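/- Let $m\ge 1$ be an integer. For $\underline a=(a_1,\dots,a_m)\in\mathbb C^m$ put $P_m(x,\underline a)=x^m+a_1x^{m-1}+\dots+a_m$ and consider the equation $$(\mathfrak E_m)\qquad \frac{d^2\Phi}{dx^2}=\frac{P_m(x,\underline a)}{x^2}\,\Phi$$ on the universal covering of $\mathbb C^*$, where $x$ has a well-defined argument $\arg x\in\mathbb R$, $\ln x=\ln|x|+i\arg x$, and $x^\alpha=\exp(\alpha\ln x)$. Let $$\frac{\sqrt{P_m(x,\underline a)}}{x}=x^{\frac m2-1}+\sum_{k\ge1}b_{\frac m2-k}(\underline a)\,x^{\frac m2-k-1}$$ be the expansion at infinity, and put $$S(x,\underline a)=\frac2m x^{\frac m2}+\sum_{1\le k<m/2}\frac{b_{\frac m2-k}(\underline a)}{\frac m2-k}x^{\frac m2-k},\qquad r(\underline a)=\begin{cases}\frac12-\frac m4&(m\text{ odd}),\\ \frac12-\frac m4-b_0(\underline a)&(m\text{ even}).\end{cases}$$ There is a unique function $\Phi_0(x,\underline a)$ which, for every $\underline a$, is an analytic solution of $(\mathfrak E_m)$ on the universal covering of $\mathbb C^*$, and which admits, in every strict sub-sector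 of $\{|\arg x|<\frac{3\pi}m\}$, an asymptotic expansion at infinity of the form $x^{r(\underline a)}e^{-S(x,\underline a)}\phi_0(x,\underline a)$, uniformly for $\underline a$ in any compact subset of $\mathbb C^m$, where $\phi_0$ has constant term $1$ and is a formal power series, with coefficients in $\mathbb C[\underline a]$, in $x^{-1/2}$ if $m$ is odd and in $x^{-1}$ if $m$ is even. Fix a sign and let $\omega=e^{\pm 2i\pi/m}$, considered on the covering as the point of modulus $1$ and argument $\pm\frac{2\pi}m$ (so that $x\mapsto\omega^m x$ adds $\pm2\pi$ to the argument). Put $\lambda\cdot\underline a=(\lambda a_1,\dots,\lambda^m a_m)$ for $\lambda\in\mathbb C$ and $\Phi_k(x,\underline a)=\Phi_0(\omega^kx,\omega^k\cdot\underline a)$ for $k\in\mathbb Z$. For all $k\in\mathbb Z$ and $\underline a\in\mathbb C^m$ there are unique numbers $C_k(\underline a),\tilde C_k(\underline a)$ (the Stokes–Sibuya coefficients) and a unique $2\times2$ complex matrix $\mathfrak M_k^\infty(\underline a)$ (the $\infty$-monodromy matrix) such that, for all $x$ in the covering, $$\Phi_{k-1}(x,\underline a)=C_k(\underline a)\Phi_k(x,\underline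 a)+\tilde C_k(\underline a)\Phi_{k+1}(x,\underline a),\qquad \begin{pmatrix}\Phi_{k-1}\\ \Phi_k\end{pmatrix}(\omega^mx,\underline a)=\mathfrak M_k^\infty(\underline a)\begin{pmatrix}\Phi_{k-1}\\ \Phi_k\end{pmatrix}(x,\underline a).$$ Let $\mathfrak S_k(\underline a)=\begin{pmatrix}C_k(\underline a)&\tilde C_k(\underline a)\\1&0\end{pmatrix}$ (the Stokes–Sibuya connection matrices). Theorem 2.9. For every $k\in\mathbb Z$, the matrix $\mathfrak M_k^\infty(\underline a)$ is invertible for every $\underline a\in\mathbb C^m$, its entries are entire functions of $\underline a$, and $$\mathfrak M_k^\infty(\underline a)=\mathfrak M_0^\infty(\omega^k\cdot\underline a).$$ Furthermore, for every $\underline a\in\mathbb C^m$, $$\mathfrak S_0(\underline a)\,\mathfrak S_1(\underline a)\cdots\mathfrak S_{m-1}(\underline a)=\bigl(\mathfrak M_0^\infty(\underline a)\bigr)^{-1}.$$ -/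

import Mathlib

namespace StokesSibuya

noncomputable section

/-!
The universal covering of the punctured plane is identified with the complex plane through
`t ↦ x = exp t`, so that `|x| = exp t.re`, the argument of `x` is `t.im`, and the power `x ^ α`
(with `ln x` real for argument zero) is `exp (α * t)`.  The parameter vector `(a_1, …, a_m)` is a
function on `Fin m`, the entry `a_j` being the value at the index `j - 1`.
-/

/-- The monic polynomial `P_m(x, a) = x ^ m + a_1 x ^ (m - 1) + ⋯ + a_m`. -/
def P (m : ℕ) (a : Fin m → ℂ) (x : ℂ) : ℂ :=
  x ^ m + ∑ i : Fin m, a i * x ^ (m - 1 - (i : ℕ))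

/-- The coefficient of `x ^ (-n)` in `x ^ (-m) P_m(x, a) = 1 + a_1 x ^ (-1) + ⋯ + a_m x ^ (-m)`. -/
def revCoeff (m : ℕ) (a : Fin m → ℂ) : ℕ → ℂ
  | 0 => 1
  | n + 1 => if h : n < m then a ⟨n, h⟩ else 0

/-- The coefficients of the expansion at infinity of the square root
`(1 + a_1 x ^ (-1) + ⋯ + a_m x ^ (-m)) ^ (1 / 2)` (branch equal to `1` at infinity) in powers of
`x ^ (-1)`.  Thus the coefficient of `x ^ (m / 2 - k - 1)` in the expansion of
`(1 / x) * sqrt (P_m(x, a))`, which is denoted by `b` with index `m / 2 - k`, is `sqrtCoeff m a k`;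
compare `sqrtCoeff_sq` below. -/
def sqrtCoeff (m : ℕ) (a : Fin m → ℂ) : ℕ → ℂ
  | 0 => 1
  | n + 1 => (revCoeff m a (n + 1) -
      ∑ i : Fin n, sqrtCoeff m a ((i : ℕ) + 1) * sqrtCoeff m a (n - (i : ℕ))) / 2
  decreasing_by
    all_goals (have := i.2; omega)

/-- The series `∑ k, sqrtCoeff m a k * X ^ k` is a square root of
`1 + a_1 X + ⋯ + a_m X ^ m`. -/
theorem sqrtCoeff_sq (m : ℕ) (a : Fin m → ℂ) :
    (PowerSeries.mk (sqrtCoeff m a)) ^ 2 = PowerSeries.mk (revCoeff m a) := by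
  ext n
  rw [sq, PowerSeries.coeff_mul, PowerSeries.coeff_mk]
  simp only [PowerSeries.coeff_mk]
  rw [Finset.Nat.sum_antidiagonal_eq_sum_range_succ
    (fun i j => sqrtCoeff m a i * sqrtCoeff m a j)]
  cases n with
  | zero => simp [sqrtCoeff, revCoeff]
  | succ n =>
    rw [Finset.sum_range_succ, Finset.sum_range_succ']
    have h : ∑ k ∈ Finset.range n, sqrtCoeff m a (k + 1) * sqrtCoeff m a (n + 1 - (k + 1)) =
        ∑ i : Fin n, sqrtCoeff m a ((i : ℕ) + 1) * sqrtCoeff m a (n - (i : ℕ)) := by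
      rw [Finset.sum_range]
      refine Finset.sum_congr rfl fun i _ => ?_
      rw [Nat.add_sub_add_right]
    have h0 : sqrtCoeff m a 0 = 1 := by rw [sqrtCoeff]
    rw [h]
    simp only [Nat.sub_zero, Nat.sub_self, h0]
    rw [sqrtCoeff]
    ring

/-- The function `S(x, a)`, i.e. `(2 / m) x ^ (m / 2)` plus the sum of the terms
`b / (m / 2 - k) * x ^ (m / 2 - k)` (with `b` of index `m / 2 - k`) over the integers `k`
with `1 ≤ k < m / 2`, at the point of the covering with coordinate `t`. -/
def S (m : ℕ) (a : Fin m → ℂ) (t : ℂ) : ℂ :=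
  2 / (m : ℂ) * Complex.exp ((m : ℂ) / 2 * t) +
    ∑ k ∈ Finset.Icc 1 ((m - 1) / 2),
      sqrtCoeff m a k / ((m : ℂ) / 2 - (k : ℂ)) * Complex.exp (((m : ℂ) / 2 - (k : ℂ)) * t)

/-- The exponent `r(a)`: it is `1 / 2 - m / 4` for odd `m`, and `1 / 2 - m / 4 - b_0(a)` for even
`m`. -/
def r (m : ℕ) (a : Fin m → ℂ) : ℂ :=
  1 / 2 - (m : ℂ) / 4 - (if Even m then sqrtCoeff m a (m / 2) else 0)

/-- The series `φ_0` runs over the powers of `x ^ (-step)`: `x ^ (-1)` for even `m`, and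
`x ^ (-1 / 2)` for odd `m`. -/
def step (m : ℕ) : ℝ := if Even m then 1 else 1 / 2

/-- The derivation `d/dx` on the covering, in the coordinate `t` with `x = exp t`. -/
def dx (f : ℂ → ℂ) (t : ℂ) : ℂ := Complex.exp (-t) * deriv f t

/-- Analytic solutions, on the universal covering of the punctured plane, of the equation
`d²Φ/dx² = (P_m(x, a) / x ^ 2) Φ`. -/
def IsSolution (m : ℕ) (a : Fin m → ℂ) (f : ℂ → ℂ) : Prop :=
  Differentiable ℂ f ∧
    ∀ t : ℂ, dx (dx f) t = P m a (Complex.exp t) / Complex.exp t ^ 2 * f t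

/-- `Φ` is the solution `Φ_0(x, a)`: for every `a` it solves the equation, and it admits an
asymptotic expansion `x ^ r(a) * exp (-S(x, a)) * φ_0(x, a)` at infinity in every strict sub-sector
of the sector `|arg x| < 3π / m`, uniformly for `a` in the compact sets, where `φ_0` is a formal
series in `x ^ (-1 / 2)` (`m` odd) or `x ^ (-1)` (`m` even), whose coefficients are polynomials in
`a` and whose constant term is `1`. -/
structure IsSubdominantSolution (m : ℕ) (Φ : ℂ → (Fin m → ℂ) → ℂ) : Prop where
  isSolution : ∀ a : Fin m → ℂ, IsSolution m a (fun t => Φ t a)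
  asymptotic : ∃ φ : ℕ → MvPolynomial (Fin m) ℂ, φ 0 = 1 ∧
    ∀ θ : ℝ, θ < 3 * Real.pi / m → ∀ K : Set (Fin m → ℂ), IsCompact K → ∀ N : ℕ,
      ∃ C R : ℝ, ∀ a ∈ K, ∀ t : ℂ, |t.im| ≤ θ → R ≤ t.re →
        ‖Φ t a / (Complex.exp (r m a * t) * Complex.exp (-S m a t)) -
            ∑ n ∈ Finset.range N,
              MvPolynomial.eval a (φ n) * Complex.exp (-((step m : ℂ) * (n : ℂ) * t))‖
          ≤ C * Real.exp (-(step m * (N : ℝ) * t.re))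

/-- The solution `Φ_0(x, a)`. -/
def Φ₀ (m : ℕ) : ℂ → (Fin m → ℂ) → ℂ :=
  Classical.epsilon (IsSubdominantSolution m)

/-- The coordinate of `ω = exp (± 2πi / m)`, as a point of the covering of argument `± 2π / m`;
the sign is `ε`. -/
def logω (m : ℕ) (ε : ℤ) : ℂ := (ε : ℂ) * (2 * (Real.pi : ℂ) * Complex.I / (m : ℂ))

/-- The number `ω = exp (± 2πi / m)`. -/
def ω (m : ℕ) (ε : ℤ) : ℂ := Complex.exp (logω m ε)

/-- The quasi-homogeneous action `c · a = (c a_1, …, c ^ m a_m)`. -/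
def qsmul {m : ℕ} (c : ℂ) (a : Fin m → ℂ) : Fin m → ℂ :=
  fun i => c ^ ((i : ℕ) + 1) * a i

/-- `Φ_k(x, a) = Φ_0(ω ^ k x, ω ^ k · a)`; multiplication by `ω ^ k` on the covering is the
translation by `k * logω`. -/
def Φk (m : ℕ) (ε : ℤ) (k : ℤ) (t : ℂ) (a : Fin m → ℂ) : ℂ :=
  Φ₀ m (t + (k : ℂ) * logω m ε) (qsmul (ω m ε ^ k) a)

/-- The column vector with entries `Φ_{k-1}(x, a)` and `Φ_k(x, a)`. -/
def Φvec (m : ℕ) (ε : ℤ) (k : ℤ) (t : ℂ) (a : Fin m → ℂ) : Fin 2 → ℂ :=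
  ![Φk m ε (k - 1) t a, Φk m ε k t a]

/-- The relation `Φ_{k-1} = c.1 Φ_k + c.2 Φ_{k+1}` that defines the Stokes-Sibuya coefficients. -/
def IsStokesCoeffs (m : ℕ) (ε : ℤ) (k : ℤ) (a : Fin m → ℂ) (c : ℂ × ℂ) : Prop :=
  ∀ t : ℂ, Φk m ε (k - 1) t a = c.1 * Φk m ε k t a + c.2 * Φk m ε (k + 1) t a

/-- The Stokes-Sibuya coefficients of `Φ_{k-1}` associated with `Φ_k` and `Φ_{k+1}`. -/
def stokesCoeffs (m : ℕ) (ε : ℤ) (k : ℤ) (a : Fin m → ℂ) : ℂ × ℂ :=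
  Classical.epsilon (IsStokesCoeffs m ε k a)

/-- The Stokes-Sibuya connection matrix. -/
def stokesMatrix (m : ℕ) (ε : ℤ) (k : ℤ) (a : Fin m → ℂ) : Matrix (Fin 2) (Fin 2) ℂ :=
  !![(stokesCoeffs m ε k a).1, (stokesCoeffs m ε k a).2; 1, 0]

/-- The relation that defines the monodromy matrix at infinity; multiplication by `ω ^ m` on the
covering is the translation by `m * logω`. -/
def IsMonodromyMatrix (m : ℕ) (ε : ℤ) (k : ℤ) (a : Fin m → ℂ)
    (M : Matrix (Fin 2) (Fin 2) ℂ) : Prop :=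
  ∀ t : ℂ, Φvec m ε k (t + (m : ℂ) * logω m ε) a = M.mulVec (Φvec m ε k t a)

/-- The `∞`-monodromy matrix. -/
def monodromyMatrix (m : ℕ) (ε : ℤ) (k : ℤ) (a : Fin m → ℂ) : Matrix (Fin 2) (Fin 2) ℂ :=
  Classical.epsilon (IsMonodromyMatrix m ε k a)

end

end StokesSibuya

/-! Once Φ_0 is known to exist, to be unique and to be holomorphic in a, the statements about
matrices are linear algebra in a two-dimensional solution space.

Construction of Φ_0. In t = ln x the equation is a linear system with entire coefficients, so it has
an entire basis depending holomorphically on a (`exists_fundamental`). Write Φ = x^r e^{-S} U and y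
= e^{-ib} x^{m/2}. Then U'' = B U' - k U, where B tends to (4/m) e^{ib} and k is O(|y|^{-1-e}) with
e = 1/`pole m`. If cos b > 0, Re B is bounded below near infinity, and a Volterra equation
integrated along the rays y + s, s ≥ 0, has a solution with U → 1 (`exists_normalized_solution`).
These rays never leave the complement of a wedge around the negative axis; since the wedge may be
thin, U is controlled for |arg y| ≤ π - δ. Comparison with the formal series
(`exists_formal_solution`, `norm_le_of_ode`) gives the full expansion, and Wronskians with the
entire basis continue the solution to the whole covering (`exists_local_solution`). Letting b
approach ±π/2 covers |(m/2) arg x| < 3π/2, which is the sector |arg x| < 3π/m.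

Uniqueness (`IsNormalized.unique`). Two solutions equivalent to x^r e^{-S} near the positive axis,
where this factor decays, have Wronskian tending to 0, hence equal to 0; they are proportional with
ratio 1. Therefore the solutions built for different b and different balls of parameters agree, and
the sectors and the holomorphy in a can be glued.

Connection matrices. As P_m(cx, c·a) = P_m(x, a) when c^m = 1, each Φ_k is a solution. On a ray
where Φ_0 is dominant, Φ_1 is subdominant, so consecutive Φ_k form a basis (`indep_Φ₀`, `indep_Φk`).
Since ω^m · a = a, going around infinity replaces the index k by k + m, and 𝔖_0 ⋯ 𝔖_{m-1} expresses
the pair of index 0 through the pair of index m. The product is thus a left inverse of 𝔐_0. Rotating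
the parameters gives the other indices, and Cramer's rule gives entire entries. -/

namespace StokesSibuya

open MeasureTheory Filter Topology Set

/-! ### Holomorphy in several variables: limits, integrals and Neumann series. -/

section Holomorphy

variable {E : Type*} [NormedAddCommGroup E] [NormedSpace ℂ E]

/-- Cauchy estimate for the Fréchet derivative of a function of several complex variables. -/
theorem norm_fderiv_le_of_ball {f : E → ℂ} {p : E} {r C : ℝ} (hr : 0 < r) (hC : 0 ≤ C)
    (hf : DifferentiableOn ℂ f (Metric.ball p r)) (hb : ∀ q ∈ Metric.ball p r, ‖f q‖ ≤ C) :
    ‖fderiv ℂ f p‖ ≤ 2 * C / r := by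
  refine ContinuousLinearMap.opNorm_le_bound _ (by positivity) fun v => ?_
  rcases eq_or_ne v 0 with rfl | hv
  · simp
  have hv' : 0 < ‖v‖ := norm_pos_iff.mpr hv
  -- Restriction to the complex line through p in direction v. The one-variable Cauchy estimate is
  -- used on a circle of half the available radius, whence the factor 2.
  set g : ℂ → ℂ := fun z => f (p + z • v) with hg
  have hmem : ∀ z : ℂ, ‖z‖ < r / ‖v‖ → p + z • v ∈ Metric.ball p r := by
    intro z hz
    rw [Metric.mem_ball, dist_eq_norm, add_sub_cancel_left, norm_smul]
    rwa [lt_div_iff₀ hv'] at hz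
  have hd : ∀ z : ℂ, ‖z‖ < r / ‖v‖ → HasDerivAt g (fderiv ℂ f (p + z • v) v) z := by
    intro z hz
    have h1 : HasFDerivAt f (fderiv ℂ f (p + z • v)) (p + z • v) :=
      (hf.differentiableAt (Metric.isOpen_ball.mem_nhds (hmem z hz))).hasFDerivAt
    have h2 : HasDerivAt (fun z : ℂ => p + z • v) v z := by
      simpa using ((hasDerivAt_id z).smul_const v).const_add p
    exact h1.comp_hasDerivAt z h2
  have hρ : 0 < r / (2 * ‖v‖) := by positivity
  have hρ' : r / (2 * ‖v‖) < r / ‖v‖ := by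
    apply div_lt_div_of_pos_left hr hv'; linarith
  have h0 := hd 0 (by simpa using div_pos hr hv')
  have hle : ‖deriv g 0‖ ≤ C / (r / (2 * ‖v‖)) := by
    refine Complex.norm_deriv_le_of_forall_mem_sphere_norm_le hρ ?_ ?_
    · refine DifferentiableOn.diffContOnCl fun z hz => ?_
      rw [closure_ball _ hρ.ne', mem_closedBall_zero_iff] at hz
      exact (hd z (hz.trans_lt hρ')).differentiableAt.differentiableWithinAt
    · intro z hz
      rw [mem_sphere_zero_iff_norm] at hz
      exact hb _ (hmem z (hz ▸ hρ'))
  rw [h0.deriv] at hle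
  simp only [zero_smul, add_zero] at hle
  refine hle.trans (le_of_eq ?_)
  field_simp

/-- A pointwise limit of functions which are holomorphic and Cauchy with respect to locally uniform
bounds is holomorphic. -/
theorem differentiableOn_of_locally_uniform_bound {Ω : Set E} (hΩ : IsOpen Ω) {F : ℕ → E → ℂ}
    {f : E → ℂ} (hF : ∀ n, DifferentiableOn ℂ (F n) Ω)
    (hb : ∀ p ∈ Ω, ∃ r > 0, ∃ δ : ℕ → ℝ, Tendsto δ atTop (𝓝 0) ∧
      ∀ n, ∀ q ∈ Metric.ball p r, ‖F n q - f q‖ ≤ δ n) : DifferentiableOn ℂ f Ω := by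
  intro p hp
  obtain ⟨r₁, hr₁, δ, hδ, hle⟩ := hb p hp
  obtain ⟨r₂, hr₂, hsub⟩ := Metric.isOpen_iff.mp hΩ p hp
  set r := min r₁ r₂ with hr
  have hr0 : 0 < r := lt_min hr₁ hr₂
  have hlim : ∀ q ∈ Metric.ball p (r / 2), Tendsto (fun n => F n q) atTop (𝓝 (f q)) := by
    intro q hq
    rw [tendsto_iff_norm_sub_tendsto_zero]
    refine squeeze_zero (fun _ => norm_nonneg _) (fun n => hle n q ?_) hδ
    exact Metric.ball_subset_ball (by have := min_le_left r₁ r₂; linarith) hq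
  have hball : ∀ q ∈ Metric.ball p (r / 2), Metric.ball q (r / 2) ⊆ Metric.ball p r := by
    intro q hq
    refine Metric.ball_subset_ball' ?_
    rw [Metric.mem_ball] at hq; linarith
  have hdiff : ∀ n, ∀ q ∈ Metric.ball p r, DifferentiableAt ℂ (F n) q := fun n q hq =>
    (hF n).differentiableAt (hΩ.mem_nhds
      (hsub (Metric.ball_subset_ball (min_le_right _ _) hq)))
  have hδ0 : ∀ n, 0 ≤ δ n := fun n =>
    (norm_nonneg _).trans (hle n p (Metric.mem_ball_self hr₁))
  have hcau : ∀ n k, ∀ q ∈ Metric.ball p (r / 2),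
      ‖fderiv ℂ (F n) q - fderiv ℂ (F k) q‖ ≤ 2 * (δ n + δ k) / (r / 2) := by
    intro n k q hq
    have hq' : q ∈ Metric.ball p r := Metric.ball_subset_ball (by linarith) hq
    rw [← fderiv_fun_sub (hdiff n q hq') (hdiff k q hq')]
    refine norm_fderiv_le_of_ball (by positivity) (add_nonneg (hδ0 n) (hδ0 k)) ?_ ?_
    · intro x hx
      exact ((hdiff n x (hball q hq hx)).sub (hdiff k x (hball q hq hx))).differentiableWithinAt
    · intro x hx
      have hx1 := Metric.ball_subset_ball (min_le_left _ _) (hball q hq hx)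
      calc ‖F n x - F k x‖ = ‖(F n x - f x) - (F k x - f x)‖ := by congr 1; ring
        _ ≤ _ := (norm_sub_le _ _).trans (add_le_add (hle n x hx1) (hle k x hx1))
  have hunif : UniformCauchySeqOn (fun n => fderiv ℂ (F n)) atTop (Metric.ball p (r / 2)) := by
    rw [Metric.uniformCauchySeqOn_iff]
    intro ε hε
    have h1 : ∀ᶠ n in atTop, δ n < ε * r / 16 := hδ.eventually_lt_const (by positivity)
    obtain ⟨N, hN⟩ := eventually_atTop.mp h1
    refine ⟨N, fun n hn k hk q hq => ?_⟩
    rw [dist_eq_norm]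
    refine (hcau n k q hq).trans_lt ?_
    rw [div_lt_iff₀ (by positivity)]
    have := hN n hn
    have := hN k hk
    nlinarith
  have hex : ∀ q ∈ Metric.ball p (r / 2), ∃ g', Tendsto (fun n => fderiv ℂ (F n) q) atTop (𝓝 g') :=
    fun q hq => cauchySeq_tendsto_of_complete (hunif.cauchySeq hq)
  choose! g' hg' using hex
  have huni : TendstoUniformlyOn (fun n => fderiv ℂ (F n)) g' atTop (Metric.ball p (r / 2)) :=
    hunif.tendstoUniformlyOn_of_tendsto fun q hq => hg' q hq
  exact (hasFDerivAt_of_tendstoUniformlyOn Metric.isOpen_ball huni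
    (fun n q hq => (hdiff n q (Metric.ball_subset_ball (by linarith) hq)).hasFDerivAt) hlim
    (Metric.mem_ball_self (by positivity))).differentiableAt.differentiableWithinAt

/-- A continuous linear map valued function on a finite dimensional space is strongly measurable if
its values at vectors are. -/
theorem aestronglyMeasurable_of_apply [FiniteDimensional ℂ E] {α : Type*} [MeasurableSpace α]
    {μ : Measure α} {L : α → E →L[ℂ] ℂ} (h : ∀ v, AEStronglyMeasurable (fun s => L s v) μ) :
    AEStronglyMeasurable L μ := by
  let b := Module.finBasis ℂ E
  have : L = fun s => ∑ i, L s (b i) • (LinearMap.toContinuousLinearMap (b.coord i)) := by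
    funext s
    ext v
    simp only [_root_.sum_apply, _root_.smul_apply,
      LinearMap.coe_toContinuousLinearMap', Module.Basis.coord_apply, smul_eq_mul]
    conv_lhs => rw [← b.sum_repr v, map_sum]
    simp [mul_comm]
  rw [this]
  exact Finset.aestronglyMeasurable_fun_sum _ fun i _ => (h (b i)).smul_const _

/-- A dominated integral of a family of holomorphic functions is holomorphic. -/
theorem differentiableOn_integral [FiniteDimensional ℂ E] {α : Type*} [MeasurableSpace α]
    {μ : Measure α} {Ω : Set E} (hΩ : IsOpen Ω) {F : E → α → ℂ}
    (hF : ∀ᵐ s ∂μ, DifferentiableOn ℂ (fun p => F p s) Ω)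
    (hm : ∀ p ∈ Ω, AEStronglyMeasurable (F p) μ)
    (hb : ∀ p ∈ Ω, ∃ r > 0, ∃ g : α → ℝ, Integrable g μ ∧
      ∀ᵐ s ∂μ, ∀ q ∈ Metric.ball p r, ‖F q s‖ ≤ g s) :
    DifferentiableOn ℂ (fun p => ∫ s, F p s ∂μ) Ω := by
  intro p hp
  obtain ⟨r₁, hr₁, g, hg, hle⟩ := hb p hp
  obtain ⟨r₂, hr₂, hsub⟩ := Metric.isOpen_iff.mp hΩ p hp
  set r := min r₁ r₂ with hr
  have hr0 : 0 < r := lt_min hr₁ hr₂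
  have hball : ∀ q ∈ Metric.ball p (r / 2), Metric.ball q (r / 2) ⊆ Metric.ball p r := by
    intro q hq
    refine Metric.ball_subset_ball' ?_
    rw [Metric.mem_ball] at hq; linarith
  have hr2 : Metric.ball p r ⊆ Ω := (Metric.ball_subset_ball (min_le_right _ _)).trans hsub
  have hdiff : ∀ᵐ s ∂μ, ∀ q ∈ Metric.ball p r, DifferentiableAt ℂ (fun p => F p s) q := by
    filter_upwards [hF] with s hs q hq
    exact hs.differentiableAt (hΩ.mem_nhds (hr2 hq))
  -- Each directional derivative is an almost everywhere limit of difference quotients with steps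
  -- 1/n, which are measurable in s.
  have hmeas : AEStronglyMeasurable (fun s => fderiv ℂ (fun p => F p s) p) μ := by
    refine aestronglyMeasurable_of_apply fun v => ?_
    have hc : Tendsto (fun n : ℕ => ‖(n : ℂ)‖) atTop atTop := by
      simpa using tendsto_natCast_atTop_atTop (R := ℝ)
    have hinv : Tendsto (fun n : ℕ => p + (n : ℂ)⁻¹ • v) atTop (𝓝 p) := by
      have h1 : Tendsto (fun n : ℕ => (n : ℂ)⁻¹) atTop (𝓝 0) := tendsto_inv_atTop_nhds_zero_nat
      simpa using (h1.smul_const v).const_add p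
    obtain ⟨N, hN⟩ := eventually_atTop.mp (hinv.eventually (hΩ.mem_nhds hp))
    refine aestronglyMeasurable_of_tendsto_ae (u := atTop)
      (f := fun n : ℕ => fun s => ((n + N : ℕ) : ℂ) •
        (F (p + ((n + N : ℕ) : ℂ)⁻¹ • v) s - F p s)) (fun n => ?_) ?_
    · have h1 := (hm _ (hN (n + N) (Nat.le_add_left N n))).sub (hm p hp)
      exact h1.const_smul ((n + N : ℕ) : ℂ)
    · filter_upwards [hdiff] with s hs
      exact ((hs p (Metric.mem_ball_self hr0)).hasFDerivAt.lim v hc).comp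
        (tendsto_add_atTop_nat N)
  have key := hasFDerivAt_integral_of_dominated_of_fderiv_le (𝕜 := ℂ) (μ := μ)
    (F := F) (F' := fun q s => fderiv ℂ (fun p => F p s) q) (x₀ := p)
    (bound := fun s => 2 * g s / (r / 2))
    (s := Metric.ball p (r / 2)) (Metric.ball_mem_nhds p (by positivity)) ?_ ?_ hmeas ?_ ?_ ?_
  · exact key.differentiableAt.differentiableWithinAt
  · filter_upwards [Metric.ball_mem_nhds p hr0] with q hq using hm q (hr2 hq)
  · refine hg.mono' (hm p hp) ?_
    filter_upwards [hle] with s hs using hs p (Metric.mem_ball_self hr₁)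
  · filter_upwards [hle, hdiff] with s hs hd q hq
    refine norm_fderiv_le_of_ball (by positivity)
      ((norm_nonneg _).trans (hs p (Metric.mem_ball_self hr₁))) ?_ ?_
    · intro x hx
      exact (hd x (hball q hq hx)).differentiableWithinAt
    · intro x hx
      exact hs x (Metric.ball_subset_ball (min_le_left _ _) (hball q hq hx))
  · exact (hg.const_mul 2).div_const _
  · filter_upwards [hdiff] with s hs q hq
    exact (hs q (Metric.ball_subset_ball (by linarith) hq)).hasFDerivAt

/-- Neumann series for an operator which preserves holomorphy on `Ω` and halves a weighted sup norm
there. -/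
theorem neumann_series {Ω : Set E} (hΩ : IsOpen Ω) {b : E → ℝ} (hb : ContinuousOn b Ω)
    (hb0 : ∀ p ∈ Ω, 0 ≤ b p) (T : (E → ℂ) → E → ℂ)
    (hT : ∀ f C, 0 ≤ C → DifferentiableOn ℂ f Ω → (∀ p ∈ Ω, ‖f p‖ ≤ C * b p) →
      DifferentiableOn ℂ (T f) Ω ∧ ∀ p ∈ Ω, ‖T f p‖ ≤ C / 2 * b p)
    (hadd : ∀ f g C, 0 ≤ C → DifferentiableOn ℂ f Ω → DifferentiableOn ℂ g Ω →
      (∀ p ∈ Ω, ‖f p‖ ≤ C * b p) → (∀ p ∈ Ω, ‖g p‖ ≤ C * b p) →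
      ∀ p ∈ Ω, T (f + g) p = T f p + T g p)
    {u₀ : E → ℂ} {C : ℝ} (hC : 0 ≤ C) (hu : DifferentiableOn ℂ u₀ Ω)
    (hu' : ∀ p ∈ Ω, ‖u₀ p‖ ≤ C * b p) :
    DifferentiableOn ℂ (fun p => ∑' n, (T^[n] u₀) p) Ω ∧
      (∀ p ∈ Ω, ‖∑' n, (T^[n] u₀) p‖ ≤ 2 * C * b p) ∧
      ∀ p ∈ Ω, ∑' n, (T^[n] u₀) p = u₀ p + T (fun p => ∑' n, (T^[n] u₀) p) p := by
  set g : ℕ → E → ℂ := fun n => T^[n] u₀ with hg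
  set u : E → ℂ := fun p => ∑' n, g n p with hudef
  have hgs : ∀ n, g (n + 1) = T (g n) := fun n => Function.iterate_succ_apply' T n u₀
  have hgn : ∀ n, DifferentiableOn ℂ (g n) Ω ∧ ∀ p ∈ Ω, ‖g n p‖ ≤ C * (1 / 2) ^ n * b p := by
    intro n
    induction n with
    | zero => exact ⟨hu, by simpa [hg] using hu'⟩
    | succ n ih =>
      rw [hgs]
      have := hT (g n) (C * (1 / 2) ^ n) (by positivity) ih.1 ih.2
      refine ⟨this.1, fun p hp => (this.2 p hp).trans (le_of_eq ?_)⟩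
      rw [pow_succ]; ring
  have hgeo : ∀ c : ℝ, HasSum (fun n : ℕ => C * (1 / 2) ^ n * c) (2 * C * c) := by
    intro c
    have := (hasSum_geometric_two.mul_left C).mul_right c
    rwa [mul_comm C 2] at this
  have hsum : ∀ p ∈ Ω, Summable (fun n => g n p) := fun p hp =>
    (hgeo (b p)).summable.of_norm_bounded fun n => (hgn n).2 p hp
  set F : ℕ → E → ℂ := fun N p => ∑ n ∈ Finset.range N, g n p with hFdef
  have hFd : ∀ N, DifferentiableOn ℂ (F N) Ω := fun N =>
    DifferentiableOn.fun_sum fun n _ => (hgn n).1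
  have hFu : ∀ N, ∀ p ∈ Ω, ‖u p - F N p‖ ≤ 2 * C * (1 / 2) ^ N * b p := by
    intro N p hp
    have h1 : u p - F N p = ∑' n, g (n + N) p := by
      rw [sub_eq_iff_eq_add, add_comm]
      exact ((hsum p hp).sum_add_tsum_nat_add N).symm
    rw [h1]
    have h2 := hgeo ((1 / 2) ^ N * b p)
    rw [← mul_assoc] at h2
    refine tsum_of_norm_bounded h2 fun n => ((hgn (n + N)).2 p hp).trans (le_of_eq ?_)
    rw [pow_add]; ring
  have hpow : Tendsto (fun n : ℕ => ((1 : ℝ) / 2) ^ n) atTop (𝓝 0) :=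
    tendsto_pow_atTop_nhds_zero_of_lt_one (by norm_num) (by norm_num)
  have hud : DifferentiableOn ℂ u Ω := by
    refine differentiableOn_of_locally_uniform_bound hΩ hFd fun p hp => ?_
    have h1 : ∀ᶠ q in 𝓝 p, q ∈ Ω ∧ b q < b p + 1 := by
      have h2 := (hb.continuousAt (hΩ.mem_nhds hp)).eventually (gt_mem_nhds (lt_add_one (b p)))
      have h3 : ∀ᶠ q in 𝓝 p, q ∈ Ω := hΩ.mem_nhds hp
      exact h3.and h2
    obtain ⟨r, hr, hr'⟩ := Metric.eventually_nhds_iff_ball.mp h1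
    refine ⟨r, hr, fun n => 2 * C * (1 / 2) ^ n * (b p + 1), ?_, fun n q hq => ?_⟩
    · simpa using (hpow.const_mul (2 * C)).mul_const (b p + 1)
    · rw [norm_sub_rev]
      exact (hFu n q (hr' q hq).1).trans
        (mul_le_mul_of_nonneg_left (hr' q hq).2.le (by positivity))
  have hub : ∀ p ∈ Ω, ‖u p‖ ≤ 2 * C * b p := fun p hp => by simpa [hFdef] using hFu 0 p hp
  refine ⟨hud, hub, fun p hp => ?_⟩
  -- Additivity of T is only assumed for pairs under a common weighted bound; the constant 4C serves
  -- for the partial sums and for the remainders.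
  have hFb : ∀ N, ∀ q ∈ Ω, ‖F N q‖ ≤ 4 * C * b q := by
    intro N q hq
    have h1 := hFu N q hq
    have h2 := hub q hq
    have h3 : ((1 : ℝ) / 2) ^ N ≤ 1 := pow_le_one₀ (by norm_num) (by norm_num)
    have h4 : 2 * C * (1 / 2) ^ N * b q ≤ 2 * C * b q := by
      have := mul_nonneg hC (hb0 q hq)
      nlinarith
    calc ‖F N q‖ = ‖u q - (u q - F N q)‖ := by rw [sub_sub_cancel]
      _ ≤ _ := norm_sub_le _ _
      _ ≤ _ := by linarith
  have hTF : ∀ N, ∀ q ∈ Ω, T (F N) q = ∑ n ∈ Finset.range N, g (n + 1) q := by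
    intro N
    induction N with
    | zero =>
      intro q hq
      have := (hT (F 0) 0 le_rfl (hFd 0) (by simp [hFdef])).2 q hq
      simpa using this
    | succ N ih =>
      intro q hq
      have h1 : F (N + 1) = F N + g N := by
        funext q; simp [hFdef, Finset.sum_range_succ]
      rw [h1, hadd (F N) (g N) (4 * C) (by positivity) (hFd N) (hgn N).1 (hFb N) ?_ q hq, ih q hq,
        Finset.sum_range_succ, hgs]
      intro x hx
      refine ((hgn N).2 x hx).trans ?_
      have h3 : ((1 : ℝ) / 2) ^ N ≤ 1 := pow_le_one₀ (by norm_num) (by norm_num)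
      have := mul_nonneg hC (hb0 x hx)
      nlinarith
  -- T is not assumed to commute with infinite sums. It is split as T F_N + T (u - F_N), and the
  -- second term is halved relative to a bound already of order 2^{-N}.
  have hlim : ∀ N, ‖u p - (u₀ p + T u p)‖ ≤ 2 * C * (1 / 2) ^ N * b p := by
    intro N
    have hd : ∀ q ∈ Ω, ‖(u - F N) q‖ ≤ (2 * C * (1 / 2) ^ N) * b q := hFu N
    have hrem := (hT (u - F N) (2 * C * (1 / 2) ^ N) (by positivity) (hud.sub (hFd N)) hd).2 p hp
    have hTu : T u p = T (F N) p + T (u - F N) p := by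
      rw [← hadd (F N) (u - F N) (4 * C) (by positivity) (hFd N) (hud.sub (hFd N)) (hFb N) ?_ p hp]
      · congr 1; abel_nf
      · intro q hq
        refine (hd q hq).trans ?_
        have h3 : ((1 : ℝ) / 2) ^ N ≤ 1 := pow_le_one₀ (by norm_num) (by norm_num)
        have := mul_nonneg hC (hb0 q hq)
        nlinarith
    have hF1 : F (N + 1) p = u₀ p + T (F N) p := by
      rw [hTF N p hp]
      simp only [hFdef]
      rw [Finset.sum_range_succ', add_comm]
      rfl
    calc ‖u p - (u₀ p + T u p)‖ = ‖(u p - F (N + 1) p) - T (u - F N) p‖ := by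
          rw [hF1, hTu]; congr 1; ring
      _ ≤ 2 * C * (1 / 2) ^ (N + 1) * b p + 2 * C * (1 / 2) ^ N / 2 * b p :=
          (norm_sub_le _ _).trans (add_le_add (hFu (N + 1) p hp) hrem)
      _ = _ := by rw [pow_succ]; ring
  have h0 : ‖u p - (u₀ p + T u p)‖ ≤ 0 := by
    refine ge_of_tendsto' (x := atTop) ?_ hlim
    simpa using (hpow.const_mul (2 * C)).mul_const (b p)
  exact sub_eq_zero.mp (norm_le_zero_iff.mp h0)

end Holomorphy

/-! ### Primitives along segments from the origin. -/

section RadialPrimitive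

variable {A : Type*} [NormedAddCommGroup A]

/-- The primitive in the first variable, vanishing at zero, by integration along a segment. -/
noncomputable def radialPrimitive (F : ℂ × A → ℂ) (p : ℂ × A) : ℂ :=
  ∫ σ in (0 : ℝ)..1, p.1 * F ((σ : ℂ) * p.1, p.2)

/-- The product of the two balls of radius `ρ` around the origin. -/
def polyball (A : Type*) [NormedAddCommGroup A] (ρ : ℝ) : Set (ℂ × A) :=
  Metric.ball 0 ρ ×ˢ Metric.ball 0 ρ

theorem isOpen_polyball (ρ : ℝ) : IsOpen (polyball A ρ) :=
  Metric.isOpen_ball.prod Metric.isOpen_ball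

theorem polyball_shrink {ρ : ℝ} {p : ℂ × A} (hp : p ∈ polyball A ρ) {σ : ℝ} (h0 : 0 ≤ σ)
    (h1 : σ ≤ 1) : ((σ : ℂ) * p.1, p.2) ∈ polyball A ρ := by
  obtain ⟨h2, h3⟩ := hp
  refine ⟨?_, h3⟩
  rw [mem_ball_zero_iff] at h2 ⊢
  simp only [norm_mul, Complex.norm_real, Real.norm_eq_abs, abs_of_nonneg h0]
  have := norm_nonneg p.1
  nlinarith

theorem radialPrimitive_congr {ρ : ℝ} {F G : ℂ × A → ℂ} (h : ∀ p ∈ polyball A ρ, F p = G p)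
    {p : ℂ × A} (hp : p ∈ polyball A ρ) : radialPrimitive F p = radialPrimitive G p := by
  unfold radialPrimitive
  refine intervalIntegral.integral_congr fun σ hσ => ?_
  rw [uIcc_of_le zero_le_one] at hσ
  simp only [h _ (polyball_shrink hp hσ.1 hσ.2)]

/-- The weight e^{L|t|} is integrated along a segment, which gains 1/L. A large L therefore makes
integration a contraction on a ball of any radius. -/
theorem norm_radialPrimitive_le {ρ : ℝ} {F : ℂ × A → ℂ} {C L : ℝ} (hL : 0 < L) (hC : 0 ≤ C)
    (hb : ∀ p ∈ polyball A ρ, ‖F p‖ ≤ C * Real.exp (L * ‖p.1‖)) :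
    ∀ p ∈ polyball A ρ, ‖radialPrimitive F p‖ ≤ C / L * Real.exp (L * ‖p.1‖) := by
  intro p hp
  have h1 : ‖radialPrimitive F p‖ ≤ ∫ σ in (0 : ℝ)..1, ‖p.1‖ * (C * Real.exp (L * (σ * ‖p.1‖))) := by
    refine intervalIntegral.norm_integral_le_of_norm_le zero_le_one ?_ ?_
    · refine Eventually.of_forall fun σ hσ => ?_
      rw [norm_mul]
      refine mul_le_mul_of_nonneg_left ((hb _ (polyball_shrink hp hσ.1.le hσ.2)).trans ?_)
        (norm_nonneg _)
      rw [norm_mul, Complex.norm_real, Real.norm_eq_abs, abs_of_nonneg hσ.1.le]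
    · exact (by fun_prop : Continuous fun σ : ℝ => ‖p.1‖ * (C * Real.exp (L * (σ * ‖p.1‖)))).intervalIntegrable _ _
  have h2 : ∫ σ in (0 : ℝ)..1, ‖p.1‖ * (C * Real.exp (L * (σ * ‖p.1‖))) =
      C / L * Real.exp (L * (1 * ‖p.1‖)) - C / L * Real.exp (L * (0 * ‖p.1‖)) := by
    refine intervalIntegral.integral_eq_sub_of_hasDerivAt (f := fun σ : ℝ => C / L * Real.exp (L * (σ * ‖p.1‖))) (fun σ _ => ?_) ?_
    · have := ((((hasDerivAt_id σ).mul_const ‖p.1‖).const_mul L).exp).const_mul (C / L)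
      refine this.congr_deriv ?_
      have hL' := hL.ne'
      simp only [id, one_mul]
      field_simp
    · exact (by fun_prop : Continuous fun σ : ℝ => ‖p.1‖ * (C * Real.exp (L * (σ * ‖p.1‖)))).intervalIntegrable _ _
  rw [h2] at h1
  refine h1.trans ?_
  have : 0 ≤ C / L := by positivity
  simp only [one_mul, zero_mul, mul_zero, Real.exp_zero]
  linarith

variable [NormedSpace ℂ A]

theorem continuousOn_radial {ρ : ℝ} {F : ℂ × A → ℂ} (hF : DifferentiableOn ℂ F (polyball A ρ))
    {p : ℂ × A} (hp : p ∈ polyball A ρ) :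
    ContinuousOn (fun σ : ℝ => p.1 * F ((σ : ℂ) * p.1, p.2)) (Icc 0 1) := by
  refine continuousOn_const.mul (hF.continuousOn.comp (by fun_prop) ?_)
  intro σ hσ
  exact polyball_shrink hp hσ.1 hσ.2

theorem radialPrimitive_add {ρ : ℝ} {F G : ℂ × A → ℂ} (hF : DifferentiableOn ℂ F (polyball A ρ))
    (hG : DifferentiableOn ℂ G (polyball A ρ)) {p : ℂ × A} (hp : p ∈ polyball A ρ) :
    radialPrimitive (fun q => F q + G q) p = radialPrimitive F p + radialPrimitive G p := by
  unfold radialPrimitive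
  rw [← intervalIntegral.integral_add]
  · simp only [mul_add]
  · exact ((continuousOn_radial hF hp).mono (by simp)).intervalIntegrable
  · exact ((continuousOn_radial hG hp).mono (by simp)).intervalIntegrable

/-- On a disc a holomorphic function has a primitive H, and the segment integral is H(z) - H(0). -/
theorem hasDerivAt_radialPrimitive {ρ : ℝ} {F : ℂ × A → ℂ}
    (hF : DifferentiableOn ℂ F (polyball A ρ)) {t : ℂ} {a : A} (hp : (t, a) ∈ polyball A ρ) :
    HasDerivAt (fun t => radialPrimitive F (t, a)) (F (t, a)) t := by
  have hs : DifferentiableOn ℂ (fun t => F (t, a)) (Metric.ball 0 ρ) := by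
    refine hF.comp (by fun_prop) fun z hz => ⟨hz, hp.2⟩
  obtain ⟨H, hH⟩ := hs.isExactOn_ball
  have heq : ∀ z ∈ Metric.ball (0 : ℂ) ρ, radialPrimitive F (z, a) = H z - H 0 := by
    intro z hz
    have hz' : (z, a) ∈ polyball A ρ := ⟨hz, hp.2⟩
    have := intervalIntegral.integral_eq_sub_of_hasDerivAt (a := 0) (b := 1)
      (f := fun σ : ℝ => H ((σ : ℂ) * z)) (f' := fun σ : ℝ => z * F ((σ : ℂ) * z, a)) ?_ ?_
    · simpa [radialPrimitive] using this
    · intro σ hσ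
      rw [uIcc_of_le zero_le_one] at hσ
      have h1 := hH _ (polyball_shrink hz' hσ.1 hσ.2).1
      have h2 : HasDerivAt (fun σ : ℝ => (σ : ℂ) * z) z σ := by
        simpa using (Complex.ofRealCLM.hasDerivAt (x := σ)).mul_const z
      have h3 := h1.comp σ h2
      rwa [mul_comm] at h3
    · exact ((continuousOn_radial hF hz').mono (by simp)).intervalIntegrable
  have h1 : HasDerivAt (fun z => H z - H 0) (F (t, a)) t := (hH t hp.1).sub_const _
  refine h1.congr_of_eventuallyEq ?_
  filter_upwards [Metric.isOpen_ball.mem_nhds hp.1] with z hz using heq z hz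

theorem differentiableOn_radialPrimitive [FiniteDimensional ℂ A] {ρ M : ℝ} {F : ℂ × A → ℂ}
    (hF : DifferentiableOn ℂ F (polyball A ρ)) (hM : ∀ p ∈ polyball A ρ, ‖F p‖ ≤ M) :
    DifferentiableOn ℂ (radialPrimitive F) (polyball A ρ) := by
  have : radialPrimitive F = fun p => ∫ σ in Ioc (0 : ℝ) 1, p.1 * F ((σ : ℂ) * p.1, p.2) := by
    funext p
    exact intervalIntegral.integral_of_le zero_le_one
  rw [this]
  refine differentiableOn_integral (isOpen_polyball ρ) ?_ ?_ ?_
  · refine (ae_restrict_iff' measurableSet_Ioc).mpr (Eventually.of_forall fun σ hσ => ?_)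
    refine differentiableOn_fst.mul (hF.comp (by fun_prop) ?_)
    intro p hp
    exact polyball_shrink hp hσ.1.le hσ.2
  · intro p hp
    exact ((continuousOn_radial hF hp).mono Ioc_subset_Icc_self).aestronglyMeasurable
      measurableSet_Ioc
  · intro p hp
    obtain ⟨r, hr, hsub⟩ := Metric.isOpen_iff.mp (isOpen_polyball ρ) p hp
    refine ⟨r, hr, fun _ => ρ * M, integrable_const _, ?_⟩
    refine (ae_restrict_iff' measurableSet_Ioc).mpr (Eventually.of_forall fun σ hσ q hq => ?_)
    have hq' := hsub hq
    rw [norm_mul]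
    have h1 := hM _ (polyball_shrink hq' hσ.1.le hσ.2)
    have h2 : ‖q.1‖ < ρ := mem_ball_zero_iff.mp hq'.1
    exact mul_le_mul h2.le h1 (norm_nonneg _) ((norm_nonneg _).trans h2.le)

end RadialPrimitive

/-! ### Global solution of linear systems with entire coefficients and parameters. -/

section LinearODE

variable {A : Type*} [NormedAddCommGroup A] [NormedSpace ℂ A] [FiniteDimensional ℂ A]

/-- Entire linear systems `f' = g v`, `v' = k f` have solutions with prescribed value at the origin,
which depend holomorphically on the parameters. -/
theorem exists_entire_solution {g k : ℂ × A → ℂ} (hg : Differentiable ℂ g)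
    (hk : Differentiable ℂ k) (f₀ v₀ : ℂ) :
    ∃ f v : ℂ × A → ℂ, Differentiable ℂ f ∧ Differentiable ℂ v ∧
      (∀ a, f (0, a) = f₀ ∧ v (0, a) = v₀) ∧
      (∀ t a, HasDerivAt (fun t => f (t, a)) (g (t, a) * v (t, a)) t) ∧
      ∀ t a, HasDerivAt (fun t => v (t, a)) (k (t, a) * f (t, a)) t := by
  have : ProperSpace A := FiniteDimensional.proper ℂ A
  -- Integrating both equations and eliminating v turns the system into the single fixed point
  -- equation f = u₀ + T f. The series below does not depend on the ball; only its estimates do.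
  set T : (ℂ × A → ℂ) → ℂ × A → ℂ := fun f =>
    radialPrimitive (fun p => g p * radialPrimitive (fun q => k q * f q) p) with hTdef
  set u₀ : ℂ × A → ℂ := fun p => f₀ + radialPrimitive (fun q => g q * v₀) p with hu₀
  set u : ℂ × A → ℂ := fun p => ∑' n, (T^[n] u₀) p with hu
  have hbd : ∀ (F : ℂ × A → ℂ), Differentiable ℂ F → ∀ ρ, ∃ M > 0, ∀ p ∈ polyball A ρ, ‖F p‖ ≤ M := by
    intro F hF ρ
    have hcomp : IsCompact (Metric.closedBall (0 : ℂ) ρ ×ˢ Metric.closedBall (0 : A) ρ) :=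
      (isCompact_closedBall _ _).prod (isCompact_closedBall _ _)
    obtain ⟨M, hM⟩ := hcomp.exists_bound_of_continuousOn hF.continuous.continuousOn
    refine ⟨max M 1, by positivity, fun p hp => (hM p ?_).trans (le_max_left _ _)⟩
    exact ⟨Metric.ball_subset_closedBall hp.1, Metric.ball_subset_closedBall hp.2⟩
  have main : ∀ ρ : ℝ, DifferentiableOn ℂ u (polyball A ρ) ∧ (∃ M, ∀ p ∈ polyball A ρ, ‖u p‖ ≤ M) ∧
      ∀ p ∈ polyball A ρ, u p = u₀ p + T u p := by
    intro ρ
    obtain ⟨G, hG0, hG⟩ := hbd g hg ρ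
    obtain ⟨K, hK0, hK⟩ := hbd k hk ρ
    -- The two nested primitives cost the factor GK/L², which this choice keeps below 1/2.
    set L := 2 * (G + K) with hL
    have hL0 : 0 < L := by positivity
    have hexp : ∀ p : ℂ × A, 1 ≤ Real.exp (L * ‖p.1‖) := fun p =>
      Real.one_le_exp (by positivity)
    have hexp' : ∀ p ∈ polyball A ρ, Real.exp (L * ‖p.1‖) ≤ Real.exp (L * ρ) := by
      intro p hp
      have : ‖p.1‖ < ρ := mem_ball_zero_iff.mp hp.1
      exact Real.exp_le_exp.mpr (by nlinarith)
    have hbound : ∀ (F : ℂ × A → ℂ) C, 0 ≤ C →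
        (∀ p ∈ polyball A ρ, ‖F p‖ ≤ C * Real.exp (L * ‖p.1‖)) →
        ∀ p ∈ polyball A ρ, ‖F p‖ ≤ C * Real.exp (L * ρ) := fun F C hC h p hp =>
      (h p hp).trans (mul_le_mul_of_nonneg_left (hexp' p hp) hC)
    have hmulb : ∀ (F H : ℂ × A → ℂ) (B C : ℝ), 0 ≤ B → (∀ p ∈ polyball A ρ, ‖H p‖ ≤ B) →
        (∀ p ∈ polyball A ρ, ‖F p‖ ≤ C * Real.exp (L * ‖p.1‖)) →
        ∀ p ∈ polyball A ρ, ‖H p * F p‖ ≤ (B * C) * Real.exp (L * ‖p.1‖) := by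
      intro F H B C hB h1 h2 p hp
      rw [norm_mul, mul_assoc]
      exact mul_le_mul (h1 p hp) (h2 p hp) (norm_nonneg _) hB
    have hin : ∀ f C, 0 ≤ C → DifferentiableOn ℂ f (polyball A ρ) →
        (∀ p ∈ polyball A ρ, ‖f p‖ ≤ C * Real.exp (L * ‖p.1‖)) →
        DifferentiableOn ℂ (radialPrimitive (fun q => k q * f q)) (polyball A ρ) ∧
        ∀ p ∈ polyball A ρ, ‖radialPrimitive (fun q => k q * f q) p‖ ≤
          K * C / L * Real.exp (L * ‖p.1‖) := by
      intro f C hC hf hfb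
      have h1 := hmulb f k K C hK0.le hK hfb
      exact ⟨differentiableOn_radialPrimitive (hk.differentiableOn.mul hf)
        (hbound _ _ (by positivity) h1), norm_radialPrimitive_le hL0 (by positivity) h1⟩
    have hu₀d : DifferentiableOn ℂ u₀ (polyball A ρ) := by
      refine (differentiableOn_const _).add (differentiableOn_radialPrimitive (M := G * ‖v₀‖)
        (hg.differentiableOn.mul_const _) fun p hp => ?_)
      rw [norm_mul]
      exact mul_le_mul_of_nonneg_right (hG p hp) (norm_nonneg _)
    have hu₀b : ∀ p ∈ polyball A ρ,
        ‖u₀ p‖ ≤ (‖f₀‖ + G * ‖v₀‖ / L) * Real.exp (L * ‖p.1‖) := by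
      intro p hp
      have h1 : ∀ p ∈ polyball A ρ, ‖g p * v₀‖ ≤ G * ‖v₀‖ * Real.exp (L * ‖p.1‖) := by
        intro p hp
        rw [norm_mul]
        have h2 := mul_le_mul_of_nonneg_right (hG p hp) (norm_nonneg v₀)
        have h3 : 0 ≤ G * ‖v₀‖ := by positivity
        nlinarith [hexp p]
      have h2 := norm_radialPrimitive_le hL0 (by positivity) h1 p hp
      refine (norm_add_le _ _).trans ?_
      rw [add_mul]
      refine add_le_add ?_ h2
      nlinarith [hexp p, norm_nonneg f₀]
    have key := neumann_series (isOpen_polyball ρ) (b := fun p : ℂ × A => Real.exp (L * ‖p.1‖))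
      (by fun_prop) (fun p _ => (Real.exp_pos _).le) T ?_ ?_ (u₀ := u₀)
      (C := ‖f₀‖ + G * ‖v₀‖ / L) (by positivity) hu₀d hu₀b
    · refine ⟨key.1, ⟨_, hbound _ _ (by positivity) key.2.1⟩, key.2.2⟩
    · intro f C hC hf hfb
      obtain ⟨h1, h2⟩ := hin f C hC hf hfb
      have h3 := hmulb _ g G _ hG0.le hG h2
      refine ⟨differentiableOn_radialPrimitive (hg.differentiableOn.mul h1)
        (hbound _ _ (by positivity) h3), fun p hp =>
          (norm_radialPrimitive_le hL0 (by positivity) h3 p hp).trans ?_⟩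
      refine mul_le_mul_of_nonneg_right ?_ (Real.exp_pos _).le
      rw [div_le_div_iff₀ hL0 two_pos, mul_div_assoc', div_mul_eq_mul_div, div_le_iff₀ hL0]
      have : G * K * 2 ≤ L * L := by rw [hL]; nlinarith
      nlinarith
    · intro f h C hC hf hh hfb hhb p hp
      have e1 : ∀ q ∈ polyball A ρ, radialPrimitive (fun q => k q * (f + h) q) q =
          radialPrimitive (fun q => k q * f q) q + radialPrimitive (fun q => k q * h q) q := by
        intro q hq
        refine Eq.trans ?_
          (radialPrimitive_add (hk.differentiableOn.mul hf) (hk.differentiableOn.mul hh) hq)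
        simp only [Pi.add_apply, Pi.mul_apply, mul_add]
      refine Eq.trans ?_ (radialPrimitive_add
        (hg.differentiableOn.mul (hin f C hC hf hfb).1)
        (hg.differentiableOn.mul (hin h C hC hh hhb).1) hp)
      refine radialPrimitive_congr (fun q hq => ?_) hp
      simp only [Pi.mul_apply]
      rw [e1 q hq, mul_add]
  have hcover : ∀ p : ℂ × A, ∃ ρ, p ∈ polyball A ρ := by
    rintro ⟨t, a⟩
    refine ⟨‖t‖ + ‖a‖ + 1, mem_ball_zero_iff.mpr ?_, mem_ball_zero_iff.mpr ?_⟩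
    · linarith [norm_nonneg a]
    · linarith [norm_nonneg t]
  have hglob : ∀ F : ℂ × A → ℂ, (∀ ρ, DifferentiableOn ℂ F (polyball A ρ)) → Differentiable ℂ F := by
    intro F hF p
    obtain ⟨ρ, hρ⟩ := hcover p
    exact (hF ρ).differentiableAt ((isOpen_polyball ρ).mem_nhds hρ)
  have hud : Differentiable ℂ u := hglob u fun ρ => (main ρ).1
  have hprim : ∀ F : ℂ × A → ℂ, Differentiable ℂ F → Differentiable ℂ (radialPrimitive F) := by
    intro F hF
    refine hglob _ fun ρ => ?_
    obtain ⟨M, -, hM⟩ := hbd F hF ρ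
    exact differentiableOn_radialPrimitive hF.differentiableOn hM
  have hprim' : ∀ F : ℂ × A → ℂ, Differentiable ℂ F → ∀ t a,
      HasDerivAt (fun t => radialPrimitive F (t, a)) (F (t, a)) t := by
    intro F hF t a
    obtain ⟨ρ, hρ⟩ := hcover (t, a)
    exact hasDerivAt_radialPrimitive hF.differentiableOn hρ
  have hueq : ∀ p, u p = u₀ p + T u p := by
    intro p
    obtain ⟨ρ, hρ⟩ := hcover p
    exact (main ρ).2.2 p hρ
  have hku : Differentiable ℂ (radialPrimitive (fun q => k q * u q)) := hprim _ (hk.mul hud)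
  refine ⟨u, fun p => v₀ + radialPrimitive (fun q => k q * u q) p, hud, hku.const_add _, ?_, ?_, ?_⟩
  · intro a
    rw [hueq]
    simp [hu₀, hTdef, radialPrimitive]
  · intro t a
    have h1 := (hprim' _ (hg.mul_const v₀) t a).const_add f₀
    have h2 := hprim' _ (hg.mul hku) t a
    have h3 := h1.add h2
    rw [mul_add]
    refine h3.congr_of_eventuallyEq (Eventually.of_forall fun z => ?_)
    exact hueq (z, a)
  · intro t a
    exact (hprim' _ (hk.mul hud) t a).const_add v₀

end LinearODE

/-! ### Wronskians and the two-dimensional space of solutions. -/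

section Wronskian

/-- The Wronskian of two solutions of a first order system is constant. -/
theorem wronskian_eq {D : Set ℂ} (hD : IsOpen D) (hD' : IsPreconnected D) {g k f₁ v₁ f₂ v₂ : ℂ → ℂ}
    (hf₁ : ∀ y ∈ D, HasDerivAt f₁ (g y * v₁ y) y) (hv₁ : ∀ y ∈ D, HasDerivAt v₁ (k y * f₁ y) y)
    (hf₂ : ∀ y ∈ D, HasDerivAt f₂ (g y * v₂ y) y) (hv₂ : ∀ y ∈ D, HasDerivAt v₂ (k y * f₂ y) y)
    {x y : ℂ} (hx : x ∈ D) (hy : y ∈ D) :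
    f₁ x * v₂ x - v₁ x * f₂ x = f₁ y * v₂ y - v₁ y * f₂ y := by
  have hd : ∀ z ∈ D, HasDerivAt (fun z => f₁ z * v₂ z - v₁ z * f₂ z) 0 z := by
    intro z hz
    refine (((hf₁ z hz).mul (hv₂ z hz)).sub ((hv₁ z hz).mul (hf₂ z hz))).congr_deriv ?_
    ring
  exact hD.is_const_of_deriv_eq_zero hD'
    (fun z hz => (hd z hz).differentiableAt.differentiableWithinAt)
    (fun z hz => (hd z hz).deriv) hx hy

variable {m : ℕ} {a : Fin m → ℂ}

/-- The equation as a first order system, for a function and its derivative `v = df/dx`. -/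
def IsPair (m : ℕ) (a : Fin m → ℂ) (f v : ℂ → ℂ) : Prop :=
  ∀ t, HasDerivAt f (Complex.exp t * v t) t ∧
    HasDerivAt v (Complex.exp (-t) * P m a (Complex.exp t) * f t) t

theorem IsPair.eq_dx {f v : ℂ → ℂ} (h : IsPair m a f v) : v = dx f := by
  funext t
  rw [dx, (h t).1.deriv, ← mul_assoc, ← Complex.exp_add]
  simp

theorem IsPair.isSolution {f v : ℂ → ℂ} (h : IsPair m a f v) : IsSolution m a f := by
  refine ⟨fun t => (h t).1.differentiableAt, fun t => ?_⟩
  rw [← h.eq_dx, dx, (h t).2.deriv, Complex.exp_neg]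
  field_simp

theorem IsSolution.isPair {f : ℂ → ℂ} (h : IsSolution m a f) : IsPair m a f (dx f) := by
  intro t
  constructor
  · rw [dx, ← mul_assoc, ← Complex.exp_add]
    simpa using (h.1 t).hasDerivAt
  · have hd : DifferentiableAt ℂ (dx f) t := by
      have h1 : Differentiable ℂ (deriv f) :=
        (h.1.contDiff (n := 2)).differentiable_deriv_two
      have h2 : Differentiable ℂ (dx f) := by
        unfold dx; fun_prop
      exact h2 t
    refine hd.hasDerivAt.congr_deriv ?_
    have h1 := h.2 t
    rw [dx] at h1
    have h2 : deriv (dx f) t = Complex.exp t * (Complex.exp (-t) * deriv (dx f) t) := by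
      rw [← mul_assoc, ← Complex.exp_add]; simp
    rw [h2, h1, Complex.exp_neg]
    field_simp

theorem continuous_P_exp : Differentiable ℂ
    (fun p : ℂ × (Fin m → ℂ) => Complex.exp (-p.1) * P m p.2 (Complex.exp p.1)) := by
  unfold P; fun_prop

/-- A fundamental system of entire solutions which depends holomorphically on the parameters. -/
theorem exists_fundamental (m : ℕ) : ∃ c c' s s' : ℂ × (Fin m → ℂ) → ℂ,
    Differentiable ℂ c ∧ Differentiable ℂ c' ∧ Differentiable ℂ s ∧ Differentiable ℂ s' ∧
    (∀ a, IsPair m a (fun t => c (t, a)) (fun t => c' (t, a))) ∧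
    (∀ a, IsPair m a (fun t => s (t, a)) (fun t => s' (t, a))) ∧
    ∀ t a, c (t, a) * s' (t, a) - c' (t, a) * s (t, a) = 1 := by
  have hg : Differentiable ℂ (fun p : ℂ × (Fin m → ℂ) => Complex.exp p.1) := by fun_prop
  obtain ⟨c, c', hc, hc', hc0, hc1, hc2⟩ := exists_entire_solution hg continuous_P_exp 1 0
  obtain ⟨s, s', hs, hs', hs0, hs1, hs2⟩ := exists_entire_solution hg continuous_P_exp 0 1
  refine ⟨c, c', s, s', hc, hc', hs, hs', fun a t => ⟨hc1 t a, hc2 t a⟩,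
    fun a t => ⟨hs1 t a, hs2 t a⟩, fun t a => ?_⟩
  rw [wronskian_eq isOpen_univ isPreconnected_univ (fun y _ => hc1 y a) (fun y _ => hc2 y a)
    (fun y _ => hs1 y a) (fun y _ => hs2 y a) (mem_univ t) (mem_univ 0)]
  simp [hc0, hs0]

theorem IsPair.wronskian_eq {f₁ v₁ f₂ v₂ : ℂ → ℂ} (h₁ : IsPair m a f₁ v₁) (h₂ : IsPair m a f₂ v₂)
    (x y : ℂ) : f₁ x * v₂ x - v₁ x * f₂ x = f₁ y * v₂ y - v₁ y * f₂ y :=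
  StokesSibuya.wronskian_eq isOpen_univ isPreconnected_univ (fun t _ => (h₁ t).1)
    (fun t _ => (h₁ t).2) (fun t _ => (h₂ t).1) (fun t _ => (h₂ t).2) (mem_univ x) (mem_univ y)

/-- Since c, s have Wronskian 1, f = c·W(f, s) - s·W(f, c); both Wronskians are constant and vanish
at t₀. -/
theorem IsPair.eq_zero {f v : ℂ → ℂ} (h : IsPair m a f v) {t₀ : ℂ} (hf : f t₀ = 0)
    (hv : v t₀ = 0) (t : ℂ) : f t = 0 := by
  obtain ⟨c, c', s, s', -, -, -, -, hc, hs, hW⟩ := exists_fundamental m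
  have h1 := h.wronskian_eq (hc a) t t₀
  have h2 := h.wronskian_eq (hs a) t t₀
  have h3 := hW t a
  simp only [hf, hv, zero_mul, sub_zero] at h1 h2
  linear_combination c (t, a) * h2 - s (t, a) * h1 - f t * h3

theorem IsPair.linearComb {f₁ v₁ f₂ v₂ : ℂ → ℂ} (h₁ : IsPair m a f₁ v₁) (h₂ : IsPair m a f₂ v₂)
    (α γ : ℂ) : IsPair m a (fun t => α * f₁ t + γ * f₂ t) (fun t => α * v₁ t + γ * v₂ t) := by
  intro t
  constructor
  · refine (((h₁ t).1.const_mul α).add ((h₂ t).1.const_mul γ)).congr_deriv ?_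
    ring
  · refine (((h₁ t).2.const_mul α).add ((h₂ t).2.const_mul γ)).congr_deriv ?_
    ring

/-- Linear independence of two functions. -/
def Indep (f g : ℂ → ℂ) : Prop :=
  ∀ α γ : ℂ, (∀ t, α * f t + γ * g t = 0) → α = 0 ∧ γ = 0

/-- At a point t₁ with f₁(t₁) ≠ 0, the combination -f₂(t₁) f₁ + f₁(t₁) f₂ vanishes together with its
derivative, hence everywhere. -/
theorem IsPair.dependent_of_wronskian_eq_zero {f₁ v₁ f₂ v₂ : ℂ → ℂ} (h₁ : IsPair m a f₁ v₁)
    (h₂ : IsPair m a f₂ v₂) {t₀ : ℂ} (h : f₁ t₀ * v₂ t₀ - v₁ t₀ * f₂ t₀ = 0) : ¬ Indep f₁ f₂ := by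
  intro hi
  by_cases h0 : ∀ t, f₁ t = 0
  · have := hi 1 0 (fun t => by simp [h0 t])
    exact one_ne_zero this.1
  push Not at h0
  obtain ⟨t₁, ht₁⟩ := h0
  have h3 : f₁ t₁ * v₂ t₁ - v₁ t₁ * f₂ t₁ = 0 := (h₁.wronskian_eq h₂ t₁ t₀).trans h
  have := (h₁.linearComb h₂ (-f₂ t₁) (f₁ t₁)).eq_zero (t₀ := t₁) (by ring)
    (by linear_combination h3)
  exact ht₁ (hi _ _ this).2

/-- Two linearly independent solutions form a basis of the space of solutions. -/
theorem IsSolution.existsUnique_comb {f₁ f₂ f : ℂ → ℂ} (h₁ : IsSolution m a f₁)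
    (h₂ : IsSolution m a f₂) (hi : Indep f₁ f₂) (h : IsSolution m a f) :
    ∃! c : ℂ × ℂ, ∀ t, f t = c.1 * f₁ t + c.2 * f₂ t := by
  have hW : f₁ 0 * dx f₂ 0 - dx f₁ 0 * f₂ 0 ≠ 0 := fun h0 =>
    h₁.isPair.dependent_of_wronskian_eq_zero h₂.isPair h0 hi
  set W := f₁ 0 * dx f₂ 0 - dx f₁ 0 * f₂ 0 with hWdef
  refine ⟨((f 0 * dx f₂ 0 - dx f 0 * f₂ 0) / W, -(f 0 * dx f₁ 0 - dx f 0 * f₁ 0) / W), ?_, ?_⟩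
  · intro t
    have e1 := h.isPair.wronskian_eq h₂.isPair t 0
    have e2 := h.isPair.wronskian_eq h₁.isPair t 0
    have e3 := h₁.isPair.wronskian_eq h₂.isPair t 0
    rw [← e1, ← e2]
    rw [← hWdef] at e3
    field_simp
    rw [← e3]; ring
  · rintro ⟨c₁, c₂⟩ hc
    set d₁ := (f 0 * dx f₂ 0 - dx f 0 * f₂ 0) / W
    set d₂ := -(f 0 * dx f₁ 0 - dx f 0 * f₁ 0) / W
    have hd : ∀ t, f t = d₁ * f₁ t + d₂ * f₂ t := by
      intro t
      have e1 := h.isPair.wronskian_eq h₂.isPair t 0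
      have e2 := h.isPair.wronskian_eq h₁.isPair t 0
      have e3 := h₁.isPair.wronskian_eq h₂.isPair t 0
      simp only [d₁, d₂]
      rw [← e1, ← e2]
      rw [← hWdef] at e3
      field_simp
      rw [← e3]; ring
    have := hi (c₁ - d₁) (c₂ - d₂) fun t => by
      have h1 := hc t
      have h2 := hd t
      simp only at h1
      linear_combination h2 - h1
    rw [sub_eq_zero, sub_eq_zero] at this
    exact Prod.ext this.1 this.2

/-- Provides the nonzero determinant for Cramer's rule: values at two points suffice, so no
derivative in t has to be followed as a varies. -/
theorem Indep.exists_det_ne_zero {f g : ℂ → ℂ} (h : Indep f g) :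
    ∃ t₁ t₂, f t₁ * g t₂ - f t₂ * g t₁ ≠ 0 := by
  by_contra! h0
  have hg : ∀ t, g t = 0 := fun t₁ => by
    have := h (g t₁) (-f t₁) fun t => by linear_combination -(h0 t₁ t)
    exact this.1
  exact one_ne_zero (h 0 1 fun t => by simp [hg t]).2

end Wronskian

/-! ### The domain of the variable y: complements of wedges, stable under positive translations. -/

section Wedge

/-- The real linear gauge of a wedge around the negative axis. -/
def gauge (l : ℝ) (y : ℂ) : ℝ := l * |y.im| + y.re

/-- The complement of a wedge around the negative axis. -/
def wedge (l R : ℝ) : Set ℂ := {y | R < gauge l y}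

theorem continuous_gauge (l : ℝ) : Continuous (gauge l) := by
  unfold gauge; fun_prop

theorem isOpen_wedge (l R : ℝ) : IsOpen (wedge l R) :=
  isOpen_lt continuous_const (continuous_gauge l)

theorem gauge_add_real (l : ℝ) (y : ℂ) (s : ℝ) : gauge l (y + s) = gauge l y + s := by
  simp [gauge]; ring

theorem wedge_add_real {l R : ℝ} {y : ℂ} (hy : y ∈ wedge l R) {s : ℝ} (hs : 0 ≤ s) :
    y + s ∈ wedge l R := by
  simp only [wedge, mem_ofPred_eq, gauge_add_real] at *
  linarith

theorem wedge_mono {l R R' : ℝ} (h : R ≤ R') : wedge l R' ⊆ wedge l R :=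
  fun _ hy => lt_of_le_of_lt h hy

theorem wedge_subset_slitPlane {l R : ℝ} (hR : 0 ≤ R) : wedge l R ⊆ Complex.slitPlane := by
  intro y hy
  rw [Complex.mem_slitPlane_iff]
  by_cases h : y.im = 0
  · left
    simp only [wedge, gauge, h, mem_ofPred_eq, abs_zero, mul_zero, zero_add] at hy
    linarith
  · exact Or.inr h

theorem gauge_le {l : ℝ} (hl : 0 ≤ l) (y : ℂ) : gauge l y ≤ (1 + l) * ‖y‖ := by
  have h1 := Complex.abs_im_le_norm y
  have h2 := Complex.re_le_norm y
  have := mul_le_mul_of_nonneg_left h1 hl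
  unfold gauge; linarith

/-- The set is not convex in general, but the gauge is affine on every segment issuing from a real
point, so the set is star-shaped about R + 1. -/
theorem isPreconnected_wedge {l R : ℝ} : IsPreconnected (wedge l R) := by
  have hmem : ((R + 1 : ℝ) : ℂ) ∈ wedge l R := by simp [wedge, gauge]
  suffices h : StarConvex ℝ ((R + 1 : ℝ) : ℂ) (wedge l R) from
    (h.isPathConnected hmem).isConnected.isPreconnected
  intro y hy α γ hα hγ hs
  simp only [wedge, gauge, mem_ofPred_eq, Complex.add_im, Complex.add_re, Complex.real_smul,
    Complex.mul_im, Complex.mul_re, Complex.ofReal_re, Complex.ofReal_im, zero_mul, sub_zero,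
    add_zero, mul_zero, zero_add] at hy ⊢
  rw [abs_mul, abs_of_nonneg hγ]
  have hα' : α = 1 - γ := by linarith
  subst hα'
  rcases hγ.eq_or_lt with h | h
  · subst h; simp
  · nlinarith [mul_lt_mul_of_pos_left hy h]

end Wedge

/-! ### Integrals along horizontal rays to infinity. -/

section ShiftIntegral

variable {A : Type*}

/-- Minus the primitive in the first variable which vanishes at infinity. -/
noncomputable def shiftIntegral (F : ℂ × A → ℂ) (p : ℂ × A) : ℂ :=
  ∫ s in Ioi (0 : ℝ), F (p.1 + s, p.2)

variable {l R : ℝ} {𝒰 : Set A} {F : ℂ × A → ℂ} {b : ℂ × A → ℝ} {k : ℝ → ℝ}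

theorem shiftIntegral_add {G : ℂ × A → ℂ} {p : ℂ × A}
    (hF : IntegrableOn (fun s : ℝ => F (p.1 + s, p.2)) (Ioi 0))
    (hG : IntegrableOn (fun s : ℝ => G (p.1 + s, p.2)) (Ioi 0)) :
    shiftIntegral (fun q => F q + G q) p = shiftIntegral F p + shiftIntegral G p :=
  integral_add hF hG

theorem shiftIntegral_congr {G : ℂ × A → ℂ} (h : ∀ p ∈ wedge l R ×ˢ 𝒰, F p = G p) {p : ℂ × A}
    (hp : p ∈ wedge l R ×ˢ 𝒰) : shiftIntegral F p = shiftIntegral G p := by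
  refine setIntegral_congr_fun measurableSet_Ioi fun s hs => ?_
  exact h _ ⟨wedge_add_real hp.1 (le_of_lt hs), hp.2⟩

theorem norm_shiftIntegral_le {p : ℂ × A} (hk : IntegrableOn k (Ioi 0))
    (hb : ∀ s : ℝ, 0 < s → ‖F (p.1 + s, p.2)‖ ≤ k s) :
    ‖shiftIntegral F p‖ ≤ ∫ s in Ioi (0 : ℝ), k s :=
  norm_integral_le_of_norm_le hk
    ((ae_restrict_iff' measurableSet_Ioi).mpr (Eventually.of_forall fun s hs => hb s hs))

variable [NormedAddCommGroup A] [NormedSpace ℂ A]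

theorem _root_.DifferentiableAt.slice {F : ℂ × A → ℂ} {y : ℂ} {a : A}
    (h : DifferentiableAt ℂ F (y, a)) : DifferentiableAt ℂ (fun y => F (y, a)) y :=
  DifferentiableAt.comp (g := F) (f := fun y : ℂ => (y, a)) y h (by fun_prop)

theorem continuousOn_shift (hF : DifferentiableOn ℂ F (wedge l R ×ˢ 𝒰)) {p : ℂ × A}
    (hp : p ∈ wedge l R ×ˢ 𝒰) : ContinuousOn (fun s : ℝ => F (p.1 + s, p.2)) (Ici 0) :=
  hF.continuousOn.comp (by fun_prop) fun _ hs => ⟨wedge_add_real hp.1 hs, hp.2⟩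

theorem integrableOn_shift (hF : DifferentiableOn ℂ F (wedge l R ×ˢ 𝒰))
    (hk : IntegrableOn k (Ioi 0))
    (hb : ∀ p ∈ wedge l R ×ˢ 𝒰, ∀ s : ℝ, 0 < s → ‖F (p.1 + s, p.2)‖ ≤ b p * k s)
    {p : ℂ × A} (hp : p ∈ wedge l R ×ˢ 𝒰) :
    IntegrableOn (fun s : ℝ => F (p.1 + s, p.2)) (Ioi 0) := by
  refine (hk.const_mul (b p)).mono'
    (((continuousOn_shift hF hp).mono Ioi_subset_Ici_self).aestronglyMeasurable
      measurableSet_Ioi) ?_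
  exact (ae_restrict_iff' measurableSet_Ioi).mpr (Eventually.of_forall fun s hs => hb p hp s hs)

theorem differentiableOn_shiftIntegral [FiniteDimensional ℂ A] (h𝒰 : IsOpen 𝒰)
    (hF : DifferentiableOn ℂ F (wedge l R ×ˢ 𝒰)) (hbc : ContinuousOn b (wedge l R ×ˢ 𝒰))
    (hk : IntegrableOn k (Ioi 0)) (hk0 : ∀ s, 0 < s → 0 ≤ k s)
    (hb : ∀ p ∈ wedge l R ×ˢ 𝒰, ∀ s : ℝ, 0 < s → ‖F (p.1 + s, p.2)‖ ≤ b p * k s) :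
    DifferentiableOn ℂ (shiftIntegral F) (wedge l R ×ˢ 𝒰) := by
  have hΩ : IsOpen (wedge l R ×ˢ 𝒰) := (isOpen_wedge l R).prod h𝒰
  refine differentiableOn_integral hΩ ?_ ?_ ?_
  · refine (ae_restrict_iff' measurableSet_Ioi).mpr (Eventually.of_forall fun s hs => ?_)
    exact hF.comp (by fun_prop) fun p hp => ⟨wedge_add_real hp.1 (le_of_lt hs), hp.2⟩
  · exact fun p hp => (integrableOn_shift hF hk hb hp).aestronglyMeasurable
  · intro p hp
    have h1 : ∀ᶠ q in 𝓝 p, b q < b p + 1 :=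
      (hbc.continuousAt (hΩ.mem_nhds hp)).eventually (gt_mem_nhds (lt_add_one (b p)))
    have h2 : ∀ᶠ q in 𝓝 p, q ∈ wedge l R ×ˢ 𝒰 := hΩ.mem_nhds hp
    obtain ⟨r, hr, hr'⟩ := Metric.eventually_nhds_iff_ball.mp (h1.and h2)
    refine ⟨r, hr, fun s => (b p + 1) * k s, hk.const_mul _, ?_⟩
    refine (ae_restrict_iff' measurableSet_Ioi).mpr (Eventually.of_forall fun s hs q hq => ?_)
    have h3 := hr' q hq
    exact (hb q h3.2 s hs).trans (mul_le_mul_of_nonneg_right h3.1.le (hk0 s hs))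

/-- Holomorphy is already known, so the complex derivative can be read off one-sidedly along the ray
y + h, h ≥ 0. There the substitution s ↦ s + h reduces the claim to the fundamental theorem of
calculus. -/
theorem hasDerivAt_shiftIntegral [FiniteDimensional ℂ A] (h𝒰 : IsOpen 𝒰)
    (hF : DifferentiableOn ℂ F (wedge l R ×ˢ 𝒰)) (hbc : ContinuousOn b (wedge l R ×ˢ 𝒰))
    (hk : IntegrableOn k (Ioi 0)) (hk0 : ∀ s, 0 < s → 0 ≤ k s)
    (hb : ∀ p ∈ wedge l R ×ˢ 𝒰, ∀ s : ℝ, 0 < s → ‖F (p.1 + s, p.2)‖ ≤ b p * k s)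
    {y : ℂ} {a : A} (hy : y ∈ wedge l R) (ha : a ∈ 𝒰) :
    HasDerivAt (fun y => shiftIntegral F (y, a)) (-F (y, a)) y := by
  have hΩ : IsOpen (wedge l R ×ˢ 𝒰) := (isOpen_wedge l R).prod h𝒰
  have hp : (y, a) ∈ wedge l R ×ˢ 𝒰 := ⟨hy, ha⟩
  have hd : DifferentiableAt ℂ (fun y => shiftIntegral F (y, a)) y :=
    ((differentiableOn_shiftIntegral h𝒰 hF hbc hk hk0 hb).differentiableAt
      (hΩ.mem_nhds hp)).slice
  have hint := integrableOn_shift hF hk hb hp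
  have h1 : HasDerivWithinAt (fun h : ℝ => shiftIntegral F (y + h, a))
      (deriv (fun y => shiftIntegral F (y, a)) y) (Ici 0) 0 := by
    have h2 : HasDerivAt (fun h : ℝ => y + (h : ℂ)) 1 0 := by
      simpa using (Complex.ofRealCLM.hasDerivAt (x := (0 : ℝ))).const_add y
    have h3 : HasDerivAt (fun y => shiftIntegral F (y, a))
        (deriv (fun y => shiftIntegral F (y, a)) y) (y + ((0 : ℝ) : ℂ)) := by
      simpa using hd.hasDerivAt
    exact ((h3.comp (0 : ℝ) h2).congr_deriv (mul_one _)).hasDerivWithinAt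
  have heq : ∀ h ∈ Ici (0 : ℝ), shiftIntegral F (y + h, a) =
      shiftIntegral F (y, a) - ∫ s in (0 : ℝ)..h, F (y + s, a) := by
    intro h hh
    have e1 : shiftIntegral F (y + h, a) = ∫ s in Ioi h, F (y + s, a) := by
      have := (measurePreserving_add_right volume h).setIntegral_preimage_emb
        (measurableEmbedding_addRight h) (fun s : ℝ => F (y + s, a)) (Ioi h)
      rw [← this]
      simp only [shiftIntegral, preimage_add_const_Ioi, sub_self]
      refine setIntegral_congr_fun measurableSet_Ioi fun s _ => ?_
      simp only [Complex.ofReal_add]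
      congr 2
      ring
    rw [e1, eq_sub_iff_add_eq, add_comm]
    refine intervalIntegral.integral_interval_add_Ioi hint ?_
    exact hint.mono_set (Ioi_subset_Ioi hh)
  have h4 : HasDerivWithinAt (fun h : ℝ => shiftIntegral F (y + h, a)) (-F (y, a)) (Ici 0) 0 := by
    have hc := continuousOn_shift hF hp
    have h5 : HasDerivWithinAt (fun h : ℝ => ∫ s in (0 : ℝ)..h, F (y + s, a))
        (F (y + ((0 : ℝ) : ℂ), a)) (Ici 0) 0 :=
      intervalIntegral.integral_hasDerivWithinAt_right (by simp) (t := Ioi 0)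
        ((hc.mono Ioi_subset_Ici_self).stronglyMeasurableAtFilter_nhdsWithin
          measurableSet_Ioi 0)
        ((hc 0 self_mem_Ici).mono Ioi_subset_Ici_self)
    have h6 := h5.const_sub (shiftIntegral F (y, a))
    simp only [Complex.ofReal_zero, add_zero] at h6
    exact h6.congr heq (heq 0 self_mem_Ici)
  have := (uniqueDiffWithinAt_Ici (0 : ℝ)).eq_deriv _ h1 h4
  rw [← this]
  exact hd.hasDerivAt

theorem integrableOn_exp_decay {c : ℝ} (hc : 0 < c) :
    IntegrableOn (fun s : ℝ => Real.exp (-c * s)) (Ioi 0) :=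
  integrableOn_exp_mul_Ioi (by linarith) 0

theorem integral_exp_decay {c : ℝ} (hc : 0 < c) :
    ∫ s in Ioi (0 : ℝ), Real.exp (-c * s) = 1 / c := by
  rw [integral_exp_mul_Ioi (by linarith)]
  simp

theorem integrableOn_rpow_decay {x e : ℝ} (hx : 0 < x) (he : 0 < e) :
    IntegrableOn (fun s : ℝ => (x + s) ^ (-1 - e)) (Ioi 0) := by
  have := integrableOn_add_rpow_Ioi_of_lt (a := -1 - e) (c := 0) (m := x) (by linarith) (by linarith)
  simpa only [add_comm] using this

theorem integral_rpow_decay {x e : ℝ} (hx : 0 < x) (he : 0 < e) :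
    ∫ s in Ioi (0 : ℝ), (x + s) ^ (-1 - e) = x ^ (-e) / e := by
  have h1 : ∀ s ∈ Ici (0 : ℝ), HasDerivAt (fun s : ℝ => -((x + s) ^ (-e) / e))
      ((x + s) ^ (-1 - e)) s := by
    intro s hs
    have hs' : 0 < x + s := by have : 0 ≤ s := hs; linarith
    have h2 : HasDerivAt (fun s : ℝ => x + s) 1 s := (hasDerivAt_id s).const_add x
    have h3 := ((h2.rpow_const (p := -e) (Or.inl hs'.ne')).div_const e).neg
    refine h3.congr_deriv ?_
    have : -e - 1 = -1 - e := by ring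
    rw [this]; field_simp
  have h2 : Tendsto (fun s : ℝ => -((x + s) ^ (-e) / e)) atTop (𝓝 0) := by
    have h3 := (tendsto_rpow_neg_atTop he).comp (tendsto_atTop_add_const_left atTop x tendsto_id)
    simpa using (h3.div_const e).neg
  rw [integral_Ioi_of_hasDerivAt_of_tendsto' h1 (integrableOn_rpow_decay hx he) h2]
  simp

end ShiftIntegral

/-! ### The equation U'' = B U' - k U near infinity. -/

section Volterra

variable {l R c K e : ℝ}

/-- Along rays parallel to the positive axis, `Re β` grows at least like `c * s` if `Re β' ≥ c`. -/
theorem re_growth {β B : ℂ → ℂ} (hβ : ∀ y ∈ wedge l R, HasDerivAt β (B y) y)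
    (hB : ∀ y ∈ wedge l R, c ≤ (B y).re) {y : ℂ} (hy : y ∈ wedge l R) {s : ℝ} (hs : 0 ≤ s) :
    c * s ≤ (β (y + s)).re - (β y).re := by
  have hd : ∀ x ∈ Ici (0 : ℝ), HasDerivAt (fun x : ℝ => (β (y + x)).re) (B (y + x)).re x := by
    intro x hx
    have h1 : HasDerivAt (fun h : ℝ => y + (h : ℂ)) 1 x := by
      simpa using (Complex.ofRealCLM.hasDerivAt (x := x)).const_add y
    have h2 := (hβ _ (wedge_add_real hy hx)).comp x h1
    rw [mul_one] at h2
    exact Complex.reCLM.hasFDerivAt.comp_hasDerivAt x h2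
  have := (convex_Ici (0 : ℝ)).mul_sub_le_image_sub_of_le_deriv (f := fun x : ℝ => (β (y + x)).re)
    (C := c) (fun x hx => (hd x hx).continuousAt.continuousWithinAt)
    (fun x hx => (hd x (interior_subset hx)).differentiableAt.differentiableWithinAt)
    (fun x hx => by
      rw [(hd x (interior_subset hx)).deriv]
      exact hB _ (wedge_add_real hy (interior_subset hx))) 0 self_mem_Ici s hs hs
  simpa using this

theorem norm_exp_neg_le {β B : ℂ → ℂ} (hβ : ∀ y ∈ wedge l R, HasDerivAt β (B y) y)
    (hB : ∀ y ∈ wedge l R, c ≤ (B y).re) {y : ℂ} (hy : y ∈ wedge l R) {s : ℝ} (hs : 0 ≤ s) :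
    ‖Complex.exp (-β (y + s))‖ ≤ Real.exp (-(β y).re) * Real.exp (-c * s) := by
  rw [Complex.norm_exp, ← Real.exp_add]
  refine Real.exp_le_exp.mpr ?_
  have := re_growth hβ hB hy hs
  simp only [Complex.neg_re]
  linarith

theorem gauge_rpow_le (he : 0 < e) {y : ℂ} (hR : 0 ≤ R) (hy : y ∈ wedge l R) {s : ℝ}
    (hs : 0 ≤ s) : gauge l (y + s) ^ (-1 - e) ≤ gauge l y ^ (-1 - e) := by
  have h1 : 0 < gauge l y := lt_of_le_of_lt hR hy
  refine Real.rpow_le_rpow_of_nonpos h1 ?_ (by linarith)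
  rw [gauge_add_real]; linarith

/-- Decay of `E` from decay of `E'' - B E'`, for a coefficient with `Re B ≥ c > 0`. -/
theorem norm_le_of_ode {E W B β h : ℂ → ℂ} {H M : ℝ} (hc : 0 < c) (he : 0 < e) (hR : 0 ≤ R)
    (hE : ∀ y ∈ wedge l R, HasDerivAt E (W y) y)
    (hW : ∀ y ∈ wedge l R, HasDerivAt W (B y * W y - h y) y)
    (hβ : ∀ y ∈ wedge l R, HasDerivAt β (B y) y)
    (hB : ∀ y ∈ wedge l R, c ≤ (B y).re) (hh : ContinuousOn h (wedge l R))
    (hhb : ∀ y ∈ wedge l R, ‖h y‖ ≤ H * gauge l y ^ (-1 - e)) (hH : 0 ≤ H)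
    (hM : ∀ y ∈ wedge l R, ‖W y‖ ≤ M)
    (hlim : ∀ y ∈ wedge l R, Tendsto (fun s : ℝ => E (y + s)) atTop (𝓝 0)) :
    ∀ y ∈ wedge l R, ‖E y‖ ≤ H / c / e * gauge l y ^ (-e) := by
  have hray : ∀ y ∈ wedge l R, ∀ x : ℝ, HasDerivAt (fun h : ℝ => y + (h : ℂ)) 1 x := by
    intro y _ x
    simpa using (Complex.ofRealCLM.hasDerivAt (x := x)).const_add y
  have hcont : ∀ f : ℂ → ℂ, ContinuousOn f (wedge l R) → ∀ y ∈ wedge l R,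
      ContinuousOn (fun s : ℝ => f (y + s)) (Ici 0) := fun f hf y hy =>
    hf.comp (by fun_prop) fun s hs => wedge_add_real hy hs
  have hβc : ContinuousOn β (wedge l R) := fun y hy => (hβ y hy).continuousAt.continuousWithinAt
  have hWc : ContinuousOn W (wedge l R) := fun y hy => (hW y hy).continuousAt.continuousWithinAt
  have hWb : ∀ y ∈ wedge l R, ‖W y‖ ≤ H / c * gauge l y ^ (-1 - e) := by
    intro y hy
    have h1 : ∀ x ∈ Ici (0 : ℝ), HasDerivAt (fun x : ℝ => Complex.exp (-β (y + x)) * W (y + x))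
        (-(Complex.exp (-β (y + x)) * h (y + x))) x := by
      intro x hx
      have hx' := wedge_add_real hy hx
      have h2 := (hβ _ hx').comp x (hray y hy x)
      have h3 := (hW _ hx').comp x (hray y hy x)
      refine ((h2.neg.cexp).mul h3).congr_deriv ?_
      simp only [Function.comp, Pi.neg_apply]
      ring
    have hb : ∀ s : ℝ, 0 < s → ‖-(Complex.exp (-β (y + s)) * h (y + s))‖ ≤
        Real.exp (-(β y).re) * (H * gauge l y ^ (-1 - e)) * Real.exp (-c * s) := by
      intro s hs
      rw [norm_neg, norm_mul, mul_right_comm]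
      refine mul_le_mul (norm_exp_neg_le hβ hB hy hs.le)
        ((hhb _ (wedge_add_real hy hs.le)).trans ?_) (norm_nonneg _) (by positivity)
      exact mul_le_mul_of_nonneg_left (gauge_rpow_le he hR hy hs.le) hH
    have hint : IntegrableOn (fun s : ℝ => -(Complex.exp (-β (y + s)) * h (y + s))) (Ioi 0) := by
      refine ((integrableOn_exp_decay hc).const_mul _).mono' (ContinuousOn.aestronglyMeasurable
        ?_ measurableSet_Ioi)
        ((ae_restrict_iff' measurableSet_Ioi).mpr (Eventually.of_forall fun s hs => hb s hs))
      exact (((hcont _ hβc y hy).neg.cexp.mul (hcont _ hh y hy)).neg).mono Ioi_subset_Ici_self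
    -- The boundary term at infinity vanishes because W is bounded while e^{-β} decays; this is what
    -- excludes the growing solution e^β of W' = B W.
    have hlim0 : Tendsto (fun x : ℝ => Complex.exp (-β (y + x)) * W (y + x)) atTop (𝓝 0) := by
      have h4 : Tendsto (fun x : ℝ => Real.exp (-(β y).re) * Real.exp (-c * x) * M) atTop (𝓝 0) := by
        have h5 : Tendsto (fun x : ℝ => Real.exp (-c * x)) atTop (𝓝 0) :=
          Real.tendsto_exp_atBot.comp (tendsto_id.const_mul_atTop_of_neg (by linarith))
        simpa using (h5.const_mul (Real.exp (-(β y).re))).mul_const M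
      refine squeeze_zero_norm' ?_ h4
      filter_upwards [eventually_ge_atTop 0] with x hx
      rw [norm_mul]
      exact mul_le_mul (norm_exp_neg_le hβ hB hy hx) (hM _ (wedge_add_real hy hx)) (norm_nonneg _)
        (by positivity)
    have h6 := integral_Ioi_of_hasDerivAt_of_tendsto' h1 hint hlim0
    have h7 : ‖Complex.exp (-β y) * W y‖ ≤
        Real.exp (-(β y).re) * (H * gauge l y ^ (-1 - e)) * (1 / c) := by
      have h8 := norm_integral_le_of_norm_le ((integrableOn_exp_decay hc).const_mul
        (Real.exp (-(β y).re) * (H * gauge l y ^ (-1 - e))))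
        ((ae_restrict_iff' measurableSet_Ioi).mpr (Eventually.of_forall fun s hs => hb s hs))
      rw [h6, integral_const_mul, integral_exp_decay hc] at h8
      simpa using h8
    rw [norm_mul, Complex.norm_exp, Complex.neg_re, mul_assoc] at h7
    have h9 := le_of_mul_le_mul_left h7 (Real.exp_pos _)
    calc ‖W y‖ ≤ _ := h9
      _ = _ := by ring
  intro y hy
  have hpos : 0 < gauge l y := lt_of_le_of_lt hR hy
  have h1 : ∀ x ∈ Ici (0 : ℝ), HasDerivAt (fun x : ℝ => E (y + x)) (W (y + x)) x := by
    intro x hx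
    exact ((hE _ (wedge_add_real hy hx)).comp x (hray y hy x)).congr_deriv (mul_one _)
  have hb : ∀ s : ℝ, 0 < s → ‖W (y + s)‖ ≤ H / c * (gauge l y + s) ^ (-1 - e) := by
    intro s hs
    rw [← gauge_add_real]
    exact hWb _ (wedge_add_real hy hs.le)
  have hint : IntegrableOn (fun s : ℝ => W (y + s)) (Ioi 0) :=
    ((integrableOn_rpow_decay hpos he).const_mul _).mono' (ContinuousOn.aestronglyMeasurable
      ((hcont _ hWc y hy).mono Ioi_subset_Ici_self) measurableSet_Ioi)
      ((ae_restrict_iff' measurableSet_Ioi).mpr (Eventually.of_forall fun s hs => hb s hs))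
  have h6 := integral_Ioi_of_hasDerivAt_of_tendsto' h1 hint (hlim y hy)
  have h8 := norm_integral_le_of_norm_le ((integrableOn_rpow_decay hpos he).const_mul (H / c))
    ((ae_restrict_iff' measurableSet_Ioi).mpr (Eventually.of_forall fun s hs => hb s hs))
  rw [h6, integral_const_mul, integral_rpow_decay hpos he] at h8
  simp only [Complex.ofReal_zero, add_zero, zero_sub, norm_neg] at h8
  calc ‖E y‖ ≤ _ := h8
    _ = _ := by ring

variable {A : Type*} [NormedAddCommGroup A] [NormedSpace ℂ A] [FiniteDimensional ℂ A]

/-- Existence of the solution tending to `1` at infinity of `U'' = B U' - k U`, as a first order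
system, for small `k` and `Re B ≥ c > 0`. -/
theorem exists_normalized_solution {R₀ : ℝ} {𝒰 : Set A} (h𝒰 : IsOpen 𝒰) {β B k : ℂ × A → ℂ}
    (hc : 0 < c) (he : 0 < e) (hK : 0 ≤ K)
    (hβd : DifferentiableOn ℂ β (wedge l R₀ ×ˢ 𝒰)) (hkd : DifferentiableOn ℂ k (wedge l R₀ ×ˢ 𝒰))
    (hβ : ∀ y ∈ wedge l R₀, ∀ a ∈ 𝒰, HasDerivAt (fun y => β (y, a)) (B (y, a)) y)
    (hB : ∀ y ∈ wedge l R₀, ∀ a ∈ 𝒰, c ≤ (B (y, a)).re)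
    (hk : ∀ y ∈ wedge l R₀, ∀ a ∈ 𝒰, ‖k (y, a)‖ ≤ K * gauge l y ^ (-1 - e)) :
    ∃ R, R₀ ≤ R ∧ 1 ≤ R ∧ ∃ (M : ℝ) (U V : ℂ × A → ℂ), 0 ≤ M ∧
      DifferentiableOn ℂ U (wedge l R ×ˢ 𝒰) ∧ DifferentiableOn ℂ V (wedge l R ×ˢ 𝒰) ∧
      (∀ y ∈ wedge l R, ∀ a ∈ 𝒰, HasDerivAt (fun y => U (y, a)) (V (y, a)) y) ∧
      (∀ y ∈ wedge l R, ∀ a ∈ 𝒰, HasDerivAt (fun y => V (y, a))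
        (B (y, a) * V (y, a) - k (y, a) * U (y, a)) y) ∧
      (∀ y ∈ wedge l R, ∀ a ∈ 𝒰, ‖V (y, a)‖ ≤ M) ∧
      ∀ y ∈ wedge l R, ∀ a ∈ 𝒰, ‖U (y, a) - 1‖ ≤ M * gauge l y ^ (-e) := by
  -- K/(ce)·R^{-e} is the norm of the operator T below on the region beyond R: 1/c comes from
  -- integrating e^{-cs}, and 1/e from integrating a power of exponent -1-e.
  obtain ⟨R, hRR, hR1, hRs⟩ : ∃ R, R₀ ≤ R ∧ 1 ≤ R ∧ K / c / e * R ^ (-e) ≤ 1 / 2 := by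
    have h1 := (tendsto_rpow_neg_atTop he).const_mul (K / c / e)
    rw [mul_zero] at h1
    obtain ⟨R, h2, h3⟩ := ((h1.eventually_lt_const (by norm_num : (0 : ℝ) < 1 / 2)).and
      (eventually_ge_atTop (max R₀ 1))).exists
    exact ⟨R, (le_max_left _ _).trans h3, (le_max_right _ _).trans h3, h2.le⟩
  have hR0 : 0 < R := by linarith
  set Ω := wedge l R ×ˢ 𝒰 with hΩdef
  have hΩ : IsOpen Ω := (isOpen_wedge l R).prod h𝒰
  have hsub : Ω ⊆ wedge l R₀ ×ˢ 𝒰 := prod_mono (wedge_mono hRR) subset_rfl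
  replace hβd := hβd.mono hsub
  replace hkd := hkd.mono hsub
  replace hβ : ∀ y ∈ wedge l R, ∀ a ∈ 𝒰, HasDerivAt (fun y => β (y, a)) (B (y, a)) y :=
    fun y hy => hβ y (wedge_mono hRR hy)
  replace hB : ∀ y ∈ wedge l R, ∀ a ∈ 𝒰, c ≤ (B (y, a)).re := fun y hy => hB y (wedge_mono hRR hy)
  replace hk : ∀ y ∈ wedge l R, ∀ a ∈ 𝒰, ‖k (y, a)‖ ≤ K * gauge l y ^ (-1 - e) :=
    fun y hy => hk y (wedge_mono hRR hy)
  have hpos : ∀ y ∈ wedge l R, 0 < gauge l y := fun y hy => lt_trans hR0 hy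
  -- Variation of constants from infinity: U' = e^β ∫ e^{-β} k U and U = 1 - ∫ U', both integrals
  -- being taken along y + s, s ≥ 0. G and T are these two steps.
  set I : (ℂ × A → ℂ) → ℂ × A → ℂ := fun f q => Complex.exp (-β q) * (k q * f q) with hI
  set G : (ℂ × A → ℂ) → ℂ × A → ℂ := fun f p => Complex.exp (β p) * shiftIntegral (I f) p with hG
  set T : (ℂ × A → ℂ) → ℂ × A → ℂ := fun f p => -shiftIntegral (G f) p with hT
  set b : ℝ → ℂ × A → ℝ := fun C p =>
    Real.exp (-(β p).re) * (K * C * gauge l p.1 ^ (-1 - e)) with hb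
  have hbc : ∀ C, ContinuousOn (b C) Ω := by
    intro C
    have h1 : ContinuousOn (fun p : ℂ × A => (β p).re) Ω :=
      Complex.continuous_re.comp_continuousOn hβd.continuousOn
    have h2 : ContinuousOn (fun p : ℂ × A => gauge l p.1 ^ (-1 - e)) Ω := by
      refine ContinuousOn.rpow_const
        (((continuous_gauge l).comp continuous_fst).continuousOn) fun p hp => Or.inl ?_
      exact (hpos p.1 hp.1).ne'
    exact (Real.continuous_exp.comp_continuousOn h1.neg).mul (continuousOn_const.mul h2)
  have hId : ∀ f, DifferentiableOn ℂ f Ω → DifferentiableOn ℂ (I f) Ω := fun f hf =>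
    hβd.neg.cexp.mul (hkd.mul hf)
  have hIb : ∀ f C, 0 ≤ C → (∀ p ∈ Ω, ‖f p‖ ≤ C) → ∀ p ∈ Ω, ∀ s : ℝ, 0 < s →
      ‖I f (p.1 + s, p.2)‖ ≤ b C p * Real.exp (-c * s) := by
    rintro f C hC hf ⟨y, a⟩ ⟨hy, ha⟩ s hs
    have hy' := wedge_add_real hy hs.le
    have h1 := norm_exp_neg_le (fun y hy => hβ y hy a ha) (fun y hy => hB y hy a ha) hy hs.le
    have h2 := (hk _ hy' a ha).trans (mul_le_mul_of_nonneg_left (gauge_rpow_le he hR0.le hy hs.le) hK)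
    have h3 := hf (y + s, a) ⟨hy', ha⟩
    have h4 : 0 ≤ gauge l y ^ (-1 - e) := Real.rpow_nonneg (hpos y hy).le _
    simp only [hI, hb, norm_mul]
    calc _ ≤ (Real.exp (-(β (y, a)).re) * Real.exp (-c * s)) * ((K * gauge l y ^ (-1 - e)) * C) :=
          mul_le_mul h1 (mul_le_mul h2 h3 (norm_nonneg _) (by positivity)) (by positivity)
            (by positivity)
      _ = _ := by ring
  have hexpi := integrableOn_exp_decay hc
  have hexp0 : ∀ s : ℝ, 0 < s → 0 ≤ Real.exp (-c * s) := fun s _ => (Real.exp_pos _).le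
  have hGd : ∀ f C, 0 ≤ C → DifferentiableOn ℂ f Ω → (∀ p ∈ Ω, ‖f p‖ ≤ C) →
      DifferentiableOn ℂ (G f) Ω := fun f C hC hf hfb =>
    hβd.cexp.mul (differentiableOn_shiftIntegral h𝒰 (hId f hf) (hbc C) hexpi hexp0
      (hIb f C hC hfb))
  have hGb : ∀ f C, 0 ≤ C → (∀ p ∈ Ω, ‖f p‖ ≤ C) →
      ∀ p ∈ Ω, ‖G f p‖ ≤ K / c * C * gauge l p.1 ^ (-1 - e) := by
    intro f C hC hf p hp
    have h1 := norm_shiftIntegral_le (hexpi.const_mul (b C p)) (hIb f C hC hf p hp)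
    rw [integral_const_mul, integral_exp_decay hc] at h1
    simp only [hG, norm_mul, Complex.norm_exp]
    calc _ ≤ Real.exp (β p).re * (b C p * (1 / c)) := mul_le_mul_of_nonneg_left h1 (Real.exp_pos _).le
      _ = (Real.exp (β p).re * Real.exp (-(β p).re)) * (K / c * C * gauge l p.1 ^ (-1 - e)) := by
        simp only [hb]; ring
      _ = _ := by rw [← Real.exp_add]; simp
  have hGs : ∀ f C, 0 ≤ C → (∀ p ∈ Ω, ‖f p‖ ≤ C) → ∀ p ∈ Ω, ∀ s : ℝ, 0 < s →
      ‖G f (p.1 + s, p.2)‖ ≤ K / c * C * (gauge l p.1 + s) ^ (-1 - e) := by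
    intro f C hC hf p hp s hs
    have := hGb f C hC hf (p.1 + s, p.2) ⟨wedge_add_real hp.1 hs.le, hp.2⟩
    rwa [gauge_add_real] at this
  have hGs' : ∀ f C, 0 ≤ C → (∀ p ∈ Ω, ‖f p‖ ≤ C) → ∀ p ∈ Ω, ∀ s : ℝ, 0 < s →
      ‖G f (p.1 + s, p.2)‖ ≤ K / c * C * (R + s) ^ (-1 - e) := by
    intro f C hC hf p hp s hs
    refine (hGs f C hC hf p hp s hs).trans (mul_le_mul_of_nonneg_left ?_ (by positivity))
    refine Real.rpow_le_rpow_of_nonpos (by linarith) ?_ (by linarith)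
    have : R < gauge l p.1 := hp.1
    linarith
  have hRi := integrableOn_rpow_decay hR0 he
  have hRp : ∀ s : ℝ, 0 < s → 0 ≤ (R + s) ^ (-1 - e) := fun s hs => Real.rpow_nonneg (by linarith) _
  have hTb : ∀ f C, 0 ≤ C → (∀ p ∈ Ω, ‖f p‖ ≤ C) →
      ∀ p ∈ Ω, ‖T f p‖ ≤ K / c / e * C * gauge l p.1 ^ (-e) := by
    intro f C hC hf p hp
    have h0 := hpos p.1 hp.1
    have h1 := norm_shiftIntegral_le ((integrableOn_rpow_decay h0 he).const_mul (K / c * C))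
      (hGs f C hC hf p hp)
    rw [integral_const_mul, integral_rpow_decay h0 he] at h1
    simp only [hT, norm_neg]
    calc _ ≤ _ := h1
      _ = _ := by ring
  have hTd : ∀ f C, 0 ≤ C → DifferentiableOn ℂ f Ω → (∀ p ∈ Ω, ‖f p‖ ≤ C) →
      DifferentiableOn ℂ (T f) Ω := fun f C hC hf hfb =>
    (differentiableOn_shiftIntegral h𝒰 (hGd f C hC hf hfb) (b := fun _ => K / c * C)
      continuousOn_const hRi hRp (hGs' f C hC hfb)).neg
  have key := neumann_series hΩ (b := fun _ => (1 : ℝ)) continuousOn_const (fun _ _ => zero_le_one)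
    T ?_ ?_ (u₀ := fun _ => 1) (C := 1) zero_le_one (differentiableOn_const _) (by simp)
  · set U : ℂ × A → ℂ := fun p => ∑' n, (T^[n] fun _ => 1) p with hU
    obtain ⟨hUd, hUb, hUeq⟩ := key
    replace hUb : ∀ p ∈ Ω, ‖U p‖ ≤ 2 := fun p hp => (hUb p hp).trans (by norm_num)
    refine ⟨R, hRR, hR1, max (K / c * 2) (K / c / e * 2), U, G U, by positivity, hUd,
      hGd U 2 zero_le_two hUd hUb, ?_, ?_, ?_, ?_⟩
    · intro y hy a ha
      have h1 := hasDerivAt_shiftIntegral h𝒰 (hGd U 2 zero_le_two hUd hUb)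
        (b := fun _ => K / c * 2) continuousOn_const hRi hRp (hGs' U 2 zero_le_two hUb) hy ha
      have h2 := h1.neg.const_add 1
      rw [neg_neg] at h2
      refine h2.congr_of_eventuallyEq ?_
      filter_upwards [(isOpen_wedge l R).mem_nhds hy] with z hz using hUeq (z, a) ⟨hz, ha⟩
    · intro y hy a ha
      have h1 := hasDerivAt_shiftIntegral h𝒰 (hId U hUd) (hbc 2) hexpi hexp0
        (hIb U 2 zero_le_two hUb) hy ha
      refine ((hβ y hy a ha).cexp.mul h1).congr_deriv ?_
      simp only [hG, hI, Complex.exp_neg]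
      field_simp
      ring
    · intro y hy a ha
      refine (hGb U 2 zero_le_two hUb (y, a) ⟨hy, ha⟩).trans (le_trans ?_ (le_max_left _ _))
      refine mul_le_of_le_one_right (by positivity) ?_
      exact Real.rpow_le_one_of_one_le_of_nonpos (hR1.trans (le_of_lt hy)) (by linarith)
    · intro y hy a ha
      have h1 : U (y, a) - 1 = T U (y, a) := by
        have h0 : U (y, a) = 1 + T U (y, a) := hUeq (y, a) ⟨hy, ha⟩
        rw [h0]; ring
      rw [h1]
      exact (hTb U 2 zero_le_two hUb (y, a) ⟨hy, ha⟩).trans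
        (mul_le_mul_of_nonneg_right (le_max_right _ _) (Real.rpow_nonneg (hpos y hy).le _))
  · intro f C hC hf hfb
    have hfb' : ∀ p ∈ Ω, ‖f p‖ ≤ C := fun p hp => by simpa using hfb p hp
    refine ⟨hTd f C hC hf hfb', fun p hp => (hTb f C hC hfb' p hp).trans ?_⟩
    have h1 : gauge l p.1 ^ (-e) ≤ R ^ (-e) :=
      Real.rpow_le_rpow_of_nonpos hR0 (le_of_lt hp.1) (by linarith)
    have h2 : 0 ≤ K / c / e := by positivity
    have h3 := mul_le_mul_of_nonneg_left h1 h2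
    nlinarith
  · intro f g C hC hf hg hfb hgb p hp
    have hfb' : ∀ p ∈ Ω, ‖f p‖ ≤ C := fun p hp => by simpa using hfb p hp
    have hgb' : ∀ p ∈ Ω, ‖g p‖ ≤ C := fun p hp => by simpa using hgb p hp
    have e1 : ∀ q ∈ Ω, G (f + g) q = G f q + G g q := by
      intro q hq
      simp only [hG]
      rw [← mul_add, ← shiftIntegral_add (integrableOn_shift (hId f hf) hexpi (hIb f C hC hfb') hq)
        (integrableOn_shift (hId g hg) hexpi (hIb g C hC hgb') hq)]
      simp only [hI, Pi.add_apply, mul_add]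
    have hi : ∀ f, DifferentiableOn ℂ f Ω → (∀ p ∈ Ω, ‖f p‖ ≤ C) →
        IntegrableOn (fun s : ℝ => G f (p.1 + s, p.2)) (Ioi 0) := fun f hf hfb =>
      integrableOn_shift (hGd f C hC hf hfb) (b := fun _ => K / c * C) hRi (hGs' f C hC hfb) hp
    simp only [hT]
    rw [← neg_add, ← shiftIntegral_add (hi f hf hfb') (hi g hg hgb')]
    rw [shiftIntegral_congr e1 hp]

end Volterra

/-! ### The formal solution and its realization as Φ_0. -/

section PolynomialNotation

open Polynomial

/-! ### Evaluation of polynomials in z with coefficients in ℂ[a]. -/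

section Evaluation

variable {m : ℕ}

/-- Evaluation of a polynomial in `z` with coefficients in `ℂ[a]`. -/
noncomputable def ev (a : Fin m → ℂ) (z : ℂ) : (MvPolynomial (Fin m) ℂ)[X] →+* ℂ :=
  eval₂RingHom (MvPolynomial.eval a) z

@[simp] theorem ev_X (a : Fin m → ℂ) (z : ℂ) : ev a z X = z := by simp [ev]

@[simp] theorem ev_C (a : Fin m → ℂ) (z : ℂ) (p : MvPolynomial (Fin m) ℂ) :
    ev a z (C p) = MvPolynomial.eval a p := by simp [ev]

theorem ev_expand (a : Fin m → ℂ) (z : ℂ) (n : ℕ) (F : (MvPolynomial (Fin m) ℂ)[X]) :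
    ev a z (expand _ n F) = ev a (z ^ n) F := by
  simp only [ev, coe_eval₂RingHom, eval₂_eq_eval_map, map_expand, expand_eval]

theorem hasDerivAt_ev (a : Fin m → ℂ) (z : ℂ) (F : (MvPolynomial (Fin m) ℂ)[X]) :
    HasDerivAt (fun z => ev a z F) (ev a z (derivative F)) z := by
  simp only [ev, coe_eval₂RingHom, eval₂_eq_eval_map, ← derivative_map]
  exact Polynomial.hasDerivAt _ z

theorem differentiable_eval (p : MvPolynomial (Fin m) ℂ) :
    Differentiable ℂ (fun a : Fin m → ℂ => MvPolynomial.eval a p) := by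
  induction p using MvPolynomial.induction_on with
  | C c => simp
  | add p q hp hq =>
    simp only [map_add]
    exact hp.fun_add hq
  | mul_X p i hp =>
    simp only [map_mul, MvPolynomial.eval_X]
    exact hp.fun_mul (differentiable_apply i)

theorem differentiable_ev (F : (MvPolynomial (Fin m) ℂ)[X]) :
    Differentiable ℂ (fun p : ℂ × (Fin m → ℂ) => ev p.2 p.1 F) := by
  induction F using Polynomial.induction_on' with
  | add p q hp hq =>
    simp only [map_add]
    exact hp.fun_add hq
  | monomial n c =>
    simp only [ev, coe_eval₂RingHom, eval₂_monomial]
    exact ((differentiable_eval c).comp differentiable_snd).mul (differentiable_fst.pow n)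

end Evaluation

/-! ### The formal power series solution. -/

section FormalSolution

variable {m : ℕ}

/-- The Euler derivation `z d/dz`. -/
noncomputable def euler (F : (MvPolynomial (Fin m) ℂ)[X]) : (MvPolynomial (Fin m) ℂ)[X] :=
  X * derivative F

/-- The differential operator `s² z^d θ² + s (2 τ + μ z^d) θ + z ρ`, where `θ = z d/dz`. -/
noncomputable def eulerOp (s μ : ℂ) (d : ℕ) (τ ρ F : (MvPolynomial (Fin m) ℂ)[X]) :
    (MvPolynomial (Fin m) ℂ)[X] :=
  C (MvPolynomial.C (s ^ 2)) * X ^ d * euler (euler F) +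
    C (MvPolynomial.C s) * (2 * τ + C (MvPolynomial.C μ) * X ^ d) * euler F + X * ρ * F

theorem eulerOp_add (s μ : ℂ) (d : ℕ) (τ ρ F G : (MvPolynomial (Fin m) ℂ)[X]) :
    eulerOp s μ d τ ρ (F + G) = eulerOp s μ d τ ρ F + eulerOp s μ d τ ρ G := by
  simp only [eulerOp, euler, derivative_add, mul_add]; ring

theorem euler_monomial (c : MvPolynomial (Fin m) ℂ) (n : ℕ) :
    euler (C c * X ^ n) = C (n : MvPolynomial (Fin m) ℂ) * (C c * X ^ n) := by
  cases n with
  | zero => simp [euler]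
  | succ n =>
    simp only [euler, derivative_C_mul_X_pow]
    simp only [map_mul, Nat.add_sub_cancel]
    ring

/-- At order z^n only 2sτθ contributes, through τ(0) = 1: the other terms carry a factor z^d with d
≥ 1, or z. The resulting factor 2sn is what the recursion divides by. -/
theorem coeff_eulerOp_monomial {s μ : ℂ} {d : ℕ} (hd : d ≠ 0)
    {τ ρ : (MvPolynomial (Fin m) ℂ)[X]} (hτ : τ.coeff 0 = 1) (c : MvPolynomial (Fin m) ℂ) (n : ℕ) :
    X ^ n ∣ eulerOp s μ d τ ρ (C c * X ^ n) ∧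
      (eulerOp s μ d τ ρ (C c * X ^ n)).coeff n = MvPolynomial.C (2 * s * n) * c := by
  have h : eulerOp s μ d τ ρ (C c * X ^ n) = (C c * (C (MvPolynomial.C (s ^ 2)) * X ^ d *
      (C (n : MvPolynomial (Fin m) ℂ) * C (n : MvPolynomial (Fin m) ℂ)) +
      C (MvPolynomial.C s) * (2 * τ + C (MvPolynomial.C μ) * X ^ d) *
        C (n : MvPolynomial (Fin m) ℂ) + X * ρ)) * X ^ n := by
    have h2 : euler (euler (C c * X ^ n)) = C (n : MvPolynomial (Fin m) ℂ) *
        (C (n : MvPolynomial (Fin m) ℂ) * (C c * X ^ n)) := by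
      rw [euler_monomial]
      have := euler_monomial ((n : MvPolynomial (Fin m) ℂ) * c) n
      rw [map_mul, mul_assoc] at this
      exact this
    rw [eulerOp, h2, euler_monomial]
    ring
  rw [h]
  refine ⟨dvd_mul_left _ _, ?_⟩
  have h3 := coeff_mul_X_pow (C c * (C (MvPolynomial.C (s ^ 2)) * X ^ d *
      (C (n : MvPolynomial (Fin m) ℂ) * C (n : MvPolynomial (Fin m) ℂ)) +
      C (MvPolynomial.C s) * (2 * τ + C (MvPolynomial.C μ) * X ^ d) *
        C (n : MvPolynomial (Fin m) ℂ) + X * ρ)) n 0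
  rw [zero_add] at h3
  rw [h3]
  simp only [mul_coeff_zero, coeff_add, coeff_C_zero, coeff_X_pow, coeff_X_zero, hτ,
    if_neg hd.symm, coeff_ofNat_zero, MvPolynomial.C_mul]
  have : (MvPolynomial.C (n : ℂ) : MvPolynomial (Fin m) ℂ) = n := map_natCast _ n
  have h4 : (MvPolynomial.C (2 : ℂ) : MvPolynomial (Fin m) ℂ) = 2 := map_ofNat _ 2
  rw [this, h4]
  ring

/-- The formal power series solution of `eulerOp` with constant term `1`. -/
theorem exists_formal_solution {s μ : ℂ} (hs : s ≠ 0) {d : ℕ} (hd : d ≠ 0)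
    {τ ρ : (MvPolynomial (Fin m) ℂ)[X]} (hτ : τ.coeff 0 = 1) :
    ∃ φ : ℕ → MvPolynomial (Fin m) ℂ, φ 0 = 1 ∧
      ∀ N, X ^ N ∣ eulerOp s μ d τ ρ (∑ n ∈ Finset.range N, C (φ n) * X ^ n) := by
  -- Adding ψ(F, n) z^n to F cancels the coefficient of order n. G collects the partial sums up to
  -- degree N, that is, N + 1 terms.
  set ψ : (MvPolynomial (Fin m) ℂ)[X] → ℕ → MvPolynomial (Fin m) ℂ := fun F n =>
    -(MvPolynomial.C (2 * s * n)⁻¹ * (eulerOp s μ d τ ρ F).coeff n) with hψ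
  let G : ℕ → (MvPolynomial (Fin m) ℂ)[X] := fun N =>
    Nat.rec 1 (fun n F => F + C (ψ F (n + 1)) * X ^ (n + 1)) N
  have hG0 : G 0 = 1 := rfl
  have hGs : ∀ n, G (n + 1) = G n + C (ψ (G n) (n + 1)) * X ^ (n + 1) := fun n => rfl
  let φ : ℕ → MvPolynomial (Fin m) ℂ := fun n =>
    Nat.casesOn n 1 fun n => ψ (G n) (n + 1)
  have hφG : ∀ N, ∑ n ∈ Finset.range (N + 1), C (φ n) * X ^ n = G N := by
    intro N
    induction N with
    | zero => simp [hG0, φ]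
    | succ N ih => rw [Finset.sum_range_succ, ih, hGs]
  refine ⟨φ, rfl, fun N => ?_⟩
  cases N with
  | zero => simp
  | succ N =>
    rw [hφG]
    induction N with
    | zero =>
      simp [hG0, eulerOp, euler]
    | succ N ih =>
      rw [hGs, eulerOp_add, X_pow_dvd_iff]
      intro k hk
      obtain ⟨h1, h2⟩ := coeff_eulerOp_monomial (s := s) (μ := μ) hd hτ (ρ := ρ)
        (ψ (G N) (N + 1)) (N + 1)
      rw [coeff_add]
      rcases (Nat.lt_succ_iff.mp hk).lt_or_eq with h | h
      · rw [X_pow_dvd_iff.mp ih k h, X_pow_dvd_iff.mp h1 k h, add_zero]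
      · subst h
        rw [h2]
        simp only [hψ]
        have hne : 2 * s * ((N + 1 : ℕ) : ℂ) ≠ 0 :=
          mul_ne_zero (mul_ne_zero two_ne_zero hs) (Nat.cast_ne_zero.mpr (Nat.succ_ne_zero N))
        rw [mul_neg, ← mul_assoc, ← MvPolynomial.C_mul, mul_inv_cancel₀ hne]
        simp

end FormalSolution

/-! ### Truncated square root of P_m, and the Riccati identity. -/

section Coefficients

variable (m : ℕ)

theorem exists_sqrtPoly : ∃ q : ℕ → MvPolynomial (Fin m) ℂ,
    ∀ k a, MvPolynomial.eval a (q k) = sqrtCoeff m a k := by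
  have hrev : ∀ k, ∃ p : MvPolynomial (Fin m) ℂ, ∀ a, MvPolynomial.eval a p = revCoeff m a k := by
    intro k
    cases k with
    | zero => exact ⟨1, fun a => by simp [revCoeff]⟩
    | succ n =>
      by_cases h : n < m
      · exact ⟨MvPolynomial.X ⟨n, h⟩, fun a => by simp [revCoeff, h]⟩
      · exact ⟨0, fun a => by simp [revCoeff, h]⟩
  have : ∀ k, ∃ p : MvPolynomial (Fin m) ℂ, ∀ a, MvPolynomial.eval a p = sqrtCoeff m a k := by
    intro k
    induction k using Nat.strong_induction_on with
    | _ k ih =>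
      cases k with
      | zero => exact ⟨1, fun a => by simp [sqrtCoeff]⟩
      | succ n =>
        choose f hf using ih
        obtain ⟨p, hp⟩ := hrev (n + 1)
        refine ⟨MvPolynomial.C (1 / 2) * (p - ∑ i : Fin n, f (i + 1) (by omega) *
          f (n - i) (by omega)), fun a => ?_⟩
        rw [sqrtCoeff]
        simp only [map_mul, map_sub, map_sum, MvPolynomial.eval_C, hp, hf]
        ring
  choose q hq using this
  exact ⟨q, hq⟩

/-- The coefficients of the square root, as polynomials in `a`. -/
noncomputable def sqrtPoly : ℕ → MvPolynomial (Fin m) ℂ := (exists_sqrtPoly m).choose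

theorem eval_sqrtPoly (k : ℕ) (a : Fin m → ℂ) :
    MvPolynomial.eval a (sqrtPoly m k) = sqrtCoeff m a k := (exists_sqrtPoly m).choose_spec k a

/-- The truncation of the expansion of the square root, in the variable `x ^ (-1)`. -/
noncomputable def truncSqrt : (MvPolynomial (Fin m) ℂ)[X] :=
  ∑ k ∈ Finset.range (m / 2 + 1), C (sqrtPoly m k) * X ^ k

/-- `x ^ (-m) P_m` in the variable `x ^ (-1)`. -/
noncomputable def revP : (MvPolynomial (Fin m) ℂ)[X] :=
  1 + ∑ i : Fin m, C (MvPolynomial.X i) * X ^ ((i : ℕ) + 1)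

theorem sqrtPoly_zero : sqrtPoly m 0 = 1 := by
  refine MvPolynomial.funext fun a => ?_
  rw [eval_sqrtPoly, sqrtCoeff, map_one]

theorem truncSqrt_coeff (n : ℕ) :
    (truncSqrt m).coeff n = if n < m / 2 + 1 then sqrtPoly m n else 0 := by
  simp only [truncSqrt, finsetSum_coeff, coeff_C_mul, coeff_X_pow, mul_ite, mul_one, mul_zero]
  rw [Finset.sum_ite_eq]
  simp

theorem eval_revP_coeff (n : ℕ) (a : Fin m → ℂ) :
    MvPolynomial.eval a ((revP m).coeff n) = revCoeff m a n := by
  simp only [revP, coeff_add, finsetSum_coeff, coeff_C_mul, coeff_X_pow, mul_ite, mul_one,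
    mul_zero, coeff_one]
  cases n with
  | zero => simp [revCoeff]
  | succ n =>
    simp only [revCoeff, map_add, map_sum, Nat.add_right_cancel_iff]
    by_cases h : n < m
    · rw [Finset.sum_eq_single ⟨n, h⟩]
      · simp [h]
      · intro i _ hi
        have : n ≠ i := fun h' => hi (Fin.ext h'.symm)
        simp [this]
      · simp
    · rw [Finset.sum_eq_zero]
      · simp [h]
      · intro i _
        have : n ≠ i := by have := i.2; omega
        simp [this]

/-- The coefficients of degree at most m/2 in the square involve only coefficients of the root of
degree at most m/2, all kept by the truncation. -/
theorem dvd_truncSqrt_sq_sub : X ^ (m / 2 + 1) ∣ truncSqrt m ^ 2 - revP m := by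
  rw [X_pow_dvd_iff]
  intro n hn
  refine MvPolynomial.funext fun a => ?_
  rw [coeff_sub, map_sub, eval_revP_coeff, sq, coeff_mul, map_sum, map_zero, sub_eq_zero]
  have h := congrArg (PowerSeries.coeff n) (sqrtCoeff_sq m a)
  rw [sq, PowerSeries.coeff_mul, PowerSeries.coeff_mk] at h
  rw [← h]
  refine Finset.sum_congr rfl fun x hx => ?_
  rw [Finset.HasAntidiagonal.mem_antidiagonal] at hx
  rw [truncSqrt_coeff, truncSqrt_coeff, if_pos (by omega), if_pos (by omega), map_mul,
    eval_sqrtPoly, eval_sqrtPoly, PowerSeries.coeff_mk, PowerSeries.coeff_mk]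

/-- The quotient of `truncSqrt ^ 2 - revP` by the power of the variable that divides it. -/
noncomputable def sqrtRem : (MvPolynomial (Fin m) ℂ)[X] := (dvd_truncSqrt_sq_sub m).choose

theorem truncSqrt_sq : truncSqrt m ^ 2 = revP m + X ^ (m / 2 + 1) * sqrtRem m := by
  have h : truncSqrt m ^ 2 - revP m = X ^ (m / 2 + 1) * sqrtRem m :=
    (dvd_truncSqrt_sq_sub m).choose_spec
  rw [← h]; ring

/-- The number of steps in `x ^ (-1)`, that is, `1 / step`. -/
def ram : ℕ := if Even m then 1 else 2

/-- The number of steps in `x ^ (-m / 2)`. -/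
def pole : ℕ := if Even m then m / 2 else m

theorem step_mul_ram : (step m : ℂ) * (ram m : ℂ) = 1 := by
  unfold step ram; split_ifs <;> simp

theorem two_pole : 2 * pole m = ram m * m := by
  unfold pole ram
  split_ifs with h
  · obtain ⟨k, rfl⟩ := h; omega
  · rfl

/-- In terms of z this says x^{m/2} · x^{-(⌊m/2⌋+1)} = z, for both parities. Hence the error of the
truncated square root, relative to P_m, is x^{m/2} z times a polynomial in x^{-1}. -/
theorem ram_mul : ram m * (m / 2 + 1) = pole m + 1 := by
  unfold pole ram
  split_ifs with h
  · simp
  · rw [Nat.not_even_iff_odd] at h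
    obtain ⟨k, rfl⟩ := h; omega

theorem pole_pos (hm : 0 < m) : 0 < pole m := by
  unfold pole
  split_ifs with h
  · obtain ⟨k, rfl⟩ := h; omega
  · exact hm

theorem ram_pos : 0 < ram m := by
  unfold ram; split_ifs <;> norm_num

theorem step_pos : 0 < step m := by
  unfold step; split_ifs <;> norm_num

theorem step_mul_pole : (step m : ℂ) * (pole m : ℂ) = (m : ℂ) / 2 := by
  have h1 := step_mul_ram m
  have h2 : (2 : ℂ) * pole m = ram m * m := by exact_mod_cast two_pole m
  linear_combination (step m : ℂ) / 2 * h2 + (m : ℂ) / 2 * h1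

/-- `x ^ (-m / 2)` times the truncated square root, in the variable `z = x ^ (-step)`. -/
noncomputable def tauPoly : (MvPolynomial (Fin m) ℂ)[X] := expand _ (ram m) (truncSqrt m)

theorem tauPoly_coeff_zero : (tauPoly m).coeff 0 = 1 := by
  have := coeff_expand_mul (R := MvPolynomial (Fin m) ℂ) (ram_pos m) (truncSqrt m) 0
  rw [zero_mul] at this
  rw [tauPoly, this, truncSqrt_coeff, if_pos (Nat.succ_pos _), sqrtPoly_zero]

/-- The constant `1 / 2 - m / 4`. -/
noncomputable def kap : ℂ := 1 / 2 - (m : ℂ) / 4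

/-- The coefficient of order zero in the equation for `u`, divided by `z`. -/
noncomputable def rhoPoly : (MvPolynomial (Fin m) ℂ)[X] :=
  expand _ (ram m) (sqrtRem m) + X ^ (ram m - 1) * expand _ (ram m) (derivative (truncSqrt m)) +
    C (MvPolynomial.C (kap m ^ 2 - kap m)) * X ^ (pole m - 1)

variable {m}

theorem zexp_ram (t : ℂ) : Complex.exp (-(step m : ℂ) * t) ^ ram m = Complex.exp (-t) := by
  rw [← Complex.exp_nat_mul]
  congr 1
  linear_combination -t * step_mul_ram m

theorem zexp_pole (t : ℂ) :
    Complex.exp ((m : ℂ) / 2 * t) * Complex.exp (-(step m : ℂ) * t) ^ pole m = 1 := by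
  rw [← Complex.exp_nat_mul, ← Complex.exp_add, ← Complex.exp_zero]
  congr 1
  linear_combination -t * step_mul_pole m

theorem P_exp (a : Fin m → ℂ) (t : ℂ) :
    P m a (Complex.exp t) = Complex.exp ((m : ℂ) / 2 * t) ^ 2 * ev a (Complex.exp (-t)) (revP m) := by
  have h0 : Complex.exp ((m : ℂ) / 2 * t) ^ 2 = Complex.exp t ^ m := by
    rw [← Complex.exp_nat_mul, ← Complex.exp_nat_mul]; congr 1; push_cast; ring
  rw [h0, P, revP]
  simp only [map_add, map_one, map_sum, map_mul, map_pow, ev_C, ev_X, MvPolynomial.eval_X, mul_add,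
    mul_one, Finset.mul_sum]
  congr 1
  refine Finset.sum_congr rfl fun i _ => ?_
  have h1 : m = (m - 1 - (i : ℕ)) + ((i : ℕ) + 1) := by have := i.2; omega
  have h2 : Complex.exp t ^ m = Complex.exp t ^ (m - 1 - (i : ℕ)) * Complex.exp t ^ ((i : ℕ) + 1) := by
    rw [← pow_add, ← h1]
  have h3 : Complex.exp t ^ ((i : ℕ) + 1) * Complex.exp (-t) ^ ((i : ℕ) + 1) = 1 := by
    rw [← mul_pow, ← Complex.exp_add]; simp
  rw [h2]
  linear_combination -(a i * Complex.exp t ^ (m - 1 - (i : ℕ))) * h3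

/-- For even m the term k = m/2 of the truncated root contributes the constant b_0. It would
integrate to a logarithm, so it is absent from S; the difference `r m a - kap m` = -b_0 accounts for
it. -/
theorem hasDerivAt_S (hm : 0 < m) (a : Fin m → ℂ) (t : ℂ) :
    HasDerivAt (S m a) (Complex.exp ((m : ℂ) / 2 * t) * ev a (Complex.exp (-t)) (truncSqrt m) +
      r m a - kap m) t := by
  have hm' : (m : ℂ) ≠ 0 := Nat.cast_ne_zero.mpr hm.ne'
  have hexp : ∀ c : ℂ, HasDerivAt (fun t => Complex.exp (c * t)) (c * Complex.exp (c * t)) t := by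
    intro c
    have := ((hasDerivAt_id t).const_mul c).cexp
    simpa [mul_comm] using this
  have hk : ∀ k ∈ Finset.Icc 1 ((m - 1) / 2), (m : ℂ) / 2 - (k : ℂ) ≠ 0 := by
    intro k hk h
    rw [Finset.mem_Icc] at hk
    rw [sub_eq_zero, div_eq_iff two_ne_zero] at h
    have : m = k * 2 := by exact_mod_cast h
    omega
  have h1 : HasDerivAt (S m a) (2 / (m : ℂ) * ((m : ℂ) / 2 * Complex.exp ((m : ℂ) / 2 * t)) +
      ∑ k ∈ Finset.Icc 1 ((m - 1) / 2), sqrtCoeff m a k / ((m : ℂ) / 2 - (k : ℂ)) *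
        (((m : ℂ) / 2 - (k : ℂ)) * Complex.exp (((m : ℂ) / 2 - (k : ℂ)) * t))) t :=
    ((hexp _).const_mul _).add (HasDerivAt.fun_sum fun k _ => (hexp _).const_mul _)
  refine h1.congr_deriv ?_
  have hterm : ∀ k, Complex.exp ((m : ℂ) / 2 * t) * (sqrtCoeff m a k * Complex.exp (-t) ^ k) =
      sqrtCoeff m a k * Complex.exp (((m : ℂ) / 2 - (k : ℂ)) * t) := by
    intro k
    rw [← Complex.exp_nat_mul, mul_left_comm, ← Complex.exp_add]
    congr 2; ring
  have e1 : Complex.exp ((m : ℂ) / 2 * t) * ev a (Complex.exp (-t)) (truncSqrt m) =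
      ∑ k ∈ Finset.range (m / 2 + 1), sqrtCoeff m a k * Complex.exp (((m : ℂ) / 2 - (k : ℂ)) * t) := by
    simp only [truncSqrt, map_sum, map_mul, map_pow, ev_C, ev_X, eval_sqrtPoly, Finset.mul_sum, hterm]
  have e2 : ∑ k ∈ Finset.Icc 1 ((m - 1) / 2), sqrtCoeff m a k / ((m : ℂ) / 2 - (k : ℂ)) *
        (((m : ℂ) / 2 - (k : ℂ)) * Complex.exp (((m : ℂ) / 2 - (k : ℂ)) * t)) =
      ∑ k ∈ Finset.range ((m - 1) / 2),
        sqrtCoeff m a (k + 1) * Complex.exp (((m : ℂ) / 2 - ((k + 1 : ℕ) : ℂ)) * t) := by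
    rw [Finset.range_eq_Ico, Finset.sum_Ico_add' (fun k => sqrtCoeff m a k *
      Complex.exp (((m : ℂ) / 2 - (k : ℂ)) * t)) 0 ((m - 1) / 2) 1]
    refine Finset.sum_congr (by ext; simp only [Finset.mem_Icc, Finset.mem_Ico]; omega) fun k hk' => ?_
    have h2 := hk k (by rw [Finset.mem_Ico] at hk'; rw [Finset.mem_Icc]; omega)
    rw [← mul_assoc, div_mul_cancel₀ _ h2]
  have e3 : sqrtCoeff m a 0 = 1 := by rw [sqrtCoeff]
  rw [e1, e2, Finset.sum_range_succ', e3, r, kap]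
  have e4 : 2 / (m : ℂ) * ((m : ℂ) / 2 * Complex.exp ((m : ℂ) / 2 * t)) =
      1 * Complex.exp (((m : ℂ) / 2 - ((0 : ℕ) : ℂ)) * t) := by
    rw [Nat.cast_zero, sub_zero]; field_simp
  rw [e4]
  split_ifs with hev
  · obtain ⟨k, rfl⟩ := hev
    obtain ⟨j, rfl⟩ : ∃ j, k = j + 1 := ⟨k - 1, by omega⟩
    have e5 : (j + 1 + (j + 1)) / 2 = j + 1 := by omega
    have e6 : (j + 1 + (j + 1) - 1) / 2 = j := by omega
    rw [e5, e6, Finset.sum_range_succ]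
    have e7 : ((j + 1 + (j + 1) : ℕ) : ℂ) / 2 - ((j + 1 : ℕ) : ℂ) = 0 := by push_cast; ring
    rw [e7]
    simp only [zero_mul, Complex.exp_zero]
    ring
  · rw [Nat.not_even_iff_odd] at hev
    obtain ⟨j, rfl⟩ := hev
    have e5 : (2 * j + 1) / 2 = j := by omega
    have e6 : (2 * j + 1 - 1) / 2 = j := by omega
    rw [e5, e6]
    ring

/-- The function `x ^ (m / 2)` times the truncated square root. -/
noncomputable def tauFun (m : ℕ) (a : Fin m → ℂ) (t : ℂ) : ℂ :=
  Complex.exp ((m : ℂ) / 2 * t) * ev a (Complex.exp (-(step m : ℂ) * t)) (tauPoly m)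

theorem tauFun_eq (a : Fin m → ℂ) (t : ℂ) : tauFun m a t =
    Complex.exp ((m : ℂ) / 2 * t) * ev a (Complex.exp (-t)) (truncSqrt m) := by
  rw [tauFun, tauPoly, ev_expand, zexp_ram]

/-- In t the equation reads f'' - f' = P f. Substituting f = lead · U with lead'/lead = κ - τ gives
U the coefficient τ² - P + (1 - 2κ) τ - τ' + κ² - κ. The value κ = 1/2 - m/4 makes 1 - 2κ = m/2,
which cancels the leading part of τ'; what remains is x^{m/2} z ρ. -/
theorem hasDerivAt_tauFun (hm : 0 < m) (a : Fin m → ℂ) (t : ℂ) :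
    HasDerivAt (tauFun m a) (tauFun m a t ^ 2 - P m a (Complex.exp t) + (m : ℂ) / 2 * tauFun m a t +
      kap m ^ 2 - kap m - Complex.exp ((m : ℂ) / 2 * t) * (Complex.exp (-(step m : ℂ) * t) *
        ev a (Complex.exp (-(step m : ℂ) * t)) (rhoPoly m))) t := by
  have h1 : HasDerivAt (fun t : ℂ => Complex.exp ((m : ℂ) / 2 * t))
      ((m : ℂ) / 2 * Complex.exp ((m : ℂ) / 2 * t)) t := by
    have := ((hasDerivAt_id t).const_mul ((m : ℂ) / 2)).cexp
    simpa [mul_comm] using this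
  have h2 : HasDerivAt (fun t : ℂ => Complex.exp (-t)) (-Complex.exp (-t)) t := by
    simpa using (hasDerivAt_id t).neg.cexp
  have h3 := h1.mul ((hasDerivAt_ev a (Complex.exp (-t)) (truncSqrt m)).comp t h2)
  have h4 : tauFun m a = fun t => Complex.exp ((m : ℂ) / 2 * t) *
      ev a (Complex.exp (-t)) (truncSqrt m) := funext fun t => tauFun_eq a t
  have h5 := congrArg (ev a (Complex.exp (-t))) (truncSqrt_sq m)
  rw [tauFun_eq, h4]
  refine h3.congr_deriv ?_
  rw [P_exp]
  simp only [map_add, map_mul, map_pow, ev_X] at h5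
  simp only [rhoPoly, map_add, map_mul, map_pow, ev_expand, zexp_ram, ev_C, ev_X, MvPolynomial.eval_C,
    Function.comp]
  have e1 := zexp_ram (m := m) t
  have e2 := zexp_pole (m := m) t
  -- The truncated subtractions in the exponents of `rhoPoly` are genuine, since `ram m` and `pole
  -- m` are positive.
  have e3 : Complex.exp (-(step m : ℂ) * t) * Complex.exp (-(step m : ℂ) * t) ^ (ram m - 1) =
      Complex.exp (-t) := by
    rw [← pow_succ', Nat.sub_add_cancel (ram_pos m), e1]
  have e4 : Complex.exp ((m : ℂ) / 2 * t) * (Complex.exp (-(step m : ℂ) * t) *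
      Complex.exp (-(step m : ℂ) * t) ^ (pole m - 1)) = 1 := by
    rw [← pow_succ', Nat.sub_add_cancel (pole_pos m hm), e2]
  have e5 : Complex.exp ((m : ℂ) / 2 * t) * Complex.exp (-t) ^ (m / 2 + 1) =
      Complex.exp (-(step m : ℂ) * t) := by
    rw [← e1, ← pow_mul, ram_mul, pow_succ, ← mul_assoc, e2, one_mul]
  generalize Complex.exp (-(step m : ℂ) * t) = z at *
  generalize ev a (Complex.exp (-t)) (derivative (truncSqrt m)) = D at *
  generalize ev a (Complex.exp (-t)) (truncSqrt m) = τ at *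
  generalize ev a (Complex.exp (-t)) (revP m) = p at *
  generalize ev a (Complex.exp (-t)) (sqrtRem m) = g at *
  generalize Complex.exp ((m : ℂ) / 2 * t) = w at *
  linear_combination w * D * e3 + (kap m ^ 2 - kap m) * e4 - w * g * e5 - w ^ 2 * h5

end Coefficients

/-! ### The coordinate y = e^{-ib} x^{m/2} and the equation for U in it. -/

section Coordinate

variable {m : ℕ}

/-- The coordinate `t` in terms of `y = exp (m t / 2 - i b)`. -/
noncomputable def tc (m : ℕ) (b : ℝ) (y : ℂ) : ℂ := 2 / (m : ℂ) * (Complex.log y + b * Complex.I)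

/-- The variable `z = x ^ (-step)` in terms of `y`. -/
noncomputable def zc (m : ℕ) (b : ℝ) (y : ℂ) : ℂ := Complex.exp (-(step m : ℂ) * tc m b y)

theorem exp_tc (hm : 0 < m) (b : ℝ) {y : ℂ} (hy : y ≠ 0) :
    Complex.exp ((m : ℂ) / 2 * tc m b y) = Complex.exp (b * Complex.I) * y := by
  have hm' : (m : ℂ) ≠ 0 := Nat.cast_ne_zero.mpr hm.ne'
  have : (m : ℂ) / 2 * tc m b y = b * Complex.I + Complex.log y := by
    rw [tc]; field_simp; ring
  rw [this, Complex.exp_add, Complex.exp_log hy]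

theorem hasDerivAt_tc (b : ℝ) {y : ℂ} (hy : y ∈ Complex.slitPlane) :
    HasDerivAt (tc m b) (2 / ((m : ℂ) * y)) y := by
  refine (((Complex.hasDerivAt_log hy).add_const _).const_mul _).congr_deriv ?_
  rw [← div_eq_mul_inv, div_div]

theorem tc_exp (hm : 0 < m) (b : ℝ) {t : ℂ} (h : |(m : ℝ) / 2 * t.im - b| < Real.pi) :
    tc m b (Complex.exp ((m : ℂ) / 2 * t - b * Complex.I)) = t := by
  have hm' : (m : ℂ) ≠ 0 := Nat.cast_ne_zero.mpr hm.ne'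
  have him : ((m : ℂ) / 2 * t - b * Complex.I).im = (m : ℝ) / 2 * t.im - b := by
    have : ((m : ℂ) / 2) = (((m : ℝ) / 2 : ℝ) : ℂ) := by push_cast; rfl
    rw [this, Complex.sub_im, Complex.im_ofReal_mul, Complex.im_ofReal_mul, Complex.I_im, mul_one]
  rw [abs_lt] at h
  rw [tc, Complex.log_exp (by rw [him]; exact h.1) (by rw [him]; exact h.2.le)]
  field_simp
  ring

theorem norm_zc (hm : 0 < m) (b : ℝ) {y : ℂ} (hy : y ≠ 0) :
    ‖zc m b y‖ = ‖y‖ ^ (-(1 / (pole m : ℝ))) := by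
  have hm' : (m : ℝ) ≠ 0 := Nat.cast_ne_zero.mpr hm.ne'
  have hp : (pole m : ℝ) ≠ 0 := Nat.cast_ne_zero.mpr (pole_pos m hm).ne'
  have h1 : step m * pole m = (m : ℝ) / 2 := by
    refine Complex.ofReal_injective ?_
    push_cast
    exact step_mul_pole m
  have h2 : (tc m b y).re = 2 / (m : ℝ) * Real.log ‖y‖ := by
    have : (2 / (m : ℂ)) = ((2 / (m : ℝ) : ℝ) : ℂ) := by push_cast; rfl
    rw [tc, this, Complex.re_ofReal_mul]
    simp [Complex.log_re]
  rw [zc, Complex.norm_exp, ← Complex.ofReal_neg, Complex.re_ofReal_mul, h2,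
    Real.rpow_def_of_pos (norm_pos_iff.mpr hy)]
  congr 1
  have h3 : step m = (m : ℝ) / 2 / pole m := by rw [← h1]; field_simp
  rw [h3]
  field_simp

/-- Decay in |y| is traded for decay in the gauge, which increases at unit speed along the rays of
integration and so can be integrated explicitly. -/
theorem norm_rpow_le_gauge {l : ℝ} (hl : 0 ≤ l) {y : ℂ} (hy : 0 < gauge l y) {p : ℝ} (hp : 0 ≤ p) :
    ‖y‖ ^ (-p) ≤ (1 + l) ^ p * gauge l y ^ (-p) := by
  have hl1 : 0 < 1 + l := by linarith
  have h1 : gauge l y / (1 + l) ≤ ‖y‖ := by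
    rw [div_le_iff₀ hl1, mul_comm]; exact gauge_le hl y
  have h2 := Real.rpow_le_rpow_of_nonpos (div_pos hy hl1) h1 (neg_nonpos.mpr hp)
  refine h2.trans (le_of_eq ?_)
  rw [Real.div_rpow hy.le hl1.le, Real.rpow_neg hl1.le p, div_inv_eq_mul, mul_comm]

theorem differentiableAt_tc (b : ℝ) {y : ℂ} (hy : y ∈ Complex.slitPlane) :
    DifferentiableAt ℂ (tc m b) y := (hasDerivAt_tc b hy).differentiableAt

theorem hasDerivAt_zc (b : ℝ) {y : ℂ} (hy : y ∈ Complex.slitPlane) :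
    HasDerivAt (zc m b) (-(step m : ℂ) * zc m b y * (2 / ((m : ℂ) * y))) y := by
  refine (((hasDerivAt_tc b hy).const_mul _).cexp).congr_deriv ?_
  rw [zc]; ring

theorem differentiable_sqrtCoeff (k : ℕ) :
    Differentiable ℂ (fun a : Fin m → ℂ => sqrtCoeff m a k) := by
  simpa only [eval_sqrtPoly] using differentiable_eval (sqrtPoly m k)

theorem differentiable_r : Differentiable ℂ (fun a : Fin m → ℂ => r m a) := by
  unfold r
  split_ifs
  · exact (differentiable_const _).sub (differentiable_sqrtCoeff _)
  · exact (differentiable_const _).sub (differentiable_const _)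

theorem differentiable_S : Differentiable ℂ (fun p : ℂ × (Fin m → ℂ) => S m p.2 p.1) := by
  unfold S
  have h : ∀ k, Differentiable ℂ (fun p : ℂ × (Fin m → ℂ) => sqrtCoeff m p.2 k) := fun k =>
    (differentiable_sqrtCoeff k).comp differentiable_snd
  have h' : ∀ c : ℂ, Differentiable ℂ (fun p : ℂ × (Fin m → ℂ) => Complex.exp (c * p.1)) := by
    intro c; fun_prop
  refine ((h' _).const_mul _).add (Differentiable.fun_sum fun k _ => ?_)
  simp only [div_eq_mul_inv]
  exact ((h k).mul_const _).mul (h' _)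

theorem norm_ev_le (F : (MvPolynomial (Fin m) ℂ)[X]) (ρ : ℝ) :
    ∃ M, 0 ≤ M ∧ ∀ a ∈ Metric.ball (0 : Fin m → ℂ) ρ, ∀ z : ℂ, ‖z‖ ≤ 1 → ‖ev a z F‖ ≤ M := by
  have hcomp : IsCompact (Metric.closedBall (0 : ℂ) 1 ×ˢ Metric.closedBall (0 : Fin m → ℂ) ρ) :=
    (isCompact_closedBall _ _).prod (isCompact_closedBall _ _)
  obtain ⟨M, hM⟩ := hcomp.exists_bound_of_continuousOn (differentiable_ev F).continuous.continuousOn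
  refine ⟨max M 0, le_max_right _ _, fun a ha z hz => (hM (z, a) ⟨?_, ?_⟩).trans (le_max_left _ _)⟩
  · simpa using hz
  · exact Metric.ball_subset_closedBall ha

/-- The coefficient `B` of the first derivative in the equation `U'' = B U' - k U`. -/
noncomputable def coeffB (m : ℕ) (b : ℝ) (p : ℂ × (Fin m → ℂ)) : ℂ :=
  4 / (m : ℂ) * Complex.exp (b * Complex.I) * ev p.2 (zc m b p.1) (tauPoly m)

/-- A primitive of `coeffB`. -/
noncomputable def primB (m : ℕ) (b : ℝ) (p : ℂ × (Fin m → ℂ)) : ℂ :=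
  2 * (S m p.2 (tc m b p.1) - (r m p.2 - kap m) * tc m b p.1)

/-- The coefficient `k` of order zero in the equation `U'' = B U' - k U`. -/
noncomputable def coeffK (m : ℕ) (b : ℝ) (p : ℂ × (Fin m → ℂ)) : ℂ :=
  4 / (m : ℂ) ^ 2 * Complex.exp (b * Complex.I) * p.1⁻¹ *
    (zc m b p.1 * ev p.2 (zc m b p.1) (rhoPoly m))

theorem tauFun_tc (hm : 0 < m) (b : ℝ) {y : ℂ} (hy : y ≠ 0) (a : Fin m → ℂ) :
    tauFun m a (tc m b y) = (m : ℂ) / 4 * y * coeffB m b (y, a) := by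
  have hm' : (m : ℂ) ≠ 0 := Nat.cast_ne_zero.mpr hm.ne'
  rw [tauFun, exp_tc hm b hy, coeffB, zc]
  field_simp

theorem hasDerivAt_S' (hm : 0 < m) (a : Fin m → ℂ) (t : ℂ) :
    HasDerivAt (S m a) (tauFun m a t + r m a - kap m) t := by
  rw [tauFun_eq]; exact hasDerivAt_S hm a t

theorem hasDerivAt_primB (hm : 0 < m) (b : ℝ) {y : ℂ} (hy : y ∈ Complex.slitPlane)
    (a : Fin m → ℂ) : HasDerivAt (fun y => primB m b (y, a)) (coeffB m b (y, a)) y := by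
  have hm' : (m : ℂ) ≠ 0 := Nat.cast_ne_zero.mpr hm.ne'
  have hy0 := Complex.slitPlane_ne_zero hy
  have h1 := hasDerivAt_tc (m := m) b hy
  have h2 := (hasDerivAt_S' hm a (tc m b y)).comp y h1
  refine ((h2.sub (h1.const_mul (r m a - kap m))).const_mul 2).congr_deriv ?_
  rw [tauFun_tc hm b hy0]
  field_simp
  ring

theorem differentiableOn_tc_fst (b : ℝ) {D : Set ℂ} (hD : D ⊆ Complex.slitPlane)
    (𝒰 : Set (Fin m → ℂ)) :
    DifferentiableOn ℂ (fun p : ℂ × (Fin m → ℂ) => tc m b p.1) (D ×ˢ 𝒰) := fun p hp =>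
  ((differentiableAt_tc (m := m) b (hD hp.1)).comp p differentiableAt_fst).differentiableWithinAt

theorem differentiableOn_ev_zc (b : ℝ) {D : Set ℂ} (hD : D ⊆ Complex.slitPlane)
    (𝒰 : Set (Fin m → ℂ)) (F : (MvPolynomial (Fin m) ℂ)[X]) :
    DifferentiableOn ℂ (fun p : ℂ × (Fin m → ℂ) => ev p.2 (zc m b p.1) F) (D ×ˢ 𝒰) := by
  have h1 : DifferentiableOn ℂ (fun p : ℂ × (Fin m → ℂ) => zc m b p.1) (D ×ˢ 𝒰) :=
    ((differentiableOn_tc_fst b hD 𝒰).const_mul _).cexp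
  exact (differentiable_ev F).comp_differentiableOn (h1.prodMk differentiableOn_snd)

theorem differentiableOn_primB (b : ℝ) {D : Set ℂ} (hD : D ⊆ Complex.slitPlane)
    (𝒰 : Set (Fin m → ℂ)) : DifferentiableOn ℂ (primB m b) (D ×ˢ 𝒰) := by
  have h1 := differentiableOn_tc_fst b hD 𝒰
  have h2 : DifferentiableOn ℂ (fun p : ℂ × (Fin m → ℂ) => S m p.2 (tc m b p.1)) (D ×ˢ 𝒰) :=
    differentiable_S.comp_differentiableOn (h1.prodMk differentiableOn_snd)
  have h3 : DifferentiableOn ℂ (fun p : ℂ × (Fin m → ℂ) => r m p.2) (D ×ˢ 𝒰) :=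
    (differentiable_r.comp differentiable_snd).differentiableOn
  exact (h2.sub ((h3.sub_const _).mul h1)).const_mul 2

theorem differentiableOn_coeffK (b : ℝ) {D : Set ℂ} (hD : D ⊆ Complex.slitPlane)
    (𝒰 : Set (Fin m → ℂ)) : DifferentiableOn ℂ (coeffK m b) (D ×ˢ 𝒰) := by
  have h1 : DifferentiableOn ℂ (fun p : ℂ × (Fin m → ℂ) => zc m b p.1) (D ×ˢ 𝒰) :=
    ((differentiableOn_tc_fst b hD 𝒰).const_mul _).cexp
  have h2 : DifferentiableOn ℂ (fun p : ℂ × (Fin m → ℂ) => p.1⁻¹) (D ×ˢ 𝒰) :=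
    differentiableOn_fst.fun_inv fun p hp => Complex.slitPlane_ne_zero (hD hp.1)
  exact (h2.const_mul _).mul (h1.mul (differentiableOn_ev_zc b hD 𝒰 _))

/-- The action of the operator `f ↦ f'' - B f' + k f` on polynomials in `z`. -/
theorem hasDerivAt_ev_zc (hm : 0 < m) (b : ℝ) {y : ℂ} (hy : y ∈ Complex.slitPlane)
    (a : Fin m → ℂ) (F : (MvPolynomial (Fin m) ℂ)[X]) :
    HasDerivAt (fun y => ev a (zc m b y) F)
      (-(2 * step m / ((m : ℂ) * y) * ev a (zc m b y) (euler F))) y ∧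
    HasDerivAt (fun y => -(2 * step m / ((m : ℂ) * y) * ev a (zc m b y) (euler F)))
      (coeffB m b (y, a) * -(2 * step m / ((m : ℂ) * y) * ev a (zc m b y) (euler F)) -
        coeffK m b (y, a) * ev a (zc m b y) F + 4 / (m : ℂ) ^ 2 * Complex.exp (b * Complex.I) * y⁻¹ *
          ev a (zc m b y) (eulerOp (step m) (m / 2) (pole m) (tauPoly m) (rhoPoly m) F)) y := by
  have hm' : (m : ℂ) ≠ 0 := Nat.cast_ne_zero.mpr hm.ne'
  have hy0 := Complex.slitPlane_ne_zero hy
  have h0 : ∀ F : (MvPolynomial (Fin m) ℂ)[X], HasDerivAt (fun y => ev a (zc m b y) F)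
      (-(2 * step m / ((m : ℂ) * y) * ev a (zc m b y) (euler F))) y := by
    intro F
    refine ((hasDerivAt_ev a _ F).comp y (hasDerivAt_zc b hy)).congr_deriv ?_
    simp only [euler, map_mul, ev_X]
    ring
  refine ⟨h0 F, ?_⟩
  have h1 : HasDerivAt (fun y : ℂ => 2 * (step m : ℂ) / ((m : ℂ) * y))
      (-(2 * step m / ((m : ℂ) * y ^ 2))) y := by
    have := ((hasDerivAt_id y).const_mul (m : ℂ)).inv (mul_ne_zero hm' hy0)
    refine (this.const_mul (2 * (step m : ℂ))).congr_deriv ?_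
    simp only [id]
    field_simp
  refine ((h1.mul (h0 (euler F))).neg).congr_deriv ?_
  have h2 : Complex.exp (b * Complex.I) * y * zc m b y ^ pole m = 1 := by
    rw [← exp_tc hm b hy0, zc]; exact zexp_pole _
  simp only [eulerOp, map_add, map_mul, map_pow, ev_C, ev_X, MvPolynomial.eval_C, map_ofNat, coeffB,
    coeffK]
  generalize ev a (zc m b y) (euler (euler F)) = f₂ at *
  generalize ev a (zc m b y) (euler F) = f₁ at *
  generalize ev a (zc m b y) F = f₀ at *
  generalize ev a (zc m b y) (tauPoly m) = τ at *
  generalize ev a (zc m b y) (rhoPoly m) = ρ at *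
  generalize hE : Complex.exp (b * Complex.I) = E at *
  have h3 : zc m b y ^ pole m = E⁻¹ * y⁻¹ := by
    have hE0 : E ≠ 0 := hE ▸ Complex.exp_ne_zero _
    field_simp
    linear_combination h2
  have hE0 : E ≠ 0 := hE ▸ Complex.exp_ne_zero _
  rw [h3]
  field_simp
  ring

end Coordinate

/-! ### The asymptotic expansion of the normalized solution U. -/

section Asymptotics

variable {m : ℕ}

theorem norm_zc_le (hm : 0 < m) (b : ℝ) {l : ℝ} (hl : 0 ≤ l) {y : ℂ} (hy : 0 < gauge l y) :
    ‖zc m b y‖ ≤ (1 + l) ^ (1 / (pole m : ℝ)) * gauge l y ^ (-(1 / (pole m : ℝ))) := by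
  have hy0 : y ≠ 0 := by rintro rfl; simp [gauge] at hy
  rw [norm_zc hm b hy0]
  exact norm_rpow_le_gauge hl hy (by positivity)

theorem norm_zc_pow_le (hm : 0 < m) (b : ℝ) {l : ℝ} (hl : 0 ≤ l) {y : ℂ} (hy : 0 < gauge l y)
    (N : ℕ) : ‖zc m b y ^ N‖ ≤ (1 + l) ^ (N * (1 / (pole m : ℝ))) *
      gauge l y ^ (-(N * (1 / (pole m : ℝ)))) := by
  have hy0 : y ≠ 0 := by rintro rfl; simp [gauge] at hy
  rw [norm_pow, norm_zc hm b hy0, ← Real.rpow_natCast, ← Real.rpow_mul (norm_nonneg _)]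
  have : -(1 / (pole m : ℝ)) * (N : ℝ) = -(N * (1 / (pole m : ℝ))) := by ring
  rw [this]
  exact norm_rpow_le_gauge hl hy (by positivity)

theorem norm_inv_le {l : ℝ} (hl : 0 ≤ l) {y : ℂ} (hy : 0 < gauge l y) :
    ‖y⁻¹‖ ≤ (1 + l) * (gauge l y)⁻¹ := by
  have := norm_rpow_le_gauge hl hy zero_le_one
  rwa [Real.rpow_one, Real.rpow_neg_one, Real.rpow_neg_one, ← norm_inv] at this

/-- `z^N` times a polynomial, divided by `y`, is `O(gauge ^ (-1 - N / pole))`. -/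
theorem norm_remainder_le (hm : 0 < m) (b : ℝ) {l : ℝ} (hl : 0 ≤ l) (ρ : ℝ) (N : ℕ)
    (G : (MvPolynomial (Fin m) ℂ)[X]) : ∃ C, 0 ≤ C ∧ ∀ y, 0 < gauge l y → ‖zc m b y‖ ≤ 1 →
      ∀ a ∈ Metric.ball (0 : Fin m → ℂ) ρ,
      ‖4 / (m : ℂ) ^ 2 * Complex.exp (b * Complex.I) * y⁻¹ *
        (zc m b y ^ N * ev a (zc m b y) G)‖ ≤ C * gauge l y ^ (-1 - N * (1 / (pole m : ℝ))) := by
  obtain ⟨M, hM0, hM⟩ := norm_ev_le G ρ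
  refine ⟨4 / (m : ℝ) ^ 2 * (1 + l) * ((1 + l) ^ (N * (1 / (pole m : ℝ))) * M), by positivity,
    fun y hy hz a ha => ?_⟩
  have h1 := norm_inv_le hl hy
  have h2 := norm_zc_pow_le hm b hl hy N
  have h3 := hM a ha _ hz
  have h4 : gauge l y ^ (-1 - N * (1 / (pole m : ℝ))) =
      (gauge l y)⁻¹ * gauge l y ^ (-(N * (1 / (pole m : ℝ)))) := by
    rw [sub_eq_add_neg, Real.rpow_add hy, Real.rpow_neg_one]
  have h5 : ‖(4 / (m : ℂ) ^ 2 * Complex.exp (b * Complex.I))‖ = 4 / (m : ℝ) ^ 2 := by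
    rw [norm_mul, Complex.norm_exp_ofReal_mul_I]; simp
  rw [norm_mul, norm_mul _ y⁻¹, h5, norm_mul, h4]
  have h6 : 0 ≤ gauge l y ^ (-(N * (1 / (pole m : ℝ)))) := Real.rpow_nonneg hy.le _
  calc _ ≤ (4 / (m : ℝ) ^ 2 * ((1 + l) * (gauge l y)⁻¹)) *
        (((1 + l) ^ (N * (1 / (pole m : ℝ))) * gauge l y ^ (-(N * (1 / (pole m : ℝ))))) * M) := by
        gcongr
    _ = _ := by ring

/-- The expansion is obtained by induction on the number of terms. If F is a partial sum and E = U -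
F, then E'' - B E' = -(k E + residue of F). The decay of k raises the known order of E by one step,
the residue of the formal series has the same order, and `norm_le_of_ode` carries this over to E. -/
theorem exists_asymptotic_solution (hm : 0 < m) {b : ℝ} (hb : 0 < Real.cos b) {l : ℝ} (hl : 0 ≤ l)
    (ρ : ℝ) {φ : ℕ → MvPolynomial (Fin m) ℂ} (hφ0 : φ 0 = 1)
    (hφ : ∀ N, X ^ N ∣ eulerOp (step m) (m / 2) (pole m) (tauPoly m) (rhoPoly m)
      (∑ n ∈ Finset.range N, C (φ n) * X ^ n)) :
    ∃ R, 1 ≤ R ∧ ∃ U V : ℂ × (Fin m → ℂ) → ℂ,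
      DifferentiableOn ℂ U (wedge l R ×ˢ Metric.ball 0 ρ) ∧
      DifferentiableOn ℂ V (wedge l R ×ˢ Metric.ball 0 ρ) ∧
      (∀ y ∈ wedge l R, ∀ a ∈ Metric.ball 0 ρ, HasDerivAt (fun y => U (y, a)) (V (y, a)) y) ∧
      (∀ y ∈ wedge l R, ∀ a ∈ Metric.ball 0 ρ, HasDerivAt (fun y => V (y, a))
        (coeffB m b (y, a) * V (y, a) - coeffK m b (y, a) * U (y, a)) y) ∧
      ∀ N : ℕ, ∃ K, ∀ y ∈ wedge l R, ∀ a ∈ Metric.ball 0 ρ,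
        ‖U (y, a) - ev a (zc m b y) (∑ n ∈ Finset.range N, C (φ n) * X ^ n)‖ ≤
          K * gauge l y ^ (-(N * (1 / (pole m : ℝ)))) := by
  set e : ℝ := 1 / (pole m : ℝ) with he
  have hp := pole_pos m hm
  have he0 : 0 < e := by positivity
  have hmR : (0 : ℝ) < m := Nat.cast_pos.mpr hm
  -- Half of the limit (4/m) cos b of Re B; the other half absorbs the corrections of order z once
  -- R₀ is large.
  set c : ℝ := 2 / (m : ℝ) * Real.cos b with hc
  have hc0 : 0 < c := by positivity
  obtain ⟨τ₁, hτ₁⟩ : X ∣ tauPoly m - 1 := by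
    rw [X_dvd_iff, coeff_sub, tauPoly_coeff_zero, coeff_one_zero, sub_self]
  obtain ⟨Mτ, hMτ0, hMτ⟩ := norm_ev_le τ₁ ρ
  obtain ⟨R₀, hR₀1, hR₀⟩ : ∃ R₀, 1 ≤ R₀ ∧ ∀ y ∈ wedge l R₀, ‖zc m b y‖ ≤ 1 ∧
      ‖zc m b y‖ * Mτ ≤ Real.cos b / 2 := by
    have h1 := (tendsto_rpow_neg_atTop he0).const_mul ((1 + l) ^ e)
    rw [mul_zero] at h1
    have h2 := h1.mul_const Mτ
    rw [zero_mul] at h2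
    obtain ⟨R₀, hR₀⟩ := eventually_atTop.mp ((h1.eventually_lt_const zero_lt_one).and
      (h2.eventually_lt_const (by positivity : 0 < Real.cos b / 2)))
    refine ⟨max R₀ 1, le_max_right _ _, fun y hy => ?_⟩
    have hy1 : max R₀ 1 < gauge l y := hy
    have hg : 0 < gauge l y := lt_trans (by positivity) hy1
    obtain ⟨h3, h4⟩ := hR₀ (gauge l y) ((le_max_left _ _).trans hy1.le)
    have h5 := norm_zc_le hm b hl hg
    exact ⟨h5.trans h3.le, (mul_le_mul_of_nonneg_right h5 hMτ0).trans h4.le⟩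
  have hslit : wedge l R₀ ⊆ Complex.slitPlane := wedge_subset_slitPlane (by linarith)
  obtain ⟨K, hK0, hK⟩ := norm_remainder_le hm b hl ρ 1 (rhoPoly m)
  have hkb : ∀ y ∈ wedge l R₀, ∀ a ∈ Metric.ball (0 : Fin m → ℂ) ρ,
      ‖coeffK m b (y, a)‖ ≤ K * gauge l y ^ (-1 - e) := by
    intro y hy a ha
    have hg : 0 < gauge l y := lt_trans (by linarith) hy
    have h1 := hK y hg (hR₀ y hy).1 a ha
    rw [pow_one, Nat.cast_one, one_mul] at h1
    exact h1
  have hBre : ∀ y ∈ wedge l R₀, ∀ a ∈ Metric.ball (0 : Fin m → ℂ) ρ, c ≤ (coeffB m b (y, a)).re := by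
    intro y hy a ha
    have h1 := congrArg (ev a (zc m b y)) hτ₁
    rw [map_sub, map_one, map_mul, ev_X, sub_eq_iff_eq_add] at h1
    have h2 := hR₀ y hy
    have h3 := hMτ a ha _ h2.1
    have h4 : coeffB m b (y, a) = ((4 / (m : ℝ) : ℝ) : ℂ) * (Complex.exp (b * Complex.I) *
        (zc m b y * ev a (zc m b y) τ₁) + Complex.exp (b * Complex.I)) := by
      rw [coeffB, h1]; push_cast; ring
    rw [h4, Complex.re_ofReal_mul, Complex.add_re, Complex.exp_ofReal_mul_I_re]
    have h5 := Complex.abs_re_le_norm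
      (Complex.exp (b * Complex.I) * (zc m b y * ev a (zc m b y) τ₁))
    rw [norm_mul, Complex.norm_exp_ofReal_mul_I, one_mul, norm_mul] at h5
    have h6 := (abs_le.mp (h5.trans
      ((mul_le_mul_of_nonneg_left h3 (norm_nonneg _)).trans h2.2))).1
    have h7 : c = 4 / (m : ℝ) * (Real.cos b / 2) := by rw [hc]; ring
    rw [h7]
    exact mul_le_mul_of_nonneg_left (by linarith) (by positivity)
  obtain ⟨R, hRR, hR1, M, U, V, hM0, hUd, hVd, hU', hV', hVb, hUb⟩ :=
    exists_normalized_solution (l := l) (c := c) (K := K) (e := e) (R₀ := R₀)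
      (𝒰 := Metric.ball (0 : Fin m → ℂ) ρ) Metric.isOpen_ball (β := primB m b) (B := coeffB m b)
      (k := coeffK m b) hc0 he0 hK0
      (differentiableOn_primB b hslit _) (differentiableOn_coeffK b hslit _)
      (fun y hy a _ => hasDerivAt_primB hm b (hslit hy) a) hBre hkb
  refine ⟨R, hR1, U, V, hUd, hVd, hU', hV', fun N => ?_⟩
  have hsub : wedge l R ⊆ wedge l R₀ := wedge_mono hRR
  have hgpos : ∀ y ∈ wedge l R, 1 < gauge l y := fun y hy => lt_of_le_of_lt hR1 hy
  have hslit' := hsub.trans hslit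
  -- The induction starts with one term, where the bound on U - 1 from the Volterra equation is
  -- available; the empty sum is treated afterwards.
  have main : ∀ N : ℕ, ∃ K, 0 ≤ K ∧ ∀ y ∈ wedge l R, ∀ a ∈ Metric.ball 0 ρ,
      ‖U (y, a) - ev a (zc m b y) (∑ n ∈ Finset.range (N + 1), C (φ n) * X ^ n)‖ ≤
        K * gauge l y ^ (-(((N + 1 : ℕ) : ℝ) * e)) := by
    intro N
    induction N with
    | zero =>
      refine ⟨M, hM0, fun y hy a ha => ?_⟩
      simpa [hφ0] using hUb y hy a ha
    | succ N ih =>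
      obtain ⟨K₁, hK₁0, hK₁⟩ := ih
      set F : (MvPolynomial (Fin m) ℂ)[X] := ∑ n ∈ Finset.range (N + 1 + 1), C (φ n) * X ^ n with hF
      obtain ⟨G, hG⟩ := hφ (N + 1 + 1)
      rw [← hF] at hG
      obtain ⟨K₂, hK₂0, hK₂⟩ := norm_remainder_le hm b hl ρ (N + 1 + 1) G
      obtain ⟨M₁, hM₁0, hM₁⟩ := norm_ev_le (C (φ (N + 1))) ρ
      obtain ⟨M₂, hM₂0, hM₂⟩ := norm_ev_le (euler F) ρ
      set K₃ := K₁ + (1 + l) ^ (((N + 1 : ℕ) : ℝ) * e) * M₁ with hK₃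
      -- Adding the term of degree N + 1 does not spoil the bound of the previous step, as that term
      -- has the same order.
      have hE : ∀ y ∈ wedge l R, ∀ a ∈ Metric.ball 0 ρ, ‖U (y, a) - ev a (zc m b y) F‖ ≤
          K₃ * gauge l y ^ (-(((N + 1 : ℕ) : ℝ) * e)) := by
        intro y hy a ha
        have hg : 0 < gauge l y := zero_lt_one.trans (hgpos y hy)
        have h1 := hK₁ y hy a ha
        have h2 := hM₁ a ha _ (hR₀ y (hsub hy)).1
        have h3 := norm_zc_pow_le hm b hl hg (N + 1)
        rw [hF, Finset.sum_range_succ, map_add, map_mul, map_pow, ev_X, ← sub_sub, hK₃, add_mul]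
        refine (norm_sub_le _ _).trans (add_le_add h1 ?_)
        rw [norm_mul, mul_comm]
        calc _ ≤ ((1 + l) ^ (((N + 1 : ℕ) : ℝ) * e) * gauge l y ^ (-(((N + 1 : ℕ) : ℝ) * e))) * M₁ :=
              mul_le_mul h3 h2 (norm_nonneg _) (by positivity)
          _ = _ := by ring
      set H := K * K₃ + K₂ with hH
      have hH0 : 0 ≤ H := by positivity
      have hq0 : 0 < (((N + 1 + 1 : ℕ) : ℝ) * e) := by positivity
      refine ⟨H / c / (((N + 1 + 1 : ℕ) : ℝ) * e), by positivity, fun y hy a ha => ?_⟩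
      refine norm_le_of_ode (l := l) (R := R) (c := c) (H := H)
        (M := M + 2 * step m / m * ((1 + l) * M₂))
        (E := fun y => U (y, a) - ev a (zc m b y) F)
        (W := fun y => V (y, a) - -(2 * step m / ((m : ℂ) * y) * ev a (zc m b y) (euler F)))
        (B := fun y => coeffB m b (y, a)) (β := fun y => primB m b (y, a))
        (h := fun y => coeffK m b (y, a) * (U (y, a) - ev a (zc m b y) F) +
          4 / (m : ℂ) ^ 2 * Complex.exp (b * Complex.I) * y⁻¹ *
            ev a (zc m b y) (eulerOp (step m) (m / 2) (pole m) (tauPoly m) (rhoPoly m) F))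
        hc0 hq0 (by linarith) ?_ ?_ ?_ ?_ ?_ ?_ hH0 ?_ ?_ y hy
      · intro y hy
        exact (hU' y hy a ha).sub (hasDerivAt_ev_zc hm b (hslit' hy) a F).1
      · intro y hy
        refine ((hV' y hy a ha).sub (hasDerivAt_ev_zc hm b (hslit' hy) a F).2).congr_deriv ?_
        ring
      · exact fun y hy => hasDerivAt_primB hm b (hslit' hy) a
      · exact fun y hy => hBre y (hsub hy) a ha
      · have hev : ∀ F : (MvPolynomial (Fin m) ℂ)[X],
            ContinuousOn (fun y => ev a (zc m b y) F) (wedge l R) := fun F y hy =>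
          (hasDerivAt_ev_zc hm b (hslit' hy) a F).1.continuousAt.continuousWithinAt
        have hk : ContinuousOn (fun y => coeffK m b (y, a)) (wedge l R) :=
          (differentiableOn_coeffK b hslit' (Metric.ball 0 ρ)).continuousOn.comp (by fun_prop)
            fun y hy => ⟨hy, ha⟩
        have hU : ContinuousOn (fun y => U (y, a)) (wedge l R) := fun y hy =>
          (hU' y hy a ha).continuousAt.continuousWithinAt
        have hi : ContinuousOn (fun y : ℂ => y⁻¹) (wedge l R) :=
          continuousOn_id.inv₀ fun y hy => Complex.slitPlane_ne_zero (hslit' hy)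
        exact (hk.mul (hU.sub (hev F))).add ((continuousOn_const.mul hi).mul (hev _))
      · intro y hy
        have hg : 0 < gauge l y := zero_lt_one.trans (hgpos y hy)
        have h1 := hkb y (hsub hy) a ha
        have h2 := hE y hy a ha
        have h3 := hK₂ y hg (hR₀ y (hsub hy)).1 a ha
        rw [hG, map_mul, map_pow, ev_X, hH, add_mul]
        refine (norm_add_le _ _).trans (add_le_add ?_ h3)
        rw [norm_mul]
        calc _ ≤ (K * gauge l y ^ (-1 - e)) * (K₃ * gauge l y ^ (-(((N + 1 : ℕ) : ℝ) * e))) :=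
              mul_le_mul h1 h2 (norm_nonneg _) (by positivity)
          _ = K * K₃ * (gauge l y ^ (-1 - e) * gauge l y ^ (-(((N + 1 : ℕ) : ℝ) * e))) := by ring
          _ = _ := by
            rw [← Real.rpow_add hg]
            congr 2
            push_cast; ring
      · intro y hy
        have hg : 1 < gauge l y := hgpos y hy
        refine (norm_sub_le _ _).trans (add_le_add (hVb y hy a ha) ?_)
        have h1 := norm_inv_le hl (zero_lt_one.trans hg)
        have h2 := hM₂ a ha _ (hR₀ y (hsub hy)).1
        have h3 : (gauge l y)⁻¹ ≤ 1 := inv_le_one_of_one_le₀ hg.le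
        have h4 : ‖y⁻¹‖ ≤ 1 + l := h1.trans (mul_le_of_le_one_right (by positivity) h3)
        have h5 : 2 * (step m : ℂ) / ((m : ℂ) * y) = ((2 * step m / m : ℝ) : ℂ) * y⁻¹ := by
          push_cast; rw [← div_div, div_eq_mul_inv _ y]
        have h6 : 0 ≤ 2 * step m / m := by have := step_pos m; positivity
        rw [norm_neg, h5, mul_assoc, norm_mul, norm_mul, Complex.norm_real, Real.norm_eq_abs,
          abs_of_nonneg h6]
        gcongr
      · intro y hy
        have hg : 0 < gauge l y := zero_lt_one.trans (hgpos y hy)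
        have h1 : Tendsto (fun s : ℝ => K₃ * (gauge l y + s) ^ (-(((N + 1 : ℕ) : ℝ) * e))) atTop
            (𝓝 0) := by
          have h2 := ((tendsto_rpow_neg_atTop (y := ((N + 1 : ℕ) : ℝ) * e) (by positivity)).comp
            (tendsto_atTop_add_const_left atTop (gauge l y) tendsto_id)).const_mul K₃
          simpa using h2
        refine squeeze_zero_norm' ?_ h1
        filter_upwards [eventually_ge_atTop 0] with s hs
        rw [← gauge_add_real]
        exact hE _ (wedge_add_real hy hs) a ha
  cases N with
  | zero =>
    obtain ⟨K₁, hK₁0, hK₁⟩ := main 0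
    obtain ⟨M₁, hM₁0, hM₁⟩ := norm_ev_le (C (φ 0)) ρ
    refine ⟨K₁ + M₁, fun y hy a ha => ?_⟩
    have h1 := hK₁ y hy a ha
    have h2 := hM₁ a ha _ (hR₀ y (hsub hy)).1
    have h3 : gauge l y ^ (-(((0 + 1 : ℕ) : ℝ) * e)) ≤ 1 :=
      Real.rpow_le_one_of_one_le_of_nonpos (hgpos y hy).le (by simp [he0.le])
    simp only [zero_add, Finset.range_one, Finset.sum_singleton, pow_zero, mul_one,
      Finset.range_zero, Finset.sum_empty, map_zero, sub_zero, Nat.cast_zero, zero_mul, neg_zero,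
      Real.rpow_zero] at h1 h3 ⊢
    calc ‖U (y, a)‖ = ‖(U (y, a) - ev a (zc m b y) (C (φ 0))) + ev a (zc m b y) (C (φ 0))‖ := by
          rw [sub_add_cancel]
      _ ≤ _ := norm_add_le _ _
      _ ≤ _ := add_le_add (h1.trans (mul_le_of_le_one_right hK₁0 h3)) h2
  | succ N =>
    obtain ⟨K₁, -, hK₁⟩ := main N
    exact ⟨K₁, hK₁⟩

end Asymptotics

/-! ### Continuation to the whole covering. -/

section Extension

variable {m : ℕ}

/-- The leading term `x ^ r(a) * exp (-S(x, a))`. -/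
noncomputable def lead (m : ℕ) (a : Fin m → ℂ) (t : ℂ) : ℂ :=
  Complex.exp (r m a * t) * Complex.exp (-S m a t)

theorem lead_ne_zero (a : Fin m → ℂ) (t : ℂ) : lead m a t ≠ 0 :=
  mul_ne_zero (Complex.exp_ne_zero _) (Complex.exp_ne_zero _)

theorem hasDerivAt_lead (hm : 0 < m) (a : Fin m → ℂ) (t : ℂ) :
    HasDerivAt (lead m a) (lead m a t * (kap m - tauFun m a t)) t := by
  have h1 := ((hasDerivAt_id t).const_mul (r m a)).cexp
  have h2 := (hasDerivAt_S' hm a t).neg.cexp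
  refine (h1.mul h2).congr_deriv ?_
  simp only [lead, id, Pi.neg_apply]
  ring

theorem differentiable_lead (t : ℂ) : Differentiable ℂ (fun a : Fin m → ℂ => lead m a t) := by
  have h1 : Differentiable ℂ (fun a : Fin m → ℂ => S m a t) :=
    differentiable_S.comp (f := fun a : Fin m → ℂ => (t, a)) (by fun_prop)
  exact ((differentiable_r.mul_const t).cexp).mul h1.neg.cexp

/-- Passage from the equation for `U` in the variable `y` to the first order system. -/
theorem hasDerivAt_system (hm : 0 < m) (b : ℝ) {y : ℂ} (hy : y ∈ Complex.slitPlane)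
    (a : Fin m → ℂ) {U V : ℂ → ℂ} (hU : HasDerivAt U (V y) y)
    (hV : HasDerivAt V (coeffB m b (y, a) * V y - coeffK m b (y, a) * U y) y) :
    HasDerivAt (fun y => lead m a (tc m b y) * U y)
      (2 / ((m : ℂ) * y) * Complex.exp (tc m b y) * (Complex.exp (-tc m b y) *
        (lead m a (tc m b y) *
          ((kap m - tauFun m a (tc m b y)) * U y + (m : ℂ) / 2 * y * V y)))) y ∧
    HasDerivAt (fun y => Complex.exp (-tc m b y) * (lead m a (tc m b y) *
        ((kap m - tauFun m a (tc m b y)) * U y + (m : ℂ) / 2 * y * V y)))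
      (2 / ((m : ℂ) * y) * (Complex.exp (-tc m b y) * P m a (Complex.exp (tc m b y))) *
        (lead m a (tc m b y) * U y)) y := by
  have hm' : (m : ℂ) ≠ 0 := Nat.cast_ne_zero.mpr hm.ne'
  have hy0 := Complex.slitPlane_ne_zero hy
  have ht := hasDerivAt_tc (m := m) b hy
  have hl := (hasDerivAt_lead hm a (tc m b y)).comp y ht
  have hτ := (hasDerivAt_tauFun hm a (tc m b y)).comp y ht
  have hexp : Complex.exp (tc m b y) * Complex.exp (-tc m b y) = 1 := by
    rw [← Complex.exp_add]; simp
  constructor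
  · refine (hl.mul hU).congr_deriv ?_
    simp only [Function.comp]
    have : 2 / ((m : ℂ) * y) * ((m : ℂ) / 2 * y) = 1 := by field_simp
    linear_combination (-(lead m a (tc m b y)) * V y) * this - 2 / ((m : ℂ) * y) *
      (lead m a (tc m b y) * ((kap m - tauFun m a (tc m b y)) * U y + (m : ℂ) / 2 * y * V y)) * hexp
  · have h1 := (hτ.const_sub (kap m)).mul hU
    have h2 := ((hasDerivAt_id y).const_mul ((m : ℂ) / 2)).mul hV
    refine (ht.neg.cexp.mul (hl.mul (h1.add h2))).congr_deriv ?_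
    simp only [Function.comp, id, Pi.neg_apply, Pi.mul_apply, Pi.add_apply]
    rw [exp_tc hm b hy0]
    have h3 := tauFun_tc hm b hy0 a
    have h4 : coeffK m b (y, a) = 4 / (m : ℂ) ^ 2 * Complex.exp (b * Complex.I) * y⁻¹ *
      (Complex.exp (-(step m : ℂ) * tc m b y) *
        ev a (Complex.exp (-(step m : ℂ) * tc m b y)) (rhoPoly m)) := rfl
    have h5 : coeffB m b (y, a) = 4 / (m : ℂ) * y⁻¹ * tauFun m a (tc m b y) := by
      rw [h3]; field_simp
    have h6 : kap m = 1 / 2 - (m : ℂ) / 4 := rfl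
    rw [h4, h5, h6]
    generalize Complex.exp (-(step m : ℂ) * tc m b y) *
        ev a (Complex.exp (-(step m : ℂ) * tc m b y)) (rhoPoly m) = Q
    generalize tauFun m a (tc m b y) = T
    generalize P m a (Complex.exp (tc m b y)) = p
    generalize lead m a (tc m b y) = L
    generalize Complex.exp (-tc m b y) = E
    field_simp
    ring

/-- U lives only where the branch of log y does. Its Wronskians with the entire basis c, s are
constant on the connected wedge complement, so the coefficients can be computed at one base point,
where they are visibly holomorphic in a; the resulting combination of c and s is entire in t. -/
theorem exists_local_solution (hm : 0 < m) {b : ℝ} (hb : 0 < Real.cos b) {l : ℝ} (hl : 0 ≤ l)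
    (ρ : ℝ) {φ : ℕ → MvPolynomial (Fin m) ℂ} (hφ0 : φ 0 = 1)
    (hφ : ∀ N, X ^ N ∣ eulerOp (step m) (m / 2) (pole m) (tauPoly m) (rhoPoly m)
      (∑ n ∈ Finset.range N, C (φ n) * X ^ n)) :
    ∃ R : ℝ, 1 ≤ R ∧ ∃ f : ℂ → (Fin m → ℂ) → ℂ,
      (∀ a ∈ Metric.ball 0 ρ, IsSolution m a (fun t => f t a)) ∧
      (∀ t, DifferentiableOn ℂ (f t) (Metric.ball 0 ρ)) ∧
      ∀ N : ℕ, ∃ K, ∀ t : ℂ, |(m : ℝ) / 2 * t.im - b| < Real.pi →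
        Complex.exp ((m : ℂ) / 2 * t - b * Complex.I) ∈ wedge l R → ∀ a ∈ Metric.ball 0 ρ,
        ‖f t a / lead m a t - ev a (Complex.exp (-(step m : ℂ) * t))
            (∑ n ∈ Finset.range N, C (φ n) * X ^ n)‖ ≤
          K * gauge l (Complex.exp ((m : ℂ) / 2 * t - b * Complex.I)) ^
            (-(N * (1 / (pole m : ℝ)))) := by
  obtain ⟨R, hR1, U, V, hUd, hVd, hU, hV, hasym⟩ := exists_asymptotic_solution hm hb hl ρ hφ0 hφ
  obtain ⟨c, c', s, s', hcd, hcd', hsd, hsd', hc, hs, hW⟩ := exists_fundamental m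
  have hslit : wedge l R ⊆ Complex.slitPlane := wedge_subset_slitPlane (by linarith)
  set F : ℂ → (Fin m → ℂ) → ℂ := fun y a => lead m a (tc m b y) * U (y, a) with hF
  set G : ℂ → (Fin m → ℂ) → ℂ := fun y a => Complex.exp (-tc m b y) * (lead m a (tc m b y) *
    ((kap m - tauFun m a (tc m b y)) * U (y, a) + (m : ℂ) / 2 * y * V (y, a))) with hG
  have hsys : ∀ y ∈ wedge l R, ∀ a ∈ Metric.ball (0 : Fin m → ℂ) ρ, _ := fun y hy a ha =>
    hasDerivAt_system hm b (hslit hy) a (U := fun y => U (y, a)) (V := fun y => V (y, a))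
      (hU y hy a ha) (hV y hy a ha)
  have hpair : ∀ (f v : ℂ → ℂ) (a : Fin m → ℂ), IsPair m a f v → ∀ y ∈ wedge l R,
      HasDerivAt (fun y => f (tc m b y))
        (2 / ((m : ℂ) * y) * Complex.exp (tc m b y) * v (tc m b y)) y ∧
      HasDerivAt (fun y => v (tc m b y)) (2 / ((m : ℂ) * y) *
        (Complex.exp (-tc m b y) * P m a (Complex.exp (tc m b y))) * f (tc m b y)) y := by
    intro f v a h y hy
    have ht := hasDerivAt_tc (m := m) b (hslit hy)
    constructor
    · refine ((h (tc m b y)).1.comp y ht).congr_deriv ?_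
      ring
    · refine ((h (tc m b y)).2.comp y ht).congr_deriv ?_
      ring
  set x₀ : ℂ := ((R + 1 : ℝ) : ℂ) with hx₀
  have hx₀mem : x₀ ∈ wedge l R := by simp [wedge, gauge, hx₀]
  set α : (Fin m → ℂ) → ℂ := fun a => F x₀ a * s' (tc m b x₀, a) - G x₀ a * s (tc m b x₀, a) with hα
  set γ : (Fin m → ℂ) → ℂ := fun a => F x₀ a * c' (tc m b x₀, a) - G x₀ a * c (tc m b x₀, a) with hγ
  have hrep : ∀ y ∈ wedge l R, ∀ a ∈ Metric.ball 0 ρ,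
      F y a = α a * c (tc m b y, a) + -γ a * s (tc m b y, a) := by
    intro y hy a ha
    have e1 := wronskian_eq (isOpen_wedge l R) isPreconnected_wedge
      (fun y hy => (hsys y hy a ha).1) (fun y hy => (hsys y hy a ha).2)
      (fun y hy => (hpair _ _ a (hs a) y hy).1) (fun y hy => (hpair _ _ a (hs a) y hy).2) hx₀mem hy
    have e2 := wronskian_eq (isOpen_wedge l R) isPreconnected_wedge
      (fun y hy => (hsys y hy a ha).1) (fun y hy => (hsys y hy a ha).2)
      (fun y hy => (hpair _ _ a (hc a) y hy).1) (fun y hy => (hpair _ _ a (hc a) y hy).2) hx₀mem hy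
    have e3 := hW (tc m b y) a
    have e1' : α a = F y a * s' (tc m b y, a) - G y a * s (tc m b y, a) := e1
    have e2' : γ a = F y a * c' (tc m b y, a) - G y a * c (tc m b y, a) := e2
    rw [e1', e2']
    linear_combination -(F y a) * e3
  have hslice : ∀ {H : ℂ × (Fin m → ℂ) → ℂ} (t : ℂ), Differentiable ℂ H →
      DifferentiableOn ℂ (fun a => H (t, a)) (Metric.ball 0 ρ) := fun t h =>
    (h.comp (f := fun a : Fin m → ℂ => (t, a)) (by fun_prop)).differentiableOn
  have hslice' : ∀ {H : ℂ × (Fin m → ℂ) → ℂ}, DifferentiableOn ℂ H (wedge l R ×ˢ Metric.ball 0 ρ) →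
      DifferentiableOn ℂ (fun a => H (x₀, a)) (Metric.ball 0 ρ) := fun h =>
    h.comp (f := fun a : Fin m → ℂ => (x₀, a)) (by fun_prop) fun a ha => ⟨hx₀mem, ha⟩
  have hFd : DifferentiableOn ℂ (F x₀) (Metric.ball 0 ρ) :=
    (differentiable_lead _).differentiableOn.mul (hslice' hUd)
  have hτd : Differentiable ℂ (fun a : Fin m → ℂ => tauFun m a (tc m b x₀)) := by
    unfold tauFun
    exact ((differentiable_ev (tauPoly m)).comp
      (f := fun a : Fin m → ℂ => (Complex.exp (-(step m : ℂ) * tc m b x₀), a))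
      (by fun_prop)).const_mul _
  have hGd : DifferentiableOn ℂ (G x₀) (Metric.ball 0 ρ) :=
    ((differentiable_lead _).differentiableOn.mul (((hτd.const_sub _).differentiableOn.mul
      (hslice' hUd)).add ((hslice' hVd).const_mul _))).const_mul _
  refine ⟨R, hR1, fun t a => α a * c (t, a) + -γ a * s (t, a), fun a ha => ?_, fun t => ?_,
    fun N => ?_⟩
  · exact ((hc a).linearComb (hs a) (α a) (-γ a)).isSolution
  · have hαd : DifferentiableOn ℂ α (Metric.ball 0 ρ) :=
      (hFd.mul (hslice _ hsd')).sub (hGd.mul (hslice _ hsd))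
    have hγd : DifferentiableOn ℂ γ (Metric.ball 0 ρ) :=
      (hFd.mul (hslice _ hcd')).sub (hGd.mul (hslice _ hcd))
    exact (hαd.mul (hslice t hcd)).add (hγd.neg.mul (hslice t hsd))
  · obtain ⟨K, hK⟩ := hasym N
    refine ⟨K, fun t ht hy a ha => ?_⟩
    have h1 := hrep _ hy a ha
    have h2 := hK _ hy a ha
    rw [tc_exp hm b ht] at h1
    beta_reduce
    rw [← h1]
    simp only [hF, tc_exp hm b ht]
    rw [zc, tc_exp hm b ht] at h2
    rwa [mul_div_cancel_left₀ _ (lead_ne_zero a t)]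

end Extension

/-! ### From wedge complements to sectors in arg x. -/

section Sector

variable {m : ℕ}

theorem gauge_mul_exp {ρ : ℝ} (hρ : 0 ≤ ρ) (l ψ : ℝ) :
    gauge l (ρ * Complex.exp (ψ * Complex.I)) = ρ * (l * |Real.sin ψ| + Real.cos ψ) := by
  rw [gauge, Complex.im_ofReal_mul, Complex.re_ofReal_mul, Complex.exp_ofReal_mul_I_im,
    Complex.exp_ofReal_mul_I_re, abs_mul, abs_of_nonneg hρ]
  ring

/-- If cos ψ ≥ 0, then |sin ψ| + cos ψ ≥ 1 already. If cos ψ < 0, then |ψ| lies between π/2 and π -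
δ, so |sin ψ| ≥ sin δ and the first term is at least 2. -/
theorem one_le_gauge_angle {δ ψ : ℝ} (hδ : 0 < δ) (hδ' : δ < Real.pi / 2)
    (hψ : |ψ| ≤ Real.pi - δ) : 1 ≤ 2 / Real.sin δ * |Real.sin ψ| + Real.cos ψ := by
  have hsδ : 0 < Real.sin δ := Real.sin_pos_of_pos_of_lt_pi hδ (by linarith)
  rcases le_or_gt 0 (Real.cos ψ) with hc | hc
  · have h1 : 1 ≤ 2 / Real.sin δ := by
      rw [le_div_iff₀ hsδ]; linarith [Real.sin_le_one δ]
    have h2 := Real.abs_sin_le_one ψ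
    have h3 := Real.sin_sq_add_cos_sq ψ
    have h4 := Real.cos_le_one ψ
    have h5 : |Real.sin ψ| ^ 2 = Real.sin ψ ^ 2 := sq_abs _
    have h6 := abs_nonneg (Real.sin ψ)
    nlinarith
  · have h1 : Real.pi / 2 < |ψ| := by
      by_contra! h
      rw [abs_le] at h
      exact absurd (Real.cos_nonneg_of_mem_Icc ⟨by linarith [h.1], h.2⟩) (not_le.mpr hc)
    have h2 : Real.sin δ ≤ |Real.sin ψ| := by
      have h3 : |Real.sin ψ| = Real.sin (Real.pi - |ψ|) := by
        rw [Real.sin_pi_sub, ← Real.abs_sin_eq_sin_abs_of_abs_le_pi (by linarith)]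
      rw [h3]
      exact Real.sin_le_sin_of_le_of_le_pi_div_two (by linarith) (by linarith) (by linarith)
    have h4 : 2 ≤ 2 / Real.sin δ * |Real.sin ψ| := by
      rw [div_mul_eq_mul_div, le_div_iff₀ hsδ]; linarith
    linarith [Real.neg_one_le_cos ψ]

theorem gauge_exp_ge (t : ℂ) {b δ : ℝ} (hδ : 0 < δ) (hδ' : δ < Real.pi / 2)
    (h : |(m : ℝ) / 2 * t.im - b| ≤ Real.pi - δ) :
    Real.exp ((m : ℝ) / 2 * t.re) ≤
      gauge (2 / Real.sin δ) (Complex.exp ((m : ℂ) / 2 * t - b * Complex.I)) := by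
  have h1 : Complex.exp ((m : ℂ) / 2 * t - b * Complex.I) = (Real.exp ((m : ℝ) / 2 * t.re) : ℝ) *
      Complex.exp (((m : ℝ) / 2 * t.im - b : ℝ) * Complex.I) := by
    rw [Complex.ofReal_exp, ← Complex.exp_add]
    congr 1
    conv_lhs => rw [← Complex.re_add_im t]
    push_cast
    ring
  rw [h1, gauge_mul_exp (Real.exp_pos _).le]
  exact le_mul_of_one_le_right (Real.exp_pos _).le (one_le_gauge_angle hδ hδ' h)

theorem exp_rpow_pole (hm : 0 < m) (x : ℝ) (N : ℕ) :
    Real.exp ((m : ℝ) / 2 * x) ^ (-(N * (1 / (pole m : ℝ)))) = Real.exp (-(step m * N * x)) := by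
  have hp : (pole m : ℝ) ≠ 0 := Nat.cast_ne_zero.mpr (pole_pos m hm).ne'
  have h1 : step m * pole m = (m : ℝ) / 2 := by
    refine Complex.ofReal_injective ?_
    push_cast
    exact step_mul_pole m
  rw [← Real.exp_mul, ← h1]
  congr 1
  field_simp

/-- A solution with the required asymptotic expansion in a sector whose opening, in terms of
`x ^ (m / 2)`, is less than `2 π`. -/
theorem exists_sector_solution (hm : 0 < m) {b δ : ℝ} (hb : 0 < Real.cos b) (hδ : 0 < δ)
    (hδ' : δ < Real.pi / 2) (ρ : ℝ) {φ : ℕ → MvPolynomial (Fin m) ℂ} (hφ0 : φ 0 = 1)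
    (hφ : ∀ N, X ^ N ∣ eulerOp (step m) (m / 2) (pole m) (tauPoly m) (rhoPoly m)
      (∑ n ∈ Finset.range N, C (φ n) * X ^ n)) :
    ∃ R : ℝ, ∃ f : ℂ → (Fin m → ℂ) → ℂ,
      (∀ a ∈ Metric.ball 0 ρ, IsSolution m a (fun t => f t a)) ∧
      (∀ t, DifferentiableOn ℂ (f t) (Metric.ball 0 ρ)) ∧
      ∀ N : ℕ, ∃ K, ∀ t : ℂ, |(m : ℝ) / 2 * t.im - b| ≤ Real.pi - δ → R ≤ t.re →
        ∀ a ∈ Metric.ball 0 ρ, ‖f t a / lead m a t - ∑ n ∈ Finset.range N,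
            MvPolynomial.eval a (φ n) * Complex.exp (-((step m : ℂ) * (n : ℂ) * t))‖ ≤
          K * Real.exp (-(step m * (N : ℝ) * t.re)) := by
  have hsδ : 0 < Real.sin δ := Real.sin_pos_of_pos_of_lt_pi hδ (by linarith)
  obtain ⟨R, hR1, f, hf, hfd, hasym⟩ := exists_local_solution hm hb (l := 2 / Real.sin δ)
    (by positivity) ρ hφ0 hφ
  have hmR : (0 : ℝ) < m := Nat.cast_pos.mpr hm
  -- Beyond this bound on ln|x|, |y| = |x|^{m/2} is at least R + 1, and the gauge is at least |y| in
  -- the sector.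
  refine ⟨2 / m * Real.log (R + 1), f, hf, hfd, fun N => ?_⟩
  obtain ⟨K, hK⟩ := hasym N
  refine ⟨|K|, fun t ht hRt a ha => ?_⟩
  have h1 := gauge_exp_ge (m := m) t hδ hδ' ht
  have h2 : R + 1 ≤ Real.exp ((m : ℝ) / 2 * t.re) := by
    rw [← Real.log_le_iff_le_exp (by linarith)]
    calc Real.log (R + 1) = (m : ℝ) / 2 * (2 / m * Real.log (R + 1)) := by field_simp
      _ ≤ _ := mul_le_mul_of_nonneg_left hRt (by positivity)
  have h3 := hK t (lt_of_le_of_lt ht (by linarith)) (lt_of_lt_of_le (by linarith) (h2.trans h1)) a ha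
  have h4 : ev a (Complex.exp (-(step m : ℂ) * t)) (∑ n ∈ Finset.range N, C (φ n) * X ^ n) =
      ∑ n ∈ Finset.range N,
        MvPolynomial.eval a (φ n) * Complex.exp (-((step m : ℂ) * (n : ℂ) * t)) := by
    rw [map_sum]
    refine Finset.sum_congr rfl fun n _ => ?_
    rw [map_mul, map_pow, ev_X, ev_C, ← Complex.exp_nat_mul]
    congr 2; ring
  rw [h4] at h3
  rw [← exp_rpow_pole hm]
  refine h3.trans ?_
  have h5 := Real.rpow_le_rpow_of_nonpos (Real.exp_pos _) h1
    (z := -(N * (1 / (pole m : ℝ)))) (by simp; positivity)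
  calc _ ≤ |K| * gauge (2 / Real.sin δ) (Complex.exp ((m : ℂ) / 2 * t - b * Complex.I)) ^
        (-(N * (1 / (pole m : ℝ)))) :=
      mul_le_mul_of_nonneg_right (le_abs_self K)
        (Real.rpow_nonneg ((Real.exp_pos _).le.trans h1) _)
    _ ≤ _ := mul_le_mul_of_nonneg_left h5 (abs_nonneg K)

end Sector

/-! ### Growth and decay of x^r e^{-S} along rays. -/

section LeadGrowth

variable {m : ℕ}

/-- On arg x = v, τ equals x^{m/2}(1 + o(1)), so the sign of cos(mv/2) decides; σ only selects which
sign is treated. -/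
theorem tendsto_re_tauFun (hm : 0 < m) (a : Fin m → ℂ) {v σ : ℝ}
    (hσ : 0 < σ * Real.cos ((m : ℝ) / 2 * v)) :
    Tendsto (fun x : ℝ => σ * (tauFun m a (x + v * Complex.I)).re) atTop atTop := by
  have hmR : (0 : ℝ) < m := Nat.cast_pos.mpr hm
  set ζ : ℂ := Complex.exp (((m : ℝ) / 2 * v : ℝ) * Complex.I) with hζ
  have hz : Tendsto (fun x : ℝ => Complex.exp (-(step m : ℂ) * (x + v * Complex.I))) atTop (𝓝 0) := by
    rw [tendsto_zero_iff_norm_tendsto_zero]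
    have h1 : ∀ x : ℝ, ‖Complex.exp (-(step m : ℂ) * (x + v * Complex.I))‖ =
        Real.exp (-step m * x) := by
      intro x
      rw [Complex.norm_exp, ← Complex.ofReal_neg, Complex.re_ofReal_mul]
      simp
    simp only [h1]
    exact Real.tendsto_exp_atBot.comp
      (tendsto_id.const_mul_atTop_of_neg (by have := step_pos m; linarith))
  have hev : Tendsto (fun x : ℝ => σ * (ζ * ev a (Complex.exp (-(step m : ℂ) *
      (x + v * Complex.I))) (tauPoly m)).re) atTop (𝓝 (σ * Real.cos ((m : ℝ) / 2 * v))) := by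
    have h1 : ev a 0 (tauPoly m) = 1 := by
      rw [ev, coe_eval₂RingHom, eval₂_at_zero, tauPoly_coeff_zero, map_one]
    have h2 : Tendsto (fun z => σ * (ζ * ev a z (tauPoly m)).re) (𝓝 0)
        (𝓝 (σ * (ζ * ev a 0 (tauPoly m)).re)) := by
      have h3 : ContinuousAt (fun z => ev a z (tauPoly m)) 0 :=
        (hasDerivAt_ev a 0 (tauPoly m)).continuousAt
      have h4 : ContinuousAt (fun z => σ * (ζ * ev a z (tauPoly m)).re) 0 :=
        continuousAt_const.mul
          (Complex.continuous_re.continuousAt.comp (continuousAt_const.mul h3))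
      exact h4
    rw [h1, mul_one, hζ, Complex.exp_ofReal_mul_I_re] at h2
    exact h2.comp hz
  have hexp : Tendsto (fun x : ℝ => Real.exp ((m : ℝ) / 2 * x)) atTop atTop :=
    Real.tendsto_exp_atTop.comp (tendsto_id.const_mul_atTop (by positivity))
  refine (hexp.atTop_mul_pos hσ hev).congr fun x => ?_
  have h1 : tauFun m a (x + v * Complex.I) = ((Real.exp ((m : ℝ) / 2 * x) : ℝ) : ℂ) *
      (ζ * ev a (Complex.exp (-(step m : ℂ) * (x + v * Complex.I))) (tauPoly m)) := by
    rw [tauFun, hζ, ← mul_assoc, Complex.ofReal_exp, ← Complex.exp_add]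
    congr 2
    push_cast; ring
  rw [h1, Complex.re_ofReal_mul]
  ring

/-- The derivative of the exponent is σ Re(τ - κ), eventually at least 1, so growth is at least
linear. -/
theorem tendsto_re_exponent (hm : 0 < m) (a : Fin m → ℂ) {v σ : ℝ}
    (hσ : 0 < σ * Real.cos ((m : ℝ) / 2 * v)) :
    Tendsto (fun x : ℝ => σ * (S m a (x + v * Complex.I) - r m a * (x + v * Complex.I)).re)
      atTop atTop := by
  have hd : ∀ x : ℝ, HasDerivAt
      (fun x : ℝ => σ * (S m a (x + v * Complex.I) - r m a * (x + v * Complex.I)).re)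
      (σ * (tauFun m a (x + v * Complex.I) - kap m).re) x := by
    intro x
    have h1 : HasDerivAt (fun x : ℝ => (x : ℂ) + v * Complex.I) 1 x := by
      simpa using (Complex.ofRealCLM.hasDerivAt (x := x)).add_const (v * Complex.I)
    have h2 := ((hasDerivAt_S' hm a (x + v * Complex.I)).sub
      ((hasDerivAt_id _).const_mul (r m a))).comp x h1
    have h3 := (Complex.reCLM.hasFDerivAt.comp_hasDerivAt x h2).const_mul σ
    refine h3.congr_deriv ?_
    simp only [mul_one, Complex.reCLM_apply, Complex.sub_re, Complex.add_re]
    ring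
  have h1 : ∀ᶠ x : ℝ in atTop, 1 ≤ σ * (tauFun m a (x + v * Complex.I) - kap m).re := by
    filter_upwards [(tendsto_re_tauFun hm a hσ).eventually_ge_atTop (1 + σ * (kap m).re)] with x hx
    rw [Complex.sub_re, mul_sub]
    linarith
  obtain ⟨X₀, hX₀⟩ := eventually_atTop.mp h1
  set g : ℝ → ℝ :=
    fun x : ℝ => σ * (S m a (x + v * Complex.I) - r m a * (x + v * Complex.I)).re with hg
  have h2 : ∀ x, X₀ ≤ x → 1 * (x - X₀) ≤ g x - g X₀ := by
    intro x hx
    refine (convex_Ici X₀).mul_sub_le_image_sub_of_le_deriv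
      (fun y _ => (hd y).continuousAt.continuousWithinAt)
      (fun y _ => (hd y).differentiableAt.differentiableWithinAt) (fun y hy => ?_) X₀ self_mem_Ici
      x hx hx
    rw [(hd y).deriv]
    exact hX₀ y (interior_subset hy)
  refine tendsto_atTop_mono' atTop ?_ (tendsto_atTop_add_const_right atTop (g X₀ - X₀) tendsto_id)
  filter_upwards [eventually_ge_atTop X₀] with x hx
  have := h2 x hx
  simp only [id]; linarith

theorem norm_lead (a : Fin m → ℂ) (t : ℂ) :
    ‖lead m a t‖ = Real.exp (-(S m a t - r m a * t).re) := by
  rw [lead, ← Complex.exp_add, Complex.norm_exp]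
  congr 1
  simp; ring

theorem tendsto_lead_zero (hm : 0 < m) (a : Fin m → ℂ) {v : ℝ}
    (hv : 0 < Real.cos ((m : ℝ) / 2 * v)) :
    Tendsto (fun x : ℝ => ‖lead m a (x + v * Complex.I)‖) atTop (𝓝 0) := by
  simp only [norm_lead]
  have h1 := tendsto_re_exponent hm a (v := v) (σ := 1) (by linarith)
  simp only [one_mul] at h1
  exact Real.tendsto_exp_atBot.comp (tendsto_neg_atTop_atBot.comp h1)

theorem tendsto_lead_atTop (hm : 0 < m) (a : Fin m → ℂ) {v : ℝ}
    (hv : Real.cos ((m : ℝ) / 2 * v) < 0) :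
    Tendsto (fun x : ℝ => ‖lead m a (x + v * Complex.I)‖) atTop atTop := by
  simp only [norm_lead]
  have h1 := tendsto_re_exponent hm a (v := v) (σ := -1) (by linarith)
  simp only [neg_one_mul] at h1
  exact Real.tendsto_exp_atTop.comp h1

end LeadGrowth

/-! ### Uniqueness of the subdominant solution. -/

section Uniqueness

variable {m : ℕ} {a : Fin m → ℂ}

/-- Solutions which are asymptotic to the leading term near the positive axis. -/
def IsNormalized (m : ℕ) (a : Fin m → ℂ) (f : ℂ → ℂ) : Prop :=
  IsSolution m a f ∧ ∃ C R : ℝ, ∀ t : ℂ, |t.im| ≤ 1 / (m : ℝ) → R ≤ t.re →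
    ‖f t / lead m a t - 1‖ ≤ C * Real.exp (-(step m * t.re))

theorem tendsto_exp_step (C : ℝ) :
    Tendsto (fun x : ℝ => C * Real.exp (-(step m * x))) atTop (𝓝 0) := by
  have h1 : Tendsto (fun x : ℝ => Real.exp (-step m * x)) atTop (𝓝 0) :=
    Real.tendsto_exp_atBot.comp
      (tendsto_id.const_mul_atTop_of_neg (by have := step_pos m; linarith))
  simpa [neg_mul] using h1.const_mul C

theorem IsNormalized.tendsto {f : ℂ → ℂ} (h : IsNormalized m a f) :
    Tendsto (fun x : ℝ => f x / lead m a x) atTop (𝓝 1) := by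
  obtain ⟨-, C, R, hCR⟩ := h
  rw [tendsto_iff_norm_sub_tendsto_zero]
  refine squeeze_zero' (Eventually.of_forall fun _ => norm_nonneg _) ?_ (tendsto_exp_step (m := m) C)
  filter_upwards [eventually_ge_atTop R] with x hx
  have := hCR x (by simp) (by simpa using hx)
  simpa using this

theorem hasDerivAt_div_lead (hm : 0 < m) {f : ℂ → ℂ} (h : IsSolution m a f) (t : ℂ) :
    HasDerivAt (fun t => f t / lead m a t) (Complex.exp t * dx f t / lead m a t -
      (f t / lead m a t) * (kap m - tauFun m a t)) t := by
  have h0 := lead_ne_zero a t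
  refine ((h.isPair t).1.div (hasDerivAt_lead hm a t) h0).congr_deriv ?_
  field_simp

/-- The derivative of f/lead tends to 0 by Cauchy's estimate on discs of radius 1/m, which fit in
the strip |arg x| ≤ 1/m of the definition. -/
theorem IsNormalized.tendsto_deriv (hm : 0 < m) {f : ℂ → ℂ} (h : IsNormalized m a f) :
    Tendsto (fun x : ℝ => Complex.exp x * dx f x / lead m a x -
      (f x / lead m a x) * (kap m - tauFun m a x)) atTop (𝓝 0) := by
  obtain ⟨hf, C, R, hCR⟩ := h
  have hmR : (0 : ℝ) < m := Nat.cast_pos.mpr hm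
  rw [tendsto_zero_iff_norm_tendsto_zero]
  set q : ℝ := 1 / (m : ℝ) with hq
  have hq0 : 0 < q := by positivity
  have h1 : Tendsto (fun x : ℝ => |C| * Real.exp (-(step m * (x - q))) / q) atTop (𝓝 0) := by
    have h2 := ((tendsto_exp_step (m := m) |C|).comp
      (tendsto_atTop_add_const_right atTop (-q) tendsto_id)).div_const q
    simpa [Function.comp_def, sub_eq_add_neg] using h2
  refine squeeze_zero' (Eventually.of_forall fun _ => norm_nonneg _) ?_ h1
  filter_upwards [eventually_ge_atTop (R + q)] with x hx
  have hd := fun t => (hasDerivAt_div_lead hm hf t).sub_const 1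
  rw [← (hd x).deriv]
  refine Complex.norm_deriv_le_of_forall_mem_sphere_norm_le hq0
    (Differentiable.diffContOnCl fun t => (hd t).differentiableAt) fun z hz => ?_
  have h3 : ‖z - x‖ = q := by simpa [dist_eq_norm] using hz
  have h4 := Complex.abs_re_le_norm (z - x)
  have h5 := Complex.abs_im_le_norm (z - x)
  rw [h3] at h4 h5
  simp only [Complex.sub_re, Complex.ofReal_re, Complex.sub_im, Complex.ofReal_im, sub_zero] at h4 h5
  have h6 := (abs_le.mp h4).1
  refine (hCR z h5 (by linarith)).trans ?_
  have h7 : Real.exp (-(step m * z.re)) ≤ Real.exp (-(step m * (x - q))) := by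
    refine Real.exp_le_exp.mpr ?_
    have := step_pos m
    nlinarith
  exact (mul_le_mul_of_nonneg_right (le_abs_self C) (Real.exp_pos _).le).trans
    (mul_le_mul_of_nonneg_left h7 (abs_nonneg C))

/-- The subdominant solution is determined by its leading asymptotic term. -/
theorem IsNormalized.unique (hm : 0 < m) {f g : ℂ → ℂ} (hf : IsNormalized m a f)
    (hg : IsNormalized m a g) : f = g := by
  have hlead : Tendsto (fun x : ℝ => Complex.exp (-x) * lead m a x ^ 2) atTop (𝓝 0) := by
    rw [tendsto_zero_iff_norm_tendsto_zero]
    have h1 := tendsto_lead_zero hm a (v := 0) (by simp)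
    simp only [Complex.ofReal_zero, zero_mul, add_zero] at h1
    have h2 := h1.pow 2
    rw [zero_pow two_ne_zero] at h2
    refine squeeze_zero' (Eventually.of_forall fun _ => norm_nonneg _) ?_ h2
    filter_upwards [eventually_ge_atTop 0] with x hx
    rw [norm_mul, norm_pow]
    refine mul_le_of_le_one_left (by positivity) ?_
    rw [Complex.norm_exp]
    simpa using hx
  have h1 := hlead.mul ((hf.tendsto.mul (hg.tendsto_deriv hm)).sub
    ((hf.tendsto_deriv hm).mul hg.tendsto))
  simp only [mul_zero, zero_mul, sub_zero] at h1
  -- With f = lead · u and g = lead · w, the terms in κ - τ cancel and the Wronskian is e^{-x} lead²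
  -- (u w' - u' w), with derivatives in t. Both factors tend to 0.
  have hW : ∀ x : ℝ, Complex.exp (-x) * lead m a x ^ 2 * (f x / lead m a x *
      (Complex.exp x * dx g x / lead m a x - g x / lead m a x * (kap m - tauFun m a x)) -
      (Complex.exp x * dx f x / lead m a x - f x / lead m a x * (kap m - tauFun m a x)) *
        (g x / lead m a x)) = f 0 * dx g 0 - dx f 0 * g 0 := by
    intro x
    rw [← hf.1.isPair.wronskian_eq hg.1.isPair x 0]
    have h0 := lead_ne_zero a (x : ℂ)
    have he : Complex.exp (-(x : ℂ)) * Complex.exp x = 1 := by rw [← Complex.exp_add]; simp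
    have h2 : f x * dx g x - dx f x * g x =
        Complex.exp (-(x : ℂ)) * Complex.exp x * (f x * dx g x - dx f x * g x) := by
      rw [he, one_mul]
    rw [h2]
    field_simp
    ring
  simp only [hW] at h1
  have hW0 := tendsto_nhds_unique tendsto_const_nhds h1
  have hdep := hf.1.isPair.dependent_of_wronskian_eq_zero hg.1.isPair hW0
  unfold Indep at hdep
  push Not at hdep
  obtain ⟨α, γ, hαγ, hne⟩ := hdep
  have h3 : α + γ = 0 := by
    have h4 := (hf.tendsto.const_mul α).add (hg.tendsto.const_mul γ)
    simp only [mul_one] at h4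
    refine tendsto_nhds_unique h4 ?_
    refine tendsto_const_nhds.congr fun x : ℝ => ?_
    rw [← mul_div_assoc, ← mul_div_assoc, ← add_div, hαγ, zero_div]
  have hα : α ≠ 0 := fun h => hne h (by rw [h, zero_add] at h3; exact h3)
  funext t
  have h4 := hαγ t
  have h5 : α * (f t - g t) = 0 := by linear_combination h4 - g t * h3
  exact sub_eq_zero.mp ((mul_eq_zero.mp h5).resolve_left hα)

theorem IsSubdominantSolution.leading {Φ : ℂ → (Fin m → ℂ) → ℂ} (h : IsSubdominantSolution m Φ)
    (a : Fin m → ℂ) {θ : ℝ} (hθ : θ < 3 * Real.pi / m) : ∃ C R : ℝ, ∀ t : ℂ, |t.im| ≤ θ → R ≤ t.re →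
      ‖Φ t a / lead m a t - 1‖ ≤ C * Real.exp (-(step m * t.re)) := by
  obtain ⟨φ, hφ0, hφ⟩ := h.asymptotic
  obtain ⟨C, R, hCR⟩ := hφ θ hθ {a} isCompact_singleton 1
  refine ⟨C, R, fun t h1 h2 => ?_⟩
  simpa [hφ0, lead] using hCR a rfl t h1 h2

theorem IsSubdominantSolution.isNormalized (hm : 0 < m) {Φ : ℂ → (Fin m → ℂ) → ℂ}
    (h : IsSubdominantSolution m Φ) (a : Fin m → ℂ) : IsNormalized m a (fun t => Φ t a) := by
  refine ⟨h.isSolution a, h.leading a ?_⟩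
  have hmR : (0 : ℝ) < m := Nat.cast_pos.mpr hm
  exact div_lt_div_of_pos_right (by linarith [Real.pi_gt_three]) hmR

theorem IsSubdominantSolution.unique (hm : 0 < m) {Φ Ψ : ℂ → (Fin m → ℂ) → ℂ}
    (h : IsSubdominantSolution m Φ) (h' : IsSubdominantSolution m Ψ) : Φ = Ψ := by
  funext t a
  exact congrFun ((h.isNormalized hm a).unique hm (h'.isNormalized hm a)) t

end Uniqueness

/-! ### Existence of Φ_0 and its holomorphy in a. -/

section Existence

variable {m : ℕ}

/-- Φ is chosen separately for each a. By uniqueness it coincides with every local family, whatever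
its direction b and its ball of parameters, so it inherits all their expansions and their holomorphy
in a. -/
theorem exists_subdominantSolution (hm : 0 < m) : ∃ Φ : ℂ → (Fin m → ℂ) → ℂ,
    IsSubdominantSolution m Φ ∧ ∀ t, Differentiable ℂ (Φ t) := by
  have hmR : (0 : ℝ) < m := Nat.cast_pos.mpr hm
  have hpi := Real.pi_gt_three
  have hs : (step m : ℂ) ≠ 0 := Complex.ofReal_ne_zero.mpr (step_pos m).ne'
  obtain ⟨φ, hφ0, hφ⟩ := exists_formal_solution (s := step m) (μ := m / 2) hs (pole_pos m hm).ne'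
    (ρ := rhoPoly m) (tauPoly_coeff_zero m)
  have hnorm : ∀ (b δ ρ R : ℝ) (f : ℂ → (Fin m → ℂ) → ℂ), 1 / 2 + |b| ≤ Real.pi - δ →
      (∀ a ∈ Metric.ball 0 ρ, IsSolution m a (fun t => f t a)) →
      (∀ N : ℕ, ∃ K, ∀ t : ℂ, |(m : ℝ) / 2 * t.im - b| ≤ Real.pi - δ → R ≤ t.re →
        ∀ a ∈ Metric.ball 0 ρ, ‖f t a / lead m a t - ∑ n ∈ Finset.range N,
            MvPolynomial.eval a (φ n) * Complex.exp (-((step m : ℂ) * (n : ℂ) * t))‖ ≤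
          K * Real.exp (-(step m * (N : ℝ) * t.re))) →
      ∀ a ∈ Metric.ball 0 ρ, IsNormalized m a (fun t => f t a) := by
    intro b δ ρ R f hb hf hasym a ha
    obtain ⟨K, hK⟩ := hasym 1
    refine ⟨hf a ha, K, R, fun t ht hR => ?_⟩
    have h1 : |(m : ℝ) / 2 * t.im - b| ≤ Real.pi - δ := by
      refine (abs_sub _ _).trans (le_trans (add_le_add ?_ le_rfl) hb)
      rw [abs_mul, abs_of_pos (by positivity)]
      calc (m : ℝ) / 2 * |t.im| ≤ (m : ℝ) / 2 * (1 / m) :=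
            mul_le_mul_of_nonneg_left ht (by positivity)
        _ = 1 / 2 := by field_simp
    simpa [hφ0] using hK t h1 hR a ha
  have hbase : ∀ ρ : ℝ, ∃ f : ℂ → (Fin m → ℂ) → ℂ,
      (∀ a ∈ Metric.ball 0 ρ, IsNormalized m a (fun t => f t a)) ∧
      ∀ t, DifferentiableOn ℂ (f t) (Metric.ball 0 ρ) := by
    intro ρ
    obtain ⟨R, f, hf, hfd, hasym⟩ := exists_sector_solution hm (b := 0) (δ := Real.pi / 4) (by simp)
      (by positivity) (by linarith) ρ hφ0 hφ
    exact ⟨f, hnorm 0 (Real.pi / 4) ρ R f (by rw [abs_zero]; linarith) hf hasym, hfd⟩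
  have hex : ∀ a : Fin m → ℂ, ∃ f, IsNormalized m a f := by
    intro a
    obtain ⟨f, hf, -⟩ := hbase (‖a‖ + 1)
    exact ⟨_, hf a (by simp)⟩
  choose Φ hΦ using hex
  refine ⟨fun t a => Φ a t, ⟨fun a => (hΦ a).1, φ, hφ0, ?_⟩, ?_⟩
  · intro θ hθ K hK N
    obtain ⟨ρ, hρ⟩ := hK.isBounded.subset_ball (0 : Fin m → ℂ)
    -- η measures the gap left to the full sector in the angle (m/2) arg x. For b = π/2 - δ the
    -- sector of angles runs from -π/2 to 3π/2 - 2δ, so δ ≤ η/2 lets it cover the upper half; b =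
    -- -(π/2 - δ) covers the lower half.
    set η : ℝ := 3 * Real.pi / 2 - (m : ℝ) / 2 * θ with hη
    have hη0 : 0 < η := by
      rw [lt_div_iff₀ hmR] at hθ
      rw [hη]; linarith
    set δ : ℝ := min (η / 2) (Real.pi / 4) with hδ
    have hδ0 : 0 < δ := lt_min (by linarith) (by linarith)
    have hδ1 : δ ≤ η / 2 := min_le_left _ _
    have hδ2 : δ ≤ Real.pi / 4 := min_le_right _ _
    have hsec : ∀ b : ℝ, |b| = Real.pi / 2 - δ → ∃ C R : ℝ, ∀ a ∈ K, ∀ t : ℂ,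
        |(m : ℝ) / 2 * t.im - b| ≤ Real.pi - δ → R ≤ t.re → ‖Φ a t / lead m a t -
          ∑ n ∈ Finset.range N,
            MvPolynomial.eval a (φ n) * Complex.exp (-((step m : ℂ) * (n : ℂ) * t))‖ ≤
          C * Real.exp (-(step m * (N : ℝ) * t.re)) := by
      intro b hb
      have hcos : 0 < Real.cos b := by
        rw [← Real.cos_abs, hb, Real.cos_pi_div_two_sub]
        exact Real.sin_pos_of_pos_of_lt_pi hδ0 (by linarith)
      obtain ⟨R, f, hf, -, hasym⟩ := exists_sector_solution hm hcos hδ0 (by linarith) ρ hφ0 hφ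
      have hfn := hnorm b δ ρ R f (by rw [hb]; linarith) hf hasym
      obtain ⟨C, hC⟩ := hasym N
      refine ⟨C, R, fun a ha t ht hR => ?_⟩
      have := congrFun ((hΦ a).unique hm (hfn a (hρ ha))) t
      rw [this]
      exact hC t ht hR a (hρ ha)
    have hb0 : 0 ≤ Real.pi / 2 - δ := by linarith
    obtain ⟨C₁, R₁, h₁⟩ := hsec (Real.pi / 2 - δ) (abs_of_nonneg hb0)
    obtain ⟨C₂, R₂, h₂⟩ := hsec (-(Real.pi / 2 - δ)) (by rw [abs_neg, abs_of_nonneg hb0])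
    refine ⟨max C₁ C₂, max R₁ R₂, fun a ha t ht hR => ?_⟩
    have hE : 0 ≤ Real.exp (-(step m * (N : ℝ) * t.re)) := (Real.exp_pos _).le
    have ht' : (m : ℝ) / 2 * |t.im| ≤ 3 * Real.pi / 2 - η := by
      have := mul_le_mul_of_nonneg_left ht (by positivity : 0 ≤ (m : ℝ) / 2)
      rw [hη]; linarith
    rcases le_total 0 t.im with h | h
    · rw [abs_of_nonneg h] at ht'
      have h3 : 0 ≤ (m : ℝ) / 2 * t.im := by positivity
      refine (h₁ a ha t ?_ ((le_max_left _ _).trans hR)).trans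
        (mul_le_mul_of_nonneg_right (le_max_left _ _) hE)
      rw [abs_le]; constructor <;> linarith
    · rw [abs_of_nonpos h] at ht'
      have h3 : 0 ≤ (m : ℝ) / 2 * -t.im := mul_nonneg (by positivity) (by linarith)
      refine (h₂ a ha t ?_ ((le_max_right _ _).trans hR)).trans
        (mul_le_mul_of_nonneg_right (le_max_right _ _) hE)
      rw [abs_le]; constructor <;> linarith
  · intro t a
    obtain ⟨f, hf, hfd⟩ := hbase (‖a‖ + 1)
    have hmem : Metric.ball (0 : Fin m → ℂ) (‖a‖ + 1) ∈ 𝓝 a := Metric.isOpen_ball.mem_nhds (by simp)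
    refine ((hfd t).differentiableAt hmem).congr_of_eventuallyEq ?_
    filter_upwards [hmem] with a' ha'
    exact congrFun ((hΦ a').unique hm (hf a' ha')) t

end Existence

end PolynomialNotation

/-! ### The rotated solutions Φ_k and their independence. -/

section Rotation

variable {m : ℕ} {ε : ℤ}

theorem isSubdominantSolution_Φ₀ (hm : 0 < m) : IsSubdominantSolution m (Φ₀ m) :=
  Classical.epsilon_spec (p := IsSubdominantSolution m)
    ((exists_subdominantSolution hm).imp fun _ h => h.1)

theorem differentiable_Φ₀ (hm : 0 < m) (t : ℂ) : Differentiable ℂ (Φ₀ m t) := by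
  obtain ⟨Φ, h, hd⟩ := exists_subdominantSolution hm
  rw [(isSubdominantSolution_Φ₀ hm).unique hm h]
  exact hd t

theorem mul_logω (hm : 0 < m) : (m : ℂ) * logω m ε = ε * (2 * Real.pi * Complex.I) := by
  have hm' : (m : ℂ) ≠ 0 := Nat.cast_ne_zero.mpr hm.ne'
  rw [logω]; field_simp

theorem ω_pow (hm : 0 < m) : ω m ε ^ m = 1 := by
  rw [ω, ← Complex.exp_nat_mul, mul_logω hm, Complex.exp_int_mul_two_pi_mul_I]

theorem ω_ne_zero : ω m ε ≠ 0 := Complex.exp_ne_zero _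

theorem exp_mul_logω (k : ℤ) : Complex.exp ((k : ℂ) * logω m ε) = ω m ε ^ k :=
  Complex.exp_int_mul _ _

theorem qsmul_qsmul (c d : ℂ) (a : Fin m → ℂ) : qsmul c (qsmul d a) = qsmul (c * d) a := by
  funext i
  simp only [qsmul, mul_pow]; ring

theorem qsmul_one (a : Fin m → ℂ) : qsmul 1 a = a := by
  funext i; simp [qsmul]

theorem differentiable_qsmul (c : ℂ) : Differentiable ℂ (fun a : Fin m → ℂ => qsmul c a) := by
  unfold qsmul; fun_prop

/-- P_m is quasi-homogeneous of degree m, and c^m = 1. As x² d²/dx² is invariant under scaling, the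
equation is preserved. -/
theorem P_qsmul {c : ℂ} (hc : c ^ m = 1) (a : Fin m → ℂ) (x : ℂ) :
    P m (qsmul c a) (c * x) = P m a x := by
  unfold P qsmul
  rw [mul_pow, hc, one_mul]
  congr 1
  refine Finset.sum_congr rfl fun i _ => ?_
  have h : c ^ ((i : ℕ) + 1) * c ^ (m - 1 - (i : ℕ)) = 1 := by
    rw [← pow_add, ← hc]; congr 1; have := i.2; omega
  rw [mul_pow]
  linear_combination a i * x ^ (m - 1 - (i : ℕ)) * h

/-- This reduces facts about any index to index 0 with rotated parameters. -/
theorem Φk_add (k j : ℤ) (t : ℂ) (a : Fin m → ℂ) :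
    Φk m ε (k + j) t a = Φk m ε j (t + k * logω m ε) (qsmul (ω m ε ^ k) a) := by
  rw [Φk, Φk, qsmul_qsmul, ← zpow_add₀ ω_ne_zero, add_comm j k]
  congr 1
  push_cast; ring

theorem Φk_add_m (hm : 0 < m) (k : ℤ) (t : ℂ) (a : Fin m → ℂ) :
    Φk m ε k (t + m * logω m ε) a = Φk m ε (m + k) t a := by
  rw [Φk_add, zpow_natCast, ω_pow hm, qsmul_one, Int.cast_natCast]

theorem isSolution_Φk (hm : 0 < m) (k : ℤ) (a : Fin m → ℂ) :
    IsSolution m a (fun t => Φk m ε k t a) := by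
  set a' := qsmul (ω m ε ^ k) a with ha'
  set κ := (k : ℂ) * logω m ε with hκ
  have hc : Complex.exp κ = ω m ε ^ k := exp_mul_logω k
  have hcm : (ω m ε ^ k) ^ m = 1 := by
    rw [← zpow_natCast, zpow_comm, zpow_natCast, ω_pow hm, one_zpow]
  have hp := ((isSubdominantSolution_Φ₀ hm).isSolution a').isPair
  refine IsPair.isSolution (v := fun t => ω m ε ^ k * dx (fun t => Φ₀ m t a') (t + κ)) fun t => ?_
  have hadd : HasDerivAt (fun t => t + κ) 1 t := (hasDerivAt_id t).add_const κ
  have hω : ω m ε ^ k ≠ 0 := zpow_ne_zero _ ω_ne_zero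
  constructor
  · refine ((hp (t + κ)).1.comp t hadd).congr_deriv ?_
    rw [Complex.exp_add, hc]; ring
  · refine (((hp (t + κ)).2.comp t hadd).const_mul (ω m ε ^ k)).congr_deriv ?_
    rw [Complex.exp_add, hc, mul_comm (Complex.exp t), P_qsmul hcm, neg_add, Complex.exp_add,
      Complex.exp_neg κ, hc]
    simp only [Φk]
    field_simp
    rfl

theorem differentiable_Φk (hm : 0 < m) (k : ℤ) (t : ℂ) :
    Differentiable ℂ (fun a : Fin m → ℂ => Φk m ε k t a) :=
  (differentiable_Φ₀ hm _).comp (differentiable_qsmul _)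

/-- On the ray arg x = -ε·2π/m, Φ_0 is still equivalent to its leading term, which blows up there,
whereas Φ_1 is Φ_0 on the positive axis for the parameters ω · a and tends to 0. Dividing a relation
by the leading term gives α = 0; then γ = 0 because Φ_1 is not zero. -/
theorem indep_Φ₀ (hm : 0 < m) (hε : ε = 1 ∨ ε = -1) (a : Fin m → ℂ) :
    Indep (fun t => Φk m ε 0 t a) (fun t => Φk m ε 1 t a) := by
  intro α γ hαγ
  have hmR : (0 : ℝ) < m := Nat.cast_pos.mpr hm
  have hm' : (m : ℂ) ≠ 0 := Nat.cast_ne_zero.mpr hm.ne'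
  have hpi := Real.pi_pos
  have hΦ := isSubdominantSolution_Φ₀ hm
  set a' : Fin m → ℂ := qsmul (ω m ε) a with ha'
  -- For this argument (m/2) v = -επ, so the cosine is -1; |v| is inside the sector of validity
  -- 3π/m; and adding `logω` returns to the positive axis.
  set v : ℝ := -(ε * (2 * Real.pi / m)) with hv
  have hv1 : |v| = 2 * Real.pi / m := by
    have h := div_nonneg (mul_nonneg zero_le_two hpi.le) hmR.le
    rcases hε with rfl | rfl <;> simpa [hv] using h
  have hcos : Real.cos ((m : ℝ) / 2 * v) < 0 := by
    have h1 : (m : ℝ) / 2 * v = -(ε * Real.pi) := by rw [hv]; field_simp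
    rw [h1]
    rcases hε with rfl | rfl <;> simp
  have hline : ∀ x : ℝ, (x : ℂ) + v * Complex.I + logω m ε = x := by
    intro x
    rw [logω, hv]; push_cast; field_simp; ring
  have h0 : ∀ t, Φk m ε 0 t a = Φ₀ m t a := fun t => by simp [Φk, qsmul_one]
  have h1 : ∀ t, Φk m ε 1 t a = Φ₀ m (t + logω m ε) a' := fun t => by simp [Φk, ha']
  obtain ⟨C, R, hCR⟩ := hΦ.leading a (θ := 2 * Real.pi / m)
    (div_lt_div_of_pos_right (by linarith) hmR)
  have hf : Tendsto (fun x : ℝ => Φ₀ m (x + v * Complex.I) a / lead m a (x + v * Complex.I)) atTop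
      (𝓝 1) := by
    rw [tendsto_iff_norm_sub_tendsto_zero]
    refine squeeze_zero' (Eventually.of_forall fun _ => norm_nonneg _) ?_
      (tendsto_exp_step (m := m) C)
    filter_upwards [eventually_ge_atTop R] with x hx
    have := hCR (x + v * Complex.I) (by simp [hv1]) (by simpa using hx)
    simpa using this
  have hg := (hΦ.isNormalized hm a').tendsto
  have hg0 : Tendsto (fun x : ℝ => Φ₀ m x a') atTop (𝓝 0) := by
    have h2 := tendsto_lead_zero hm a' (v := 0) (by simp)
    simp only [Complex.ofReal_zero, zero_mul, add_zero] at h2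
    have h3 := hg.mul (tendsto_zero_iff_norm_tendsto_zero.mpr h2)
    rw [mul_zero] at h3
    exact h3.congr fun x => div_mul_cancel₀ _ (lead_ne_zero _ _)
  have hinv : Tendsto (fun x : ℝ => (lead m a (x + v * Complex.I))⁻¹) atTop (𝓝 0) := by
    rw [tendsto_zero_iff_norm_tendsto_zero]
    simp only [norm_inv]
    exact tendsto_inv_atTop_zero.comp (tendsto_lead_atTop hm a hcos)
  have hα : α = 0 := by
    have h2 := (hf.const_mul α).add ((hg0.const_mul γ).mul hinv)
    simp only [mul_one, mul_zero, add_zero] at h2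
    refine tendsto_nhds_unique h2 (tendsto_const_nhds.congr fun x : ℝ => ?_)
    have h3 := hαγ (x + v * Complex.I)
    simp only [h0, h1, hline] at h3
    rw [div_eq_mul_inv, ← mul_assoc, ← add_mul, h3, zero_mul]
  refine ⟨hα, ?_⟩
  have h2 := hg.const_mul γ
  rw [mul_one] at h2
  refine tendsto_nhds_unique h2 (tendsto_const_nhds.congr fun x : ℝ => ?_)
  have h3 := hαγ (x + v * Complex.I)
  simp only [h1, hline, hα, zero_mul, zero_add] at h3
  rw [← mul_div_assoc, h3, zero_div]

theorem indep_Φk (hm : 0 < m) (hε : ε = 1 ∨ ε = -1) (k : ℤ) (a : Fin m → ℂ) :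
    Indep (fun t => Φk m ε k t a) (fun t => Φk m ε (k + 1) t a) := by
  intro α γ h
  refine indep_Φ₀ hm hε (qsmul (ω m ε ^ k) a) α γ fun t => ?_
  have h1 := h (t - k * logω m ε)
  have h2 := Φk_add (ε := ε) k 0 (t - k * logω m ε) a
  simp only [Φk_add k 1, sub_add_cancel] at h1
  rw [add_zero, sub_add_cancel] at h2
  rwa [h2] at h1

theorem indep_Φvec (hm : 0 < m) (hε : ε = 1 ∨ ε = -1) (k : ℤ) (a : Fin m → ℂ) :
    Indep (fun t => Φk m ε (k - 1) t a) (fun t => Φk m ε k t a) := by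
  have := indep_Φk hm hε (k - 1) a
  rwa [sub_add_cancel] at this

end Rotation

/-! ### Stokes–Sibuya matrices and monodromy at infinity. -/

section Matrices

variable {m : ℕ} {ε : ℤ}

theorem existsUnique_stokesCoeffs (hm : 0 < m) (hε : ε = 1 ∨ ε = -1) (k : ℤ) (a : Fin m → ℂ) :
    ∃! c : ℂ × ℂ, IsStokesCoeffs m ε k a c :=
  (isSolution_Φk hm k a).existsUnique_comb (isSolution_Φk hm (k + 1) a) (indep_Φk hm hε k a)
    (isSolution_Φk hm (k - 1) a)

theorem isStokesCoeffs (hm : 0 < m) (hε : ε = 1 ∨ ε = -1) (k : ℤ) (a : Fin m → ℂ) :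
    IsStokesCoeffs m ε k a (stokesCoeffs m ε k a) :=
  Classical.epsilon_spec (existsUnique_stokesCoeffs hm hε k a).exists

theorem matrix_eq_of_mulVec_Φvec (hm : 0 < m) (hε : ε = 1 ∨ ε = -1) (k : ℤ) (a : Fin m → ℂ)
    {M N : Matrix (Fin 2) (Fin 2) ℂ}
    (h : ∀ t, M.mulVec (Φvec m ε k t a) = N.mulVec (Φvec m ε k t a)) : M = N := by
  have hrow : ∀ i, M i 0 - N i 0 = 0 ∧ M i 1 - N i 1 = 0 := by
    intro i
    refine indep_Φvec hm hε k a _ _ fun t => ?_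
    have h1 := congrFun (h t) i
    simp only [Matrix.mulVec, dotProduct, Fin.sum_univ_two, Φvec, Matrix.cons_val_zero,
      Matrix.cons_val_one] at h1
    linear_combination h1
  ext i j
  fin_cases j
  · exact sub_eq_zero.mp (hrow i).1
  · exact sub_eq_zero.mp (hrow i).2

theorem existsUnique_monodromyMatrix (hm : 0 < m) (hε : ε = 1 ∨ ε = -1) (k : ℤ)
    (a : Fin m → ℂ) : ∃! M : Matrix (Fin 2) (Fin 2) ℂ, IsMonodromyMatrix m ε k a M := by
  have hcomb : ∀ j : ℤ, ∃ c : ℂ × ℂ, ∀ t, Φk m ε j (t + m * logω m ε) a =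
      c.1 * Φk m ε (k - 1) t a + c.2 * Φk m ε k t a := by
    intro j
    simp only [Φk_add_m hm]
    exact ((isSolution_Φk hm (k - 1) a).existsUnique_comb (isSolution_Φk hm k a)
      (indep_Φvec hm hε k a) (isSolution_Φk hm (m + j) a)).exists
  obtain ⟨c, hc⟩ := hcomb (k - 1)
  obtain ⟨d, hd⟩ := hcomb k
  refine ⟨!![c.1, c.2; d.1, d.2], fun t => ?_, fun N hN => ?_⟩
  · ext i
    fin_cases i <;> simp [Φvec, Matrix.mulVec, dotProduct, Fin.sum_univ_two, hc, hd]
  · refine matrix_eq_of_mulVec_Φvec hm hε k a fun t => ?_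
    rw [← hN t]
    ext i
    fin_cases i <;> simp [Φvec, Matrix.mulVec, dotProduct, Fin.sum_univ_two, hc, hd]

theorem isMonodromyMatrix (hm : 0 < m) (hε : ε = 1 ∨ ε = -1) (k : ℤ) (a : Fin m → ℂ) :
    IsMonodromyMatrix m ε k a (monodromyMatrix m ε k a) :=
  Classical.epsilon_spec (existsUnique_monodromyMatrix hm hε k a).exists

theorem Φvec_eq (k : ℤ) (t : ℂ) (a : Fin m → ℂ) :
    Φvec m ε k t a = Φvec m ε 0 (t + k * logω m ε) (qsmul (ω m ε ^ k) a) := by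
  have h1 := Φk_add (ε := ε) k (0 - 1) t a
  have h2 := Φk_add (ε := ε) k 0 t a
  rw [add_zero] at h2
  rw [show k + (0 - 1) = k - 1 by ring] at h1
  rw [Φvec, Φvec, h1, h2]

/-- The pair of index k is the pair of index 0 at the rotated point, and rotation commutes with the
turn around infinity; uniqueness of the matrix does the rest. -/
theorem monodromyMatrix_eq (hm : 0 < m) (hε : ε = 1 ∨ ε = -1) (k : ℤ) (a : Fin m → ℂ) :
    monodromyMatrix m ε k a = monodromyMatrix m ε 0 (qsmul (ω m ε ^ k) a) := by
  refine (existsUnique_monodromyMatrix hm hε k a).unique (isMonodromyMatrix hm hε k a) fun t => ?_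
  rw [Φvec_eq, Φvec_eq k t, add_right_comm]
  exact isMonodromyMatrix hm hε 0 _ _

theorem Φvec_stokes (hm : 0 < m) (hε : ε = 1 ∨ ε = -1) (k : ℤ) (t : ℂ) (a : Fin m → ℂ) :
    Φvec m ε k t a = (stokesMatrix m ε k a).mulVec (Φvec m ε (k + 1) t a) := by
  have h := isStokesCoeffs hm hε k a t
  ext i
  fin_cases i <;> simp [Φvec, stokesMatrix, Matrix.mulVec, dotProduct, Fin.sum_univ_two, h]

theorem Φvec_stokes_prod (hm : 0 < m) (hε : ε = 1 ∨ ε = -1) (t : ℂ) (a : Fin m → ℂ) (n : ℕ) :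
    Φvec m ε 0 t a = (((List.range n).map (fun k : ℕ => stokesMatrix m ε (k : ℤ) a)).prod).mulVec
      (Φvec m ε n t a) := by
  induction n with
  | zero => simp
  | succ n ih =>
    rw [List.range_succ, List.map_append, List.prod_append, ih, Φvec_stokes hm hε n]
    rw [Matrix.mulVec_mulVec, List.map_singleton, List.prod_singleton, Nat.cast_succ]

/-- As ω^m · a = a, the turn x ↦ ω^m x changes the pair of index 0 into the pair of index m, which
the Stokes product carries back to index 0. The product with 𝔐_0 thus fixes an independent pair. -/
theorem stokes_prod_mul_monodromyMatrix (hm : 0 < m) (hε : ε = 1 ∨ ε = -1) (a : Fin m → ℂ) :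
    ((List.range m).map (fun k : ℕ => stokesMatrix m ε (k : ℤ) a)).prod *
      monodromyMatrix m ε 0 a = 1 := by
  refine matrix_eq_of_mulVec_Φvec hm hε 0 a fun t => ?_
  rw [← Matrix.mulVec_mulVec, ← isMonodromyMatrix hm hε 0 a t, Matrix.one_mulVec]
  have h := Φvec_eq (ε := ε) (m : ℤ) t a
  rw [zpow_natCast, ω_pow hm, qsmul_one, Int.cast_natCast] at h
  rw [← h]
  exact (Φvec_stokes_prod hm hε t a m).symm

theorem isUnit_monodromyMatrix (hm : 0 < m) (hε : ε = 1 ∨ ε = -1) (k : ℤ) (a : Fin m → ℂ) :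
    IsUnit (monodromyMatrix m ε k a) := by
  rw [monodromyMatrix_eq hm hε]
  exact IsUnit.of_mul_eq_one_right _ (stokes_prod_mul_monodromyMatrix hm hε _)

theorem differentiable_Φvec (hm : 0 < m) (k : ℤ) (t : ℂ) (i : Fin 2) :
    Differentiable ℂ (fun a : Fin m → ℂ => Φvec m ε k t a i) := by
  fin_cases i
  · exact differentiable_Φk hm (k - 1) t
  · exact differentiable_Φk hm k t

/-- Evaluating the defining relation at two points t₁, t₂ gives a linear system for each row. Its
determinant is holomorphic in a and nonzero near a₀, so Cramer's rule writes the entries as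
quotients of entire functions of a. -/
theorem differentiable_monodromyMatrix (hm : 0 < m) (hε : ε = 1 ∨ ε = -1) (k : ℤ) (i j : Fin 2) :
    Differentiable ℂ (fun a : Fin m → ℂ => monodromyMatrix m ε k a i j) := by
  intro a₀
  obtain ⟨t₁, t₂, hdet⟩ := (indep_Φvec hm hε k a₀).exists_det_ne_zero
  set f : ℂ → (Fin m → ℂ) → ℂ := fun t a => Φk m ε (k - 1) t a with hf
  set g : ℂ → (Fin m → ℂ) → ℂ := fun t a => Φk m ε k t a with hg
  set h : ℂ → (Fin m → ℂ) → ℂ := fun t a => Φvec m ε k (t + m * logω m ε) a i with hh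
  set D : (Fin m → ℂ) → ℂ := fun a => f t₁ a * g t₂ a - f t₂ a * g t₁ a with hD
  have hfd : ∀ t, Differentiable ℂ (f t) := fun t => differentiable_Φk hm (k - 1) t
  have hgd : ∀ t, Differentiable ℂ (g t) := fun t => differentiable_Φk hm k t
  have hhd : ∀ t, Differentiable ℂ (h t) := fun t => differentiable_Φvec hm k _ i
  have hDd : Differentiable ℂ D := ((hfd t₁).mul (hgd t₂)).sub ((hfd t₂).mul (hgd t₁))
  have hrel : ∀ t a, h t a =
      monodromyMatrix m ε k a i 0 * f t a + monodromyMatrix m ε k a i 1 * g t a := by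
    intro t a
    have := congrFun (isMonodromyMatrix hm hε k a t) i
    simp only [Matrix.mulVec, dotProduct, Fin.sum_univ_two] at this
    exact this
  have hne : ∀ᶠ a in 𝓝 a₀, D a ≠ 0 := hDd.continuous.continuousAt.eventually_ne hdet
  have hquot : ∀ n : (Fin m → ℂ) → ℂ, Differentiable ℂ n →
      DifferentiableAt ℂ (fun a => n a * (D a)⁻¹) a₀ := fun n hn =>
    (hn a₀).mul ((hDd a₀).fun_inv hdet)
  have hj : j = 0 ∨ j = 1 := by fin_cases j <;> simp
  rcases hj with rfl | rfl
  · refine (hquot (fun a => h t₁ a * g t₂ a - h t₂ a * g t₁ a)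
      (((hhd t₁).mul (hgd t₂)).sub ((hhd t₂).mul (hgd t₁)))).congr_of_eventuallyEq ?_
    filter_upwards [hne] with a ha
    rw [hrel, hrel, eq_mul_inv_iff_mul_eq₀ ha]
    ring
  · refine (hquot (fun a => f t₁ a * h t₂ a - f t₂ a * h t₁ a)
      (((hfd t₁).mul (hhd t₂)).sub ((hfd t₂).mul (hhd t₁)))).congr_of_eventuallyEq ?_
    filter_upwards [hne] with a ha
    rw [hrel, hrel, eq_mul_inv_iff_mul_eq₀ ha]
    ring

end Matrices

end StokesSibuya

theorem theorem2p9 (m : ℕ) (hm : 0 < m) (ε : ℤ) (hε : ε = 1 ∨ ε = -1) :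
    (∃! Φ : ℂ → (Fin m → ℂ) → ℂ, StokesSibuya.IsSubdominantSolution m Φ) ∧
    (∀ (k : ℤ) (a : Fin m → ℂ), ∃! c : ℂ × ℂ, StokesSibuya.IsStokesCoeffs m ε k a c) ∧
    (∀ (k : ℤ) (a : Fin m → ℂ),
      ∃! M : Matrix (Fin 2) (Fin 2) ℂ, StokesSibuya.IsMonodromyMatrix m ε k a M) ∧
    (∀ (k : ℤ) (a : Fin m → ℂ), IsUnit (StokesSibuya.monodromyMatrix m ε k a)) ∧
    (∀ (k : ℤ) (i j : Fin 2),
      Differentiable ℂ (fun a : Fin m → ℂ => StokesSibuya.monodromyMatrix m ε k a i j)) ∧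
    (∀ (k : ℤ) (a : Fin m → ℂ),
      StokesSibuya.monodromyMatrix m ε k a =
        StokesSibuya.monodromyMatrix m ε 0 (StokesSibuya.qsmul (StokesSibuya.ω m ε ^ k) a)) ∧
    (∀ a : Fin m → ℂ,
      ((List.range m).map (fun k : ℕ => StokesSibuya.stokesMatrix m ε (k : ℤ) a)).prod =
        (StokesSibuya.monodromyMatrix m ε 0 a)⁻¹) :=
  ⟨⟨StokesSibuya.Φ₀ m, StokesSibuya.isSubdominantSolution_Φ₀ hm, fun _ h =>
      h.unique hm (StokesSibuya.isSubdominantSolution_Φ₀ hm)⟩,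
    StokesSibuya.existsUnique_stokesCoeffs hm hε,
    StokesSibuya.existsUnique_monodromyMatrix hm hε,
    StokesSibuya.isUnit_monodromyMatrix hm hε,
    StokesSibuya.differentiable_monodromyMatrix hm hε,
    StokesSibuya.monodromyMatrix_eq hm hε,
    fun a => (Matrix.inv_eq_left_inv
      (StokesSibuya.stokes_prod_mul_monodromyMatrix hm hε a)).symm⟩
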